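/- Let $\mathfrak g$ be a finite-dimensional simple Lie algebra over $\mathbb C$ (in the application, the Langlands dual ${}^L\mathfrak g$ of a given simple Lie algebra), with Cartan decomposition $\mathfrak g=\mathfrak n_+\oplus\mathfrak h\oplus\mathfrak n_-$ and Chevalley generators $e_i,h_i,f_i$; put $\mathfrak b_\pm=\mathfrak h\oplus\mathfrak n_\pm$, and let $N_+$ be the unipotent group of $\mathfrak n_+$. Fix a coordinate $t$ on the formal disc. An oper on the formal punctured disc $D^\times$ is an orbit of operators $\partial_t-\sum_i f_i+v(t)$, $v(t)\in\mathfrak b_+((t))$, under gauge transformations $\partial_t+A\mapsto g(\partial_t+A)g^{-1}$, $g\in N_+((t))$. Let $\mathrm{Op}(D^\times)$ be the set of opers, let $\mathrm{Conn}(D^\times)$ be the set of operators $\partial_t+u(t)$ with $u(t)\in\mathfrak h((t))$, and let the Miura transformation $\mu:\mathrm{Conn}(D^\times)\to\mathrm{Op}(D^\times)$ send $\partial_t+u$ to the class of $\partial_t-\sum_i f_i+u$. The Springer fibre of a nilpotent $x\in\mathfrak g$ is the set of Borel subalgebras of $\mathfrak g$ containing $x$. An oper is called nilpotent if it has a representative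 $\partial_t+A=\partial_t-\sum_i f_i+v(t)$ with $v(t)\in\mathfrak b_+[[t]]+t^{-1}\mathfrak n_+$; its residue $\mathrm{Res}(\rho)\in\mathfrak n_+$ is then the coefficient of $t^{-1}$ in such a representative. It is called regular if it has a representative with $v(t)\in\mathfrak b_+[[t]]$. **Lemma.** Let $\rho\in\mathrm{Op}(D^\times)$. 1. If $\rho$ is nilpotent, then the set $\mu^{-1}(\rho)$ is in bijection with the Springer fibre of $\mathrm{Res}(\rho)$ (for the residue of any representative $\partial_t+A$ as above). 2. If $\rho$ is regular, then $\mu^{-1}(\rho)$ is in bijection with the set of all Borel subalgebras of $\mathfrak g$, the flag variety. 3. More generally, let $\partial_t+A$ be any representative of $\rho$ and suppose that $\rho$ has a regular singularity and unipotent monodromy, in the form that an automorphism $k$ of the $\mathbb C((t))$-Lie algebra $\mathfrak g((t))$ carries $\partial_t+A$ to an operator $\partial_t+C$ with $C\in t^{-1}\mathfrak g[[t]]$ whose residue $x$ is nilpotent. Then $\mu^{-1}(\rho)$ is in bijection with the Springer fibre of $x$. In each case the bijection may be taken to be the following one (with $k=1$ in parts 1 and 2): for $\partial_t+u\in\mu^{-1}(\rho)$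 choose $g\in N_+((t))$ with $g(\partial_t-\sum_i f_i+u)g^{-1}=\partial_t+A$; then $\partial_t+u$ corresponds to the Borel subalgebra of $\mathfrak g$ formed by the values at $t=0$ of the elements of $k\,g\,\mathfrak b_-((t))\cap\mathfrak g[[t]]$. -/

import Mathlib

open scoped TensorProduct

noncomputable section

namespace MiuraOper

/-- The coefficientwise `ℂ`-algebra structure of `ℂ((t))`, preferred here to the (equal) one that
Mathlib finds through power series, since it is definitionally compatible with the module structure
of Laurent series. -/
instance laurentAlgebra : Algebra ℂ (LaurentSeries ℂ) := HahnSeries.instAlgebra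

instance laurentScalarTower : IsScalarTower ℂ (LaurentSeries ℂ) (LaurentSeries ℂ) :=
  @IsScalarTower.right ℂ (LaurentSeries ℂ) _ _ laurentAlgebra

section Loop

variable (𝔤 : Type*) [LieRing 𝔤] [LieAlgebra ℂ 𝔤]

/-- The formal loop algebra `𝔤((t)) = ℂ((t)) ⊗ 𝔤` of a (finite-dimensional) Lie algebra `𝔤`,
a Lie algebra over `ℂ((t))`. -/
abbrev Loop : Type _ := LaurentSeries ℂ ⊗[ℂ] 𝔤

variable {𝔤}

/-- The derivation `∂_t` of `𝔤((t))`, acting on coefficients. -/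
def loopDeriv : Loop 𝔤 →ₗ[ℂ] Loop 𝔤 :=
  (LaurentSeries.derivative ℂ : LaurentSeries ℂ →ₗ[ℂ] LaurentSeries ℂ).rTensor 𝔤

/-- The coefficient of `t ^ n` of an element of `𝔤((t))`. -/
def loopCoeff (n : ℤ) : Loop 𝔤 →ₗ[ℂ] 𝔤 :=
  (TensorProduct.lid ℂ 𝔤).toLinearMap ∘ₗ
    (HahnSeries.coeff.linearMap n : LaurentSeries ℂ →ₗ[ℂ] ℂ).rTensor 𝔤

/-- For a complex subspace `V ⊆ 𝔤`, the `ℂ((t))`-subspace `V((t)) ⊆ 𝔤((t))`. -/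
def loopSubmodule (V : Submodule ℂ 𝔤) : Submodule (LaurentSeries ℂ) (Loop 𝔤) :=
  V.baseChange (LaurentSeries ℂ)

/-- The covariant derivative `Y ↦ ∂_t Y + [A, Y]` on `𝔤((t))` of the operator `∂_t + A`. -/
def covDeriv (A Y : Loop 𝔤) : Loop 𝔤 := loopDeriv Y + ⁅A, Y⁆

/-- `g (∂_t + A) g⁻¹ = ∂_t + B`: the automorphism `g` of `𝔤((t))` carries the operator `∂_t + A`
to the operator `∂_t + B`. When the centre of `𝔤` is trivial, this determines `B` in terms of `g`
and `A`; for matrices it is the gauge transformation `B = g A g⁻¹ - (∂_t g) g⁻¹`. -/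
def IsGaugeTransform (g : Loop 𝔤 ≃ₗ[LaurentSeries ℂ] Loop 𝔤) (A B : Loop 𝔤) : Prop :=
  ∀ Y : Loop 𝔤, g (covDeriv A Y) = covDeriv B (g Y)

/-- The subspace `𝔤[[t]]` of `𝔤((t))`. -/
def integralLoops : Submodule ℂ (Loop 𝔤) := ⨅ (n : ℤ) (_ : n < 0), LinearMap.ker (loopCoeff n)

/-- The limit at `t = 0` of a `ℂ((t))`-subspace `W ⊆ 𝔤((t))`: the subspace of `𝔤` formed by the
constant terms of the elements of `W ∩ 𝔤[[t]]`. -/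
def limitAtZero (W : Submodule (LaurentSeries ℂ) (Loop 𝔤)) : Submodule ℂ 𝔤 :=
  (W.restrictScalars ℂ ⊓ integralLoops).map (loopCoeff 0)

end Loop

section Borel

variable {𝔤 : Type*} [LieRing 𝔤] [LieAlgebra ℂ 𝔤]

/-- A Borel subalgebra is a maximal solvable subalgebra. -/
def IsBorel (B : LieSubalgebra ℂ 𝔤) : Prop :=
  Maximal (fun C : LieSubalgebra ℂ 𝔤 => LieAlgebra.IsSolvable C) B

variable (𝔤) in
/-- The points of the flag variety: all Borel subalgebras. -/
def flagVariety : Set (LieSubalgebra ℂ 𝔤) := {B | IsBorel B}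

/-- The points of the Springer fibre of `x`: the Borel subalgebras that contain `x`. -/
def springerFiber (x : 𝔤) : Set (LieSubalgebra ℂ 𝔤) := {B | IsBorel B ∧ x ∈ B}

end Borel

section Oper

variable {𝔤 : Type*} [LieRing 𝔤] [LieAlgebra ℂ 𝔤] {ι : Type*} [Fintype ι]
  {𝔥 : LieSubalgebra ℂ 𝔤} (b : LieAlgebra.Basis ι 𝔥)

/-- `𝔫₊`, generated by the `e_i`. -/
def nPlus : LieSubalgebra ℂ 𝔤 := LieSubalgebra.lieSpan ℂ 𝔤 (Set.range b.e)

/-- `𝔫₋`, generated by the `f_i`. -/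
def nMinus : LieSubalgebra ℂ 𝔤 := LieSubalgebra.lieSpan ℂ 𝔤 (Set.range b.f)

/-- `𝔟₊ = 𝔥 ⊕ 𝔫₊`. -/
def bPlus : Submodule ℂ 𝔤 := 𝔥.toSubmodule ⊔ (nPlus b).toSubmodule

/-- `𝔟₋ = 𝔥 ⊕ 𝔫₋`. -/
def bMinus : Submodule ℂ 𝔤 := 𝔥.toSubmodule ⊔ (nMinus b).toSubmodule

/-- The constant loop `∑ f_i`. -/
def sumF : Loop 𝔤 := (1 : LaurentSeries ℂ) ⊗ₜ[ℂ] ∑ i, b.f i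

/-- The group `N₊((t))` in its adjoint representation on `𝔤((t))` (which is faithful on it):
it is generated by the exponentials of the nilpotent operators `ad X` with `X ∈ 𝔫₊((t))`. -/
def loopNPlus : Subgroup (Loop 𝔤 ≃ₗ[LaurentSeries ℂ] Loop 𝔤) :=
  Subgroup.closure {g | ∃ X ∈ loopSubmodule (nPlus b).toSubmodule,
    (g : Module.End (LaurentSeries ℂ) (Loop 𝔤)) =
      IsNilpotent.exp (LieAlgebra.ad (LaurentSeries ℂ) (Loop 𝔤) X)}

/-- The operators `∂_t - ∑ f_i + v(t)` with `v(t) ∈ 𝔟₊((t))`; the operator `∂_t + A` is recorded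
by `A`. -/
def OperConn : Type _ := {A : Loop 𝔤 // A + sumF b ∈ loopSubmodule (bPlus b)}

/-- Equivalence of the operators `∂_t - ∑ f_i + v(t)` under `N₊((t))`-valued gauge
transformations. -/
def gaugeSetoid : Setoid (OperConn b) where
  r A B := ∃ g ∈ loopNPlus b, IsGaugeTransform g A.1 B.1
  iseqv :=
    { refl := fun _ => ⟨1, one_mem _, fun _ => rfl⟩
      symm := by
        rintro A B ⟨g, hg, h⟩
        refine ⟨g⁻¹, inv_mem hg, fun Y => ?_⟩
        have h1 := h (g.symm Y)
        rw [LinearEquiv.apply_symm_apply] at h1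
        change g.symm (covDeriv B.1 Y) = covDeriv A.1 (g.symm Y)
        rw [← h1, LinearEquiv.symm_apply_apply]
      trans := by
        rintro A B C ⟨g, hg, h⟩ ⟨k, hk, h'⟩
        refine ⟨k * g, mul_mem hk hg, fun Y => ?_⟩
        change k (g (covDeriv A.1 Y)) = covDeriv C.1 (k (g Y))
        rw [h, h'] }

/-- The space `Op(D^×)` of opers on the formal punctured disc (with coordinate `t`). -/
def Oper : Type _ := Quotient (gaugeSetoid b)

variable {b} in
/-- The oper represented by an operator `∂_t - ∑ f_i + v(t)`. -/
def OperConn.toOper (A : OperConn b) : Oper b := Quotient.mk (gaugeSetoid b) A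

/-- The space `Conn(D^×)` of operators `∂_t + u(t)` with `u(t) ∈ 𝔥((t))`, recorded by `u`. These
are the connections on the `H`-bundle `Ω^ρ^∨` on `D^×`, trivialized by the coordinate `t`. -/
def Conn (𝔥 : LieSubalgebra ℂ 𝔤) : Type _ := {u : Loop 𝔤 // u ∈ loopSubmodule 𝔥.toSubmodule}

/-- The operator `∂_t - ∑ f_i + u(t)` attached to `∂_t + u(t)`. -/
def miuraConn (u : Conn 𝔥) : OperConn b :=
  ⟨u.1 - sumF b, by
    rw [sub_add_cancel]
    have h : loopSubmodule 𝔥.toSubmodule ≤ loopSubmodule (bPlus b) :=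
      Submodule.baseChange_mono _ le_sup_left
    exact h u.2⟩

/-- The Miura transformation `μ : Conn(D^×) → Op(D^×)`. -/
def miura (u : Conn 𝔥) : Oper b := (miuraConn b u).toOper

variable {b}

/-- `∂_t + A = ∂_t - ∑ f_i + v(t)` with `v(t) ∈ 𝔟₊[[t]] + t⁻¹ 𝔫₊`. (The negative coefficients of
`v` are those of `A`.) -/
def OperConn.IsNilpotentForm (A : OperConn b) : Prop :=
  (∀ n : ℤ, n < -1 → loopCoeff n A.1 = 0) ∧ loopCoeff (-1) A.1 ∈ nPlus b

/-- `∂_t + A = ∂_t - ∑ f_i + v(t)` with `v(t) ∈ 𝔟₊[[t]]`. -/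
def OperConn.IsRegularForm (A : OperConn b) : Prop :=
  ∀ n : ℤ, n < 0 → loopCoeff n A.1 = 0

/-- The residue of the operator `∂_t + A`: the coefficient of `t⁻¹`. -/
def OperConn.residue (A : OperConn b) : 𝔤 := loopCoeff (-1) A.1

/-- The fibre of the Miura transformation over an oper. -/
def miuraFiber (ρ : Oper b) : Set (Conn 𝔥) := {u | miura b u = ρ}

/-- The automorphism `k` of the Lie algebra `𝔤((t))` carries `∂_t + A` to an operator `∂_t + C` with
at most a simple pole whose residue is a nilpotent element of `𝔤`. Such `k` and `C` exist exactly
when `∂_t + A` has a regular singularity and unipotent monodromy (in the adjoint group). -/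
def IsUnipotentLogForm (A : OperConn b) (k : Loop 𝔤 ≃ₗ⁅LaurentSeries ℂ⁆ Loop 𝔤) (C : Loop 𝔤) :
    Prop :=
  IsGaugeTransform k.toLinearEquiv A.1 C ∧ (∀ n : ℤ, n < -1 → loopCoeff n C = 0) ∧
    IsNilpotent (LieAlgebra.ad ℂ 𝔤 (loopCoeff (-1) C))

/-- `B` is the limit at `t = 0` of `k 𝔅`, where `𝔅` is the Borel subalgebra of `𝔤((t))`, horizontal
for the operator `∂_t + A`, that corresponds to `u`: for a gauge transformation `g ∈ N₊((t))` with
`g (∂_t - ∑ f_i + u) g⁻¹ = ∂_t + A`, one has `𝔅 = g 𝔟₋((t))`. -/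
def IsLimitBorel (A : OperConn b) (k : Loop 𝔤 ≃ₗ⁅LaurentSeries ℂ⁆ Loop 𝔤) (u : Conn 𝔥)
    (B : LieSubalgebra ℂ 𝔤) : Prop :=
  ∃ g ∈ loopNPlus b, IsGaugeTransform g (miuraConn b u).1 A.1 ∧
    B.toSubmodule =
      limitAtZero (((loopSubmodule (bMinus b)).map g.toLinearMap).map k.toLinearEquiv.toLinearMap)

end Oper

end MiuraOper

end

open scoped TensorProduct

noncomputable section

namespace MiuraOper

/-! ### Brackets of subspaces and solvability -/

section Bracket

variable {k L : Type*} [Field k] [LieRing L] [LieAlgebra k L]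

/-- The subspace spanned by the brackets of elements of two subspaces. -/
def brk (P Q : Submodule k L) : Submodule k L :=
  Submodule.map₂ (LieModule.toEnd k L L : L →ₗ[k] Module.End k L) P Q

lemma lie_mem_brk {P Q : Submodule k L} {x y : L} (hx : x ∈ P) (hy : y ∈ Q) : ⁅x, y⁆ ∈ brk P Q :=
  Submodule.apply_mem_map₂ (LieModule.toEnd k L L : L →ₗ[k] Module.End k L) hx hy

lemma brk_le {P Q R : Submodule k L} : brk P Q ≤ R ↔ ∀ x ∈ P, ∀ y ∈ Q, ⁅x, y⁆ ∈ R :=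
  Submodule.map₂_le

lemma brk_mono {P P' Q Q' : Submodule k L} (h : P ≤ P') (h' : Q ≤ Q') : brk P Q ≤ brk P' Q' :=
  Submodule.map₂_le_map₂ h h'

/-- The derived series of a subspace. -/
def dser (P : Submodule k L) : ℕ → Submodule k L
  | 0 => P
  | n + 1 => brk (dser P n) (dser P n)

/-- A subspace is solvable if its derived series reaches zero. -/
def Solv (P : Submodule k L) : Prop := ∃ n, dser P n = ⊥

lemma dser_add (P : Submodule k L) (m n : ℕ) : dser P (m + n) = dser (dser P m) n := by
  induction n with
  | zero => rfl
  | succ n ih => rw [← add_assoc, dser, ih, dser]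

/-- An operator on subspaces that is lax with respect to brackets is lax for derived series. -/
lemma dser_le_of_lax {k' L' : Type*} [Field k'] [LieRing L'] [LieAlgebra k' L']
    (Ψ : Submodule k L → Submodule k' L') (h : ∀ P, brk (Ψ P) (Ψ P) ≤ Ψ (brk P P))
    (P : Submodule k L) (n : ℕ) : dser (Ψ P) n ≤ Ψ (dser P n) := by
  induction n with
  | zero => exact le_rfl
  | succ n ih => exact (brk_mono ih ih).trans (h _)

lemma Solv.of_lax {k' L' : Type*} [Field k'] [LieRing L'] [LieAlgebra k' L']
    (Ψ : Submodule k L → Submodule k' L') (h : ∀ P, brk (Ψ P) (Ψ P) ≤ Ψ (brk P P))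
    (h0 : Ψ ⊥ = ⊥) {P : Submodule k L} (hP : Solv P) : Solv (Ψ P) := by
  obtain ⟨n, hn⟩ := hP
  refine ⟨n, le_bot_iff.mp ?_⟩
  rw [← h0, ← hn]
  exact dser_le_of_lax Ψ h P n

lemma dser_mono {P Q : Submodule k L} (h : P ≤ Q) (n : ℕ) : dser P n ≤ dser Q n := by
  induction n with
  | zero => exact h
  | succ n ih => exact brk_mono ih ih

lemma Solv.mono {P Q : Submodule k L} (h : P ≤ Q) (hQ : Solv Q) : Solv P := by
  obtain ⟨n, hn⟩ := hQ
  exact ⟨n, le_bot_iff.mp (hn ▸ dser_mono h n)⟩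

lemma Solv.map {L' : Type*} [LieRing L'] [LieAlgebra k L'] (φ : L →ₗ⁅k⁆ L') {P : Submodule k L}
    (hP : Solv P) : Solv (P.map (φ : L →ₗ[k] L')) := by
  refine Solv.of_lax (fun Q => Q.map (φ : L →ₗ[k] L')) (fun Q => brk_le.mpr ?_) (by simp) hP
  rintro - ⟨x, hx, rfl⟩ - ⟨y, hy, rfl⟩
  exact ⟨⁅x, y⁆, lie_mem_brk hx hy, by simp⟩

lemma dser_le_self {P : Submodule k L} (hP : brk P P ≤ P) (n : ℕ) : dser P n ≤ P := by
  induction n with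
  | zero => exact le_rfl
  | succ n ih => exact (brk_mono ih ih).trans hP

lemma brk_sup_sup {B P : Submodule k L} (hP : brk P P ≤ P) (h : brk B P ≤ P) :
    brk (B ⊔ P) (B ⊔ P) ≤ brk B B ⊔ P := by
  rw [brk_le]
  intro x hx y hy
  obtain ⟨a, ha, p, hp, rfl⟩ := Submodule.mem_sup.mp hx
  obtain ⟨b, hb, q, hq, rfl⟩ := Submodule.mem_sup.mp hy
  rw [lie_add, add_lie, add_lie]
  refine add_mem (add_mem (Submodule.mem_sup_left (lie_mem_brk ha hb))
    (Submodule.mem_sup_right ?_)) (add_mem (Submodule.mem_sup_right (h (lie_mem_brk ha hq)))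
    (Submodule.mem_sup_right (hP (lie_mem_brk hp hq))))
  rw [← lie_skew]
  exact neg_mem (h (lie_mem_brk hb hp))

/-- A solvable subalgebra normalizing another generates a solvable subalgebra with it. -/
lemma Solv.sup {B P : Submodule k L} (hB : Solv B) (hBB : brk B B ≤ B) (hP : Solv P)
    (hPP : brk P P ≤ P) (h : brk B P ≤ P) : Solv (B ⊔ P) := by
  have key (n : ℕ) : dser (B ⊔ P) n ≤ dser B n ⊔ P := by
    induction n with
    | zero => exact le_rfl
    | succ n ih =>
      exact (brk_mono ih ih).trans
        (brk_sup_sup hPP ((brk_mono (dser_le_self hBB n) le_rfl).trans h))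
  obtain ⟨n, hn⟩ := hB
  obtain ⟨m, hm⟩ := hP
  refine ⟨n + m, le_bot_iff.mp ?_⟩
  rw [dser_add, ← hm]
  refine dser_mono ((key n).trans ?_) m
  rw [hn, bot_sup_eq]

lemma map_derivedSeries_eq_dser (C : LieSubalgebra k L) (n : ℕ) :
    (LieAlgebra.derivedSeries k C n).toSubmodule.map C.toSubmodule.subtype =
      dser C.toSubmodule n := by
  induction n with
  | zero => simp [dser]
  | succ n ih =>
    rw [LieAlgebra.derivedSeries_def, LieAlgebra.derivedSeriesOfIdeal_succ,
      ← LieAlgebra.derivedSeries_def, dser, ← ih]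
    rw [LieSubmodule.lieIdeal_oper_eq_linear_span', Submodule.map_span]
    apply le_antisymm
    · rw [Submodule.span_le]
      rintro - ⟨-, ⟨x, hx, y, hy, rfl⟩, rfl⟩
      exact lie_mem_brk (Submodule.mem_map_of_mem hx) (Submodule.mem_map_of_mem hy)
    · rw [brk_le]
      rintro - ⟨x, hx, rfl⟩ - ⟨y, hy, rfl⟩
      let x' : C := x
      let y' : C := y
      exact Submodule.subset_span ⟨⁅x', y'⁆, ⟨x', hx, y', hy, rfl⟩, rfl⟩

lemma isSolvable_iff_solv (C : LieSubalgebra k L) :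
    LieAlgebra.IsSolvable C ↔ Solv C.toSubmodule := by
  rw [LieAlgebra.isSolvable_iff k]
  refine exists_congr fun n => ?_
  rw [← map_derivedSeries_eq_dser, ← LieSubmodule.toSubmodule_eq_bot]
  refine ⟨fun h => by rw [h, Submodule.map_bot], fun h => ?_⟩
  rw [Submodule.eq_bot_iff] at h ⊢
  exact fun x hx => Subtype.ext (h _ (Submodule.mem_map_of_mem hx))

lemma brk_toSubmodule_le (C : LieSubalgebra k L) :
    brk C.toSubmodule C.toSubmodule ≤ C.toSubmodule :=
  brk_le.mpr fun _ hx _ hy => C.lie_mem hx hy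

/-- A subspace closed under brackets, as a Lie subalgebra. -/
def ofBrkLe (P : Submodule k L) (h : brk P P ≤ P) : LieSubalgebra k L :=
  { P with lie_mem' := fun hx hy => h (lie_mem_brk hx hy) }

end Bracket

/-! ### Gradings by projections -/

/-- A finite grading of a vector space, given by its projections. -/
structure Grading (Γ k V : Type*) [Field k] [AddCommGroup V] [Module k V] where
  /-- A finite set of degrees that contains all those that occur. -/
  supp : Finset Γ
  /-- The projections to the homogeneous components. -/
  proj : Γ → Module.End k V
  proj_proj_self : ∀ c x, proj c (proj c x) = proj c x
  proj_proj_ne : ∀ c d, c ≠ d → ∀ x, proj c (proj d x) = 0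
  sum_proj : ∀ x, ∑ c ∈ supp, proj c x = x

namespace Grading

variable {Γ k V : Type*} [Field k] [AddCommGroup V] [Module k V] (G : Grading Γ k V)

lemma proj_eq_zero {c : Γ} (hc : c ∉ G.supp) (x : V) : G.proj c x = 0 := by
  conv_lhs => rw [← G.sum_proj x]
  rw [map_sum]
  exact Finset.sum_eq_zero fun d hd => G.proj_proj_ne _ _ (by rintro rfl; exact hc hd) _

lemma ext_proj {x y : V} (h : ∀ c, G.proj c x = G.proj c y) : x = y := by
  rw [← G.sum_proj x, ← G.sum_proj y]
  exact Finset.sum_congr rfl fun c _ => h c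

lemma proj_of_eq {c : Γ} {x : V} (h : G.proj c x = x) {d : Γ} (hd : d ≠ c) : G.proj d x = 0 := by
  rw [← h, G.proj_proj_ne _ _ hd]

/-- The base change of a grading. -/
def baseChange (K : Type*) [Field K] [Algebra k K] : Grading Γ K (K ⊗[k] V) where
  supp := G.supp
  proj c := (G.proj c).baseChange K
  proj_proj_self c x := by
    induction x with
    | zero => simp
    | tmul a v => simp [G.proj_proj_self]
    | add x y hx hy => simp only [map_add, hx, hy]
  proj_proj_ne c d hcd x := by
    induction x with
    | zero => simp
    | tmul a v => simp [G.proj_proj_ne c d hcd]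
    | add x y hx hy => simp only [map_add, hx, hy, add_zero]
  sum_proj x := by
    induction x with
    | zero => simp
    | tmul a v => simp [← TensorProduct.tmul_sum, G.sum_proj]
    | add x y hx hy => simp only [map_add, Finset.sum_add_distrib, hx, hy]

/-- The grading attached to an internal direct sum decomposition. -/
lemma exists_of_isInternal [DecidableEq Γ] [FiniteDimensional k V] (M : Γ → Submodule k V)
    (hM : DirectSum.IsInternal M) :
    ∃ G : Grading Γ k V, (∀ c x, G.proj c x ∈ M c) ∧ ∀ c, ∀ x ∈ M c, G.proj c x = x := by
  classical
  let _ := hM.chooseDecomposition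
  have hfin := WellFoundedGT.finite_ne_bot_of_iSupIndep hM.submodule_iSupIndep
  refine ⟨⟨hfin.toFinset, fun c => (M c).subtype ∘ₗ DirectSum.component k Γ (fun i => M i) c ∘ₗ
    (DirectSum.decomposeLinearEquiv M).toLinearMap, fun c x => ?_, fun c d h x => ?_, fun x => ?_⟩,
    fun c x => ?_, fun c x hx => ?_⟩
  · exact DirectSum.decompose_of_mem_same M (SetLike.coe_mem _)
  · exact DirectSum.decompose_of_mem_ne M (SetLike.coe_mem _) (Ne.symm h)
  · conv_rhs => rw [← DirectSum.sum_support_decompose M x]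
    refine (Finset.sum_subset ?_ ?_).symm
    · intro c hc
      simp only [Set.Finite.mem_toFinset, Set.mem_ofPred_eq]
      rw [DFinsupp.mem_support_iff] at hc
      rintro h0
      refine hc (Subtype.ext ?_)
      have := (DirectSum.decompose M x c).2
      exact (Submodule.mem_bot k).mp (h0.le this)
    · intro c _ hc
      rw [DFinsupp.notMem_support_iff] at hc
      change ((DirectSum.decompose M x c : M c) : V) = 0
      rw [hc]; rfl
  · exact SetLike.coe_mem _
  · exact DirectSum.decompose_of_mem_same M hx

section Order

variable [LinearOrder Γ]

/-- The elements all of whose components have degree at least `c`. -/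
def fil (c : Γ) : Submodule k V := ⨅ (d : Γ) (_ : d < c), LinearMap.ker (G.proj d)

lemma mem_fil {c : Γ} {x : V} : x ∈ G.fil c ↔ ∀ d < c, G.proj d x = 0 := by
  simp [fil, Submodule.mem_iInf]

lemma exists_leading {x : V} (hx : x ≠ 0) : ∃ c, x ∈ G.fil c ∧ G.proj c x ≠ 0 := by
  classical
  have hne : (G.supp.filter fun c => G.proj c x ≠ 0).Nonempty := by
    by_contra h
    rw [Finset.not_nonempty_iff_eq_empty, Finset.filter_eq_empty_iff] at h
    refine hx ?_
    rw [← G.sum_proj x]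
    exact Finset.sum_eq_zero fun c hc => not_not.mp (h hc)
  refine ⟨_, G.mem_fil.mpr fun d hd => ?_, (Finset.mem_filter.mp (Finset.min'_mem _ hne)).2⟩
  by_contra h
  refine absurd (Finset.min'_le _ d (Finset.mem_filter.mpr ⟨?_, h⟩)) (not_le.mpr hd)
  by_contra h'
  exact h (G.proj_eq_zero h' x)

/-- The span of the lowest components of the elements of a subspace. -/
def gr (W : Submodule k V) : Submodule k V :=
  ⨅ c : Γ, ((W ⊓ G.fil c).map (G.proj c)).comap (G.proj c)

lemma mem_gr {W : Submodule k V} {x : V} :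
    x ∈ G.gr W ↔ ∀ c, ∃ w ∈ W, w ∈ G.fil c ∧ G.proj c w = G.proj c x := by
  simp [gr, Submodule.mem_iInf, Submodule.mem_map, and_assoc]

lemma gr_mono {W W' : Submodule k V} (h : W ≤ W') : G.gr W ≤ G.gr W' := by
  intro x hx
  rw [mem_gr] at hx ⊢
  intro c
  obtain ⟨w, hw, h'⟩ := hx c
  exact ⟨w, h hw, h'⟩

lemma gr_bot : G.gr (⊥ : Submodule k V) = ⊥ := by
  refine (Submodule.eq_bot_iff _).mpr fun x hx => G.ext_proj fun c => ?_
  obtain ⟨w, hw, -, h⟩ := G.mem_gr.mp hx c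
  rw [← h, (Submodule.mem_bot k).mp hw]

lemma proj_mem_gr_of_mem {W : Submodule k V} {w : V} (hw : w ∈ W) {c : Γ} (hc : w ∈ G.fil c) :
    G.proj c w ∈ G.gr W := by
  rw [mem_gr]
  intro d
  rcases eq_or_ne d c with rfl | h
  · exact ⟨w, hw, hc, (G.proj_proj_self _ _).symm⟩
  · exact ⟨0, zero_mem _, zero_mem _, by rw [G.proj_proj_ne _ _ h, map_zero]⟩

lemma proj_mem_gr {W : Submodule k V} {x : V} (hx : x ∈ G.gr W) (c : Γ) : G.proj c x ∈ G.gr W := by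
  obtain ⟨w, hw, hc, h⟩ := G.mem_gr.mp hx c
  rw [← h]
  exact G.proj_mem_gr_of_mem hw hc

lemma le_gr {W : Submodule k V} (hW : ∀ x ∈ W, ∀ c, G.proj c x ∈ W) : W ≤ G.gr W := by
  intro x hx
  rw [mem_gr]
  intro c
  refine ⟨G.proj c x, hW x hx c, G.mem_fil.mpr fun d hd => G.proj_proj_ne _ _ hd.ne _,
    G.proj_proj_self _ _⟩

lemma finrank_le_finrank_gr [FiniteDimensional k V] (W : Submodule k V) :
    Module.finrank k W ≤ Module.finrank k (G.gr W) := by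
  choose R hR using fun c => Submodule.exists_isCompl ((W ⊓ G.fil c).map (G.proj c))
  set U : Submodule k V := ⨅ c, (R c).comap (G.proj c) with hU
  have hmemU {x : V} : x ∈ U ↔ ∀ c, G.proj c x ∈ R c := by simp [hU, Submodule.mem_iInf]
  have h1 : U ⊔ G.gr W = ⊤ := by
    refine eq_top_iff.mpr fun x _ => ?_
    rw [← G.sum_proj x]
    refine Submodule.sum_mem _ fun c _ => ?_
    have hx : G.proj c x ∈ (W ⊓ G.fil c).map (G.proj c) ⊔ R c := by
      rw [(hR c).sup_eq_top]; trivial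
    obtain ⟨-, ⟨w, hw, rfl⟩, r, hr, hwr⟩ := Submodule.mem_sup.mp hx
    rw [← hwr, add_comm]
    have hr' : G.proj c r = r := by
      rw [eq_sub_of_add_eq' hwr, map_sub, G.proj_proj_self, G.proj_proj_self]
    refine Submodule.add_mem_sup (hmemU.mpr fun d => ?_) (G.proj_mem_gr_of_mem hw.1 hw.2)
    rcases eq_or_ne d c with rfl | h
    · rwa [hr']
    · rw [G.proj_of_eq hr' h]; exact zero_mem _
  have h2 : U ⊓ W = ⊥ := by
    refine (Submodule.eq_bot_iff _).mpr fun x hx => ?_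
    by_contra hne
    obtain ⟨c, hc, hc'⟩ := G.exists_leading hne
    refine hc' ?_
    have := (hR c).inf_eq_bot
    rw [← Submodule.mem_bot k, ← this]
    exact ⟨⟨x, ⟨hx.2, hc⟩, rfl⟩, hmemU.mp hx.1 c⟩
  have h3 := Submodule.finrank_sup_add_finrank_inf_eq U (G.gr W)
  have h4 := Submodule.finrank_sup_add_finrank_inf_eq U W
  rw [h1, finrank_top] at h3
  rw [h2, finrank_bot] at h4
  have := Submodule.finrank_le (U ⊔ W)
  omega

end Order

end Grading

section LieGrading

variable {Γ k L : Type*} [Field k] [LieRing L] [LieAlgebra k L]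

/-- Compatibility of a grading with a Lie bracket. -/
def Grading.IsLie [Add Γ] (G : Grading Γ k L) : Prop :=
  ∀ a b x y, G.proj (a + b) ⁅G.proj a x, G.proj b y⁆ = ⁅G.proj a x, G.proj b y⁆

lemma Grading.IsLie.baseChange [Add Γ] {G : Grading Γ k L} (hG : G.IsLie) (K : Type*) [Field K]
    [Algebra k K] : (G.baseChange K).IsLie := by
  intro a b x y
  induction x with
  | zero => simp
  | add x x' hx hx' => simp only [map_add, add_lie, hx, hx']
  | tmul s x =>
    induction y with
    | zero => simp
    | add y y' hy hy' => simp only [map_add, lie_add, hy, hy']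
    | tmul t y => simp [Grading.baseChange, hG a b x y]

variable [AddCommGroup Γ] {G : Grading Γ k L}

lemma Grading.IsLie.proj_lie (hG : G.IsLie) (c : Γ) (x y : L) :
    G.proj c ⁅x, y⁆ = ∑ i ∈ G.supp, ⁅G.proj i x, G.proj (c - i) y⁆ := by
  conv_lhs => rw [← G.sum_proj x, sum_lie, map_sum]
  refine Finset.sum_congr rfl fun i _ => ?_
  conv_lhs => rw [← G.sum_proj y, lie_sum, map_sum]
  by_cases h : c - i ∈ G.supp
  · rw [Finset.sum_eq_single_of_mem _ h]
    · have := hG i (c - i) x y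
      rwa [add_sub_cancel] at this
    · intro j _ hj
      rw [← hG, G.proj_proj_ne]
      rintro rfl
      exact hj (by abel)
  · rw [G.proj_eq_zero h, lie_zero]
    refine Finset.sum_eq_zero fun j hj => ?_
    rw [← hG, G.proj_proj_ne]
    rintro rfl
    exact h (by simpa using hj)

variable [LinearOrder Γ] [IsOrderedAddMonoid Γ]

lemma Grading.IsLie.proj_lie_of_mem_fil (hG : G.IsLie) {a b : Γ} {x y : L} (hx : x ∈ G.fil a)
    (hy : y ∈ G.fil b) : G.proj (a + b) ⁅x, y⁆ = ⁅G.proj a x, G.proj b y⁆ := by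
  rw [hG.proj_lie]
  by_cases ha : a ∈ G.supp
  · rw [Finset.sum_eq_single_of_mem _ ha, add_sub_cancel_left]
    intro i _ hi
    rcases lt_or_gt_of_ne hi with h | h
    · rw [G.mem_fil.mp hx i h, zero_lie]
    · rw [G.mem_fil.mp hy _ (by rw [sub_lt_iff_lt_add, add_comm]; exact add_lt_add_right h b), lie_zero]
  · rw [G.proj_eq_zero ha, zero_lie]
    refine Finset.sum_eq_zero fun i hi => ?_
    rcases lt_or_ge i a with h | h
    · rw [G.mem_fil.mp hx i h, zero_lie]
    · have h' : a < i := lt_of_le_of_ne h (by rintro rfl; exact ha hi)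
      rw [G.mem_fil.mp hy _ (by rw [sub_lt_iff_lt_add, add_comm]; exact add_lt_add_right h' b), lie_zero]

lemma Grading.IsLie.lie_mem_fil (hG : G.IsLie) {a b : Γ} {x y : L} (hx : x ∈ G.fil a)
    (hy : y ∈ G.fil b) : ⁅x, y⁆ ∈ G.fil (a + b) := by
  rw [G.mem_fil]
  intro c hc
  rw [hG.proj_lie]
  refine Finset.sum_eq_zero fun i _ => ?_
  rcases lt_or_ge i a with h | h
  · rw [G.mem_fil.mp hx i h, zero_lie]
  · rw [G.mem_fil.mp hy _ ?_, lie_zero]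
    rw [sub_lt_iff_lt_add, add_comm]
    exact hc.trans_le (by gcongr)

lemma Grading.IsLie.brk_gr_le (hG : G.IsLie) (P Q : Submodule k L) :
    brk (G.gr P) (G.gr Q) ≤ G.gr (brk P Q) := by
  rw [brk_le]
  intro x hx y hy
  rw [← G.sum_proj x, ← G.sum_proj y, sum_lie]
  refine Submodule.sum_mem _ fun a _ => ?_
  rw [lie_sum]
  refine Submodule.sum_mem _ fun b _ => ?_
  obtain ⟨v, hv, hva, hvx⟩ := G.mem_gr.mp hx a
  obtain ⟨w, hw, hwb, hwy⟩ := G.mem_gr.mp hy b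
  rw [← hvx, ← hwy, ← hG.proj_lie_of_mem_fil hva hwb]
  exact G.proj_mem_gr_of_mem (lie_mem_brk hv hw) (hG.lie_mem_fil hva hwb)

lemma Grading.IsLie.solv_gr (hG : G.IsLie) {P : Submodule k L} (hP : Solv P) : Solv (G.gr P) :=
  Solv.of_lax G.gr (fun Q => hG.brk_gr_le Q Q) G.gr_bot hP

end LieGrading

/-! ### Laurent series -/

/-- The field `ℂ((t))`, as a type on which no instances are found but those declared below. -/
def LSer : Type := LaurentSeries ℂ

instance : Field LSer := inferInstanceAs (Field (LaurentSeries ℂ))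

instance : Algebra ℂ LSer := laurentAlgebra

namespace LSer

/-- The coefficient of `t ^ n`. -/
def coeff (n : ℤ) : LSer →ₗ[ℂ] ℂ := HahnSeries.coeff.linearMap n

/-- The derivative. -/
def der : LSer →ₗ[ℂ] LSer := LaurentSeries.derivative ℂ

/-- The monomial `t ^ n`. -/
def tpow (n : ℤ) : LSer := (HahnSeries.single n 1 : LaurentSeries ℂ)

lemma ext {f g : LSer} (h : ∀ n, coeff n f = coeff n g) : f = g :=
  HahnSeries.ext (funext h : HahnSeries.coeff (f : LaurentSeries ℂ) = _)

lemma coeff_tpow_mul (m n : ℤ) (f : LSer) : coeff n (tpow m * f) = coeff (n - m) f := by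
  have h (f : LaurentSeries ℂ) : (HahnSeries.single m 1 * f).coeff n = f.coeff (n - m) := by
    simp [HahnSeries.coeff_single_mul]
  exact h f

lemma tpow_mul (m n : ℤ) : tpow m * tpow n = tpow (m + n) := by
  have : (HahnSeries.single m 1 : LaurentSeries ℂ) * HahnSeries.single n 1 =
    HahnSeries.single (m + n) 1 := by simp [HahnSeries.single_mul_single]
  exact this

@[simp] lemma tpow_zero : tpow 0 = 1 := rfl

lemma tpow_ne_zero (n : ℤ) : tpow n ≠ 0 := by
  intro h
  have := tpow_mul n (-n)
  rw [h, zero_mul, add_neg_cancel, tpow_zero] at this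
  exact zero_ne_one this

lemma coeff_tpow (m n : ℤ) : coeff n (tpow m) = if n = m then 1 else 0 :=
  (HahnSeries.coeff_single ..).trans (by congr)

lemma coeff_one (n : ℤ) : coeff n (1 : LSer) = if n = 0 then 1 else 0 := by
  rw [← tpow_zero, coeff_tpow]

lemma coeff_derivative (f : LaurentSeries ℂ) (n : ℤ) :
    (LaurentSeries.derivative ℂ f).coeff n = (n + 1) * f.coeff (n + 1) := by
  rw [LaurentSeries.derivative_apply, LaurentSeries.hasseDeriv_coeff]
  simp

lemma coeff_der (n : ℤ) (f : LSer) : coeff n (der f) = (n + 1) * coeff (n + 1) f := by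
  exact coeff_derivative f n

/-- The Laurent series with given nonnegative coefficients. -/
def mk (p : ℕ → ℂ) : LSer := HahnSeries.ofPowerSeries ℤ ℂ (PowerSeries.mk p)

lemma coeff_mk (p : ℕ → ℂ) (n : ℕ) : coeff n (mk p) = p n := by
  change (HahnSeries.ofPowerSeries ℤ ℂ (PowerSeries.mk p)).coeff n = p n
  rw [LaurentSeries.coeff_coe_powerSeries, PowerSeries.coeff_mk]

lemma coeff_mk_neg (p : ℕ → ℂ) {n : ℤ} (hn : n < 0) : coeff n (mk p) = 0 := by
  change (HahnSeries.ofPowerSeries ℤ ℂ (PowerSeries.mk p)).coeff n = 0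
  rw [PowerSeries.coeff_coe, if_pos hn]

lemma coeff_mk_mul_mk (p q : ℕ → ℂ) (n : ℕ) :
    coeff n (mk p * mk q) = ∑ ij ∈ Finset.HasAntidiagonal.antidiagonal n, p ij.1 * q ij.2 := by
  have : (HahnSeries.ofPowerSeries ℤ ℂ (PowerSeries.mk p) *
      HahnSeries.ofPowerSeries ℤ ℂ (PowerSeries.mk q)).coeff n =
        ∑ ij ∈ Finset.HasAntidiagonal.antidiagonal n, p ij.1 * q ij.2 := by
    rw [← map_mul, LaurentSeries.coeff_coe_powerSeries, PowerSeries.coeff_mul]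
    simp
  exact this

lemma coeff_mk_mul_mk_neg (p q : ℕ → ℂ) {n : ℤ} (hn : n < 0) : coeff n (mk p * mk q) = 0 := by
  have : (HahnSeries.ofPowerSeries ℤ ℂ (PowerSeries.mk p) *
      HahnSeries.ofPowerSeries ℤ ℂ (PowerSeries.mk q)).coeff n = 0 := by
    rw [← map_mul, PowerSeries.coeff_coe, if_pos hn]
  exact this

lemma exists_coeff_eq_zero (f : LSer) : ∃ N : ℤ, ∀ n < N, coeff n f = 0 :=
  ⟨(f : LaurentSeries ℂ).order, fun _ hn => HahnSeries.coeff_eq_zero_of_lt_order hn⟩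

lemma eq_mk {f : LSer} (hf : ∀ n < 0, coeff n f = 0) : f = mk fun n => coeff n f := by
  refine ext fun n => ?_
  rcases lt_or_ge n 0 with h | h
  · rw [hf n h, coeff_mk_neg _ h]
  · lift n to ℕ using h
    rw [coeff_mk]

lemma der_tpow (n : ℤ) : der (tpow n) = (n : ℂ) • tpow (n - 1) := by
  refine ext fun m => ?_
  rw [coeff_der, coeff_tpow, map_smul, coeff_tpow, smul_eq_mul]
  by_cases h : m + 1 = n
  · rw [if_pos h, if_pos (by omega), ← h]; push_cast; ring
  · rw [if_neg h, if_neg (by omega), mul_zero, mul_zero]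

lemma der_mul (f g : LSer) : der (f * g) = der f * g + f * der g := by
  have hth (f : LaurentSeries ℂ) (m : ℤ) :
      (HahnSeries.single (1 : ℤ) (1 : ℂ) * LaurentSeries.derivative ℂ f).coeff m =
        m * f.coeff m := by
    rw [HahnSeries.coeff_single_mul, coeff_derivative, sub_add_cancel]
    push_cast; ring
  have hs (f : LaurentSeries ℂ) :
      (HahnSeries.single (1 : ℤ) (1 : ℂ) * LaurentSeries.derivative ℂ f).support ⊆ f.support :=
    fun n hn h => hn (by rw [hth, h, mul_zero])
  have key (f g : LaurentSeries ℂ) :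
      HahnSeries.single (1 : ℤ) (1 : ℂ) * LaurentSeries.derivative ℂ (f * g) =
        HahnSeries.single (1 : ℤ) (1 : ℂ) * LaurentSeries.derivative ℂ f * g +
          f * (HahnSeries.single (1 : ℤ) (1 : ℂ) * LaurentSeries.derivative ℂ g) := by
    ext n
    rw [hth, HahnSeries.coeff_add,
      HahnSeries.coeff_mul_left' (HahnSeries.isPWO_support f) (hs f),
      HahnSeries.coeff_mul_right' (HahnSeries.isPWO_support g) (hs g),
      HahnSeries.coeff_mul, Finset.mul_sum, ← Finset.sum_add_distrib]
    refine Finset.sum_congr rfl fun ij hij => ?_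
    rw [Finset.mem_antidiagonal] at hij
    rw [hth, hth, ← hij.2.2]
    push_cast
    ring
  have h : tpow 1 * der (f * g) = tpow 1 * der f * g + f * (tpow 1 * der g) := key f g
  refine mul_left_cancel₀ (tpow_ne_zero 1) ?_
  rw [h]
  ring

end LSer

open LSer

/-! ### Loops -/

section Loops

variable (𝔤 : Type*) [LieRing 𝔤] [LieAlgebra ℂ 𝔤]

/-- The loop algebra. -/
abbrev LG : Type _ := LSer ⊗[ℂ] 𝔤

variable {𝔤}

/-- The derivation `∂_t`. -/
def lder : LG 𝔤 →ₗ[ℂ] LG 𝔤 := der.rTensor 𝔤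

/-- The coefficient of `t ^ n`. -/
def lcoeff (n : ℤ) : LG 𝔤 →ₗ[ℂ] 𝔤 :=
  (TensorProduct.lid ℂ 𝔤).toLinearMap ∘ₗ (coeff n).rTensor 𝔤

/-- The covariant derivative of `∂_t + A`. -/
def cov (A Y : LG 𝔤) : LG 𝔤 := lder Y + ⁅A, Y⁆

/-- The subspace `U((t))`. -/
abbrev lsub (U : Submodule ℂ 𝔤) : Submodule LSer (LG 𝔤) := U.baseChange LSer

@[simp] lemma lcoeff_tmul (n : ℤ) (s : LSer) (v : 𝔤) :
    lcoeff n (s ⊗ₜ[ℂ] v : LG 𝔤) = coeff n s • v := rfl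

@[simp] lemma lder_tmul (s : LSer) (v : 𝔤) : lder (s ⊗ₜ[ℂ] v : LG 𝔤) = der s ⊗ₜ[ℂ] v := rfl

lemma lcoeff_tpow_smul (m n : ℤ) (X : LG 𝔤) :
    lcoeff n (tpow m • X) = lcoeff (n - m) X := by
  induction X using TensorProduct.induction_on with
  | zero => simp
  | tmul s v => rw [TensorProduct.smul_tmul', smul_eq_mul, lcoeff_tmul, lcoeff_tmul, coeff_tpow_mul]
  | add x y hx hy => rw [smul_add, map_add, map_add, hx, hy]

lemma tpow_smul_tpow_smul (m n : ℤ) (X : LG 𝔤) : tpow m • tpow n • X = tpow (m + n) • X := by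
  rw [smul_smul, tpow_mul]

lemma lcoeff_lder (n : ℤ) (X : LG 𝔤) :
    lcoeff n (lder X) = ((n : ℂ) + 1) • lcoeff (n + 1) X := by
  induction X using TensorProduct.induction_on with
  | zero => simp
  | tmul s v => rw [lder_tmul, lcoeff_tmul, lcoeff_tmul, coeff_der, mul_smul]
  | add x y hx hy => rw [map_add, map_add, map_add, smul_add, hx, hy]

lemma lder_smul (c : LSer) (X : LG 𝔤) : lder (c • X) = der c • X + c • lder X := by
  induction X using TensorProduct.induction_on with
  | zero => simp
  | tmul s v =>
    rw [TensorProduct.smul_tmul', lder_tmul, lder_tmul, TensorProduct.smul_tmul',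
      TensorProduct.smul_tmul', smul_eq_mul, der_mul, TensorProduct.add_tmul]; rfl
  | add x y hx hy => rw [smul_add, map_add, map_add, hx, hy, smul_add, smul_add]; abel

lemma lder_lie (X Y : LG 𝔤) : lder ⁅X, Y⁆ = ⁅lder X, Y⁆ + ⁅X, lder Y⁆ := by
  induction X using TensorProduct.induction_on with
  | zero => simp
  | add x x' hx hx' => simp only [map_add, add_lie, hx, hx']; abel
  | tmul s x =>
    induction Y using TensorProduct.induction_on with
    | zero => simp
    | add y y' hy hy' => simp only [map_add, lie_add, hy, hy']; abel
    | tmul u y =>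
      simp only [LieAlgebra.ExtendScalars.bracket_tmul, lder_tmul, der_mul,
        TensorProduct.add_tmul]

lemma cov_lie (A X Y : LG 𝔤) : cov A ⁅X, Y⁆ = ⁅cov A X, Y⁆ + ⁅X, cov A Y⁆ := by
  rw [cov, cov, cov, lder_lie, leibniz_lie, add_lie, lie_add]; abel

lemma cov_smul (A X : LG 𝔤) (c : LSer) : cov A (c • X) = der c • X + c • cov A X := by
  rw [cov, cov, lder_smul, lie_smul, smul_add]; abel

lemma cov_add (A X Y : LG 𝔤) : cov A (X + Y) = cov A X + cov A Y := by
  rw [cov, cov, cov, map_add, lie_add]; abel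

lemma cov_sub (A X Y : LG 𝔤) : cov A (X - Y) = cov A X - cov A Y := by
  rw [cov, cov, cov, map_sub, lie_sub]; abel

@[simp] lemma lcoeff_baseChange (f : Module.End ℂ 𝔤) (n : ℤ) (X : LG 𝔤) :
    lcoeff n (f.baseChange LSer X) = f (lcoeff n X) := by
  induction X using TensorProduct.induction_on with
  | zero => simp
  | tmul s v => simp
  | add x y hx hy => rw [map_add, map_add, hx, hy, map_add, map_add]

lemma lder_baseChange (f : Module.End ℂ 𝔤) (X : LG 𝔤) :
    lder (f.baseChange LSer X) = f.baseChange LSer (lder X) := by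
  induction X using TensorProduct.induction_on with
  | zero => simp
  | tmul s v => simp
  | add x y hx hy => rw [map_add, map_add, hx, hy, map_add, map_add]

@[simp] lemma lcoeff_one_tmul_lie (x : 𝔤) (n : ℤ) (X : LG 𝔤) :
    lcoeff n ⁅(1 : LSer) ⊗ₜ[ℂ] x, X⁆ = ⁅x, lcoeff n X⁆ := by
  induction X using TensorProduct.induction_on with
  | zero => simp
  | tmul s v => simp
  | add y z hy hz => rw [lie_add, map_add, hy, hz, map_add, lie_add]

lemma exists_lcoeff_eq_zero (X : LG 𝔤) : ∃ N : ℤ, ∀ n < N, lcoeff n X = 0 := by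
  induction X using TensorProduct.induction_on with
  | zero => exact ⟨0, by simp⟩
  | tmul s v =>
    obtain ⟨N, hN⟩ := exists_coeff_eq_zero s
    exact ⟨N, fun n hn => by rw [lcoeff_tmul, hN n hn, zero_smul]⟩
  | add x y hx hy =>
    obtain ⟨a, ha⟩ := hx
    obtain ⟨b, hb⟩ := hy
    exact ⟨min a b, fun n hn => by
      rw [map_add, ha n (hn.trans_le (min_le_left _ _)), hb n (hn.trans_le (min_le_right _ _)),
        add_zero]⟩

/-- Loops without pole. -/
def Integral (X : LG 𝔤) : Prop := ∀ n < 0, lcoeff n X = 0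

lemma Integral.add {X Y : LG 𝔤} (hX : Integral X) (hY : Integral Y) : Integral (X + Y) :=
  fun n hn => by rw [map_add, hX n hn, hY n hn, add_zero]

lemma Integral.sub {X Y : LG 𝔤} (hX : Integral X) (hY : Integral Y) : Integral (X - Y) :=
  fun n hn => by rw [map_sub, hX n hn, hY n hn, sub_zero]

lemma integral_zero : Integral (0 : LG 𝔤) := fun n _ => by rw [map_zero]

lemma integral_one_tmul (v : 𝔤) : Integral ((1 : LSer) ⊗ₜ[ℂ] v) := fun n hn => by
  rw [lcoeff_tmul, coeff_one, if_neg hn.ne, zero_smul]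

lemma lcoeff_zero_one_tmul (v : 𝔤) : lcoeff 0 ((1 : LSer) ⊗ₜ[ℂ] v) = v := by
  rw [lcoeff_tmul, coeff_one, if_pos rfl, one_smul]

lemma integral_tpow_smul {X : LG 𝔤} (hX : Integral X) {n : ℤ} (hn : 0 ≤ n) :
    Integral (tpow n • X) := fun m hm => by
  rw [lcoeff_tpow_smul]; exact hX _ (by omega)

/-- The limit at `t = 0` of a `ℂ((t))`-subspace. -/
def lim (W : Submodule LSer (LG 𝔤)) : Submodule ℂ 𝔤 where
  carrier := {v | ∃ w ∈ W, Integral w ∧ lcoeff 0 w = v}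
  zero_mem' := ⟨0, zero_mem _, integral_zero, map_zero _⟩
  add_mem' := by
    rintro - - ⟨v, hv, hv', rfl⟩ ⟨w, hw, hw', rfl⟩
    exact ⟨v + w, add_mem hv hw, hv'.add hw', map_add _ _ _⟩
  smul_mem' := by
    rintro c - ⟨v, hv, hv', rfl⟩
    refine ⟨algebraMap ℂ LSer c • v, W.smul_mem _ hv, fun n hn => ?_, ?_⟩
    · rw [algebraMap_smul, map_smul, hv' n hn, smul_zero]
    · rw [algebraMap_smul, map_smul]

lemma lim_mono {W W' : Submodule LSer (LG 𝔤)} (h : W ≤ W') : lim W ≤ lim W' := by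
  rintro v ⟨w, hw, h'⟩
  exact ⟨w, h hw, h'⟩

lemma lim_bot : lim (⊥ : Submodule LSer (LG 𝔤)) = ⊥ := by
  refine (Submodule.eq_bot_iff _).mpr ?_
  rintro - ⟨w, hw, -, rfl⟩
  rw [(Submodule.mem_bot LSer).mp hw, map_zero]

lemma tmul_mem_lsub {U : Submodule ℂ 𝔤} (s : LSer) {v : 𝔤} (hv : v ∈ U) :
    s ⊗ₜ[ℂ] v ∈ lsub U :=
  Submodule.tmul_mem_baseChange_of_mem s hv

lemma lsub_induction {U : Submodule ℂ 𝔤} {p : LG 𝔤 → Prop} (h0 : p 0)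
    (hadd : ∀ x y, p x → p y → p (x + y)) (h : ∀ (s : LSer) (v : 𝔤), v ∈ U → p (s ⊗ₜ[ℂ] v))
    {X : LG 𝔤} (hX : X ∈ lsub U) : p X := by
  obtain ⟨x, rfl⟩ := Submodule.toBaseChange_surjective' LSer U hX
  clear hX
  induction x using TensorProduct.induction_on with
  | zero => simpa using h0
  | tmul s v => exact h s v v.2
  | add x y hx hy => rw [map_add]; exact hadd _ _ hx hy

lemma lcoeff_mem_of_mem_lsub {U : Submodule ℂ 𝔤} {X : LG 𝔤} (hX : X ∈ lsub U) (n : ℤ) :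
    lcoeff n X ∈ U := by
  refine lsub_induction (p := fun X => lcoeff n X ∈ U) (by simp) (fun x y hx hy => ?_)
    (fun s v hv => U.smul_mem _ hv) hX
  rw [map_add]; exact add_mem hx hy

lemma lsub_mono {U U' : Submodule ℂ 𝔤} (h : U ≤ U') : lsub U ≤ lsub U' :=
  Submodule.baseChange_mono _ h

lemma lim_lsub (U : Submodule ℂ 𝔤) : lim (lsub U) = U := by
  apply le_antisymm
  · rintro - ⟨w, hw, -, rfl⟩
    exact lcoeff_mem_of_mem_lsub hw 0
  · intro v hv
    exact ⟨_, tmul_mem_lsub 1 hv, integral_one_tmul v, lcoeff_zero_one_tmul v⟩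

lemma brk_lsub_le (U U' : Submodule ℂ 𝔤) : brk (lsub U) (lsub U') ≤ lsub (brk U U') := by
  rw [brk_le]
  intro x hx y hy
  refine lsub_induction (p := fun x => ⁅x, y⁆ ∈ lsub (brk U U')) (by simp) (fun x y hx hy => ?_)
    (fun s v hv => ?_) hx
  · rw [add_lie]; exact add_mem hx hy
  · refine lsub_induction (p := fun y => ⁅s ⊗ₜ[ℂ] v, y⁆ ∈ lsub (brk U U')) (by simp)
      (fun x y hx hy => ?_) (fun s' v' hv' => ?_) hy
    · rw [lie_add]; exact add_mem hx hy
    · exact tmul_mem_lsub _ (lie_mem_brk hv hv')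

lemma solv_lsub {U : Submodule ℂ 𝔤} (hU : Solv U) : Solv (lsub U) :=
  Solv.of_lax lsub (fun P => brk_lsub_le P P) (Submodule.baseChange_bot _) hU

lemma finrank_lsub [FiniteDimensional ℂ 𝔤] (U : Submodule ℂ 𝔤) :
    Module.finrank LSer (lsub U) = Module.finrank ℂ U := by
  rw [← Module.finrank_baseChange (R := LSer) (S := ℂ) (M' := U)]
  refine (LinearEquiv.ofBijective (U.toBaseChange LSer)
    ⟨fun x y h => ?_, Submodule.toBaseChange_surjective LSer U⟩).finrank_eq.symm
  have : Function.Injective (U.subtype.lTensor LSer) :=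
    Module.Flat.lTensor_preserves_injective_linearMap _ U.injective_subtype
  exact this (congrArg Subtype.val h)

lemma coeff_repr {ι : Type*} (b : Module.Basis ι ℂ 𝔤) (X : LG 𝔤) (j : ι) (n : ℤ) :
    coeff n ((b.baseChange LSer).repr X j) = b.repr (lcoeff n X) j := by
  induction X using TensorProduct.induction_on with
  | zero => simp
  | tmul s v =>
    have h : ((b.baseChange LSer).repr (s ⊗ₜ[ℂ] v)) j = b.repr v j • s := by
      rw [Module.Basis.baseChange_repr_tmul]
    rw [h, map_smul, lcoeff_tmul, map_smul, Finsupp.smul_apply, smul_eq_mul, smul_eq_mul, mul_comm]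
  | add x y hx hy => simp [hx, hy]

section FiniteDimensional

variable [FiniteDimensional ℂ 𝔤]

lemma LG.ext {X Y : LG 𝔤} (h : ∀ n, lcoeff n X = lcoeff n Y) : X = Y := by
  let b := Module.finBasis ℂ 𝔤
  refine (b.baseChange LSer).repr.injective (Finsupp.ext fun j => LSer.ext fun n => ?_)
  rw [coeff_repr, coeff_repr, h]

/-- A nonzero loop has a leading term. -/
lemma exists_leading_coeff {X : LG 𝔤} (hX : X ≠ 0) :
    ∃ m : ℤ, Integral (tpow m • X) ∧ lcoeff 0 (tpow m • X) ≠ 0 := by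
  obtain ⟨N, hN⟩ := exists_lcoeff_eq_zero X
  have hex : ∃ k : ℕ, lcoeff (N + k) X ≠ 0 := by
    by_contra! h
    refine hX (LG.ext fun n => ?_)
    rw [map_zero]
    rcases lt_or_ge n N with h' | h'
    · exact hN n h'
    · have := h (n - N).toNat
      rwa [Int.toNat_of_nonneg (by omega), add_sub_cancel] at this
  classical
  refine ⟨-(N + Nat.find hex), fun n hn => ?_, ?_⟩
  · rw [lcoeff_tpow_smul]
    rcases lt_or_ge (n + Nat.find hex) 0 with h' | h'
    · exact hN _ (by omega)
    · have := Nat.find_min hex (m := (n + Nat.find hex).toNat) (by omega)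
      rw [not_not, Int.toNat_of_nonneg h'] at this
      convert this using 3; omega
  · rw [lcoeff_tpow_smul]
    convert Nat.find_spec hex using 4; omega

/-- The loop with given nonnegative coefficients. -/
def mkLoop (f : ℕ → 𝔤) : LG 𝔤 :=
  ∑ j, LSer.mk (fun n => (Module.finBasis ℂ 𝔤).repr (f n) j) ⊗ₜ[ℂ] Module.finBasis ℂ 𝔤 j

lemma lcoeff_mkLoop (f : ℕ → 𝔤) (n : ℕ) : lcoeff n (mkLoop f) = f n := by
  rw [mkLoop, map_sum]
  simp only [lcoeff_tmul, coeff_mk]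
  exact (Module.finBasis ℂ 𝔤).sum_repr (f n)

lemma integral_mkLoop (f : ℕ → 𝔤) : Integral (mkLoop f) := fun n hn => by
  rw [mkLoop, map_sum]
  exact Finset.sum_eq_zero fun j _ => by rw [lcoeff_tmul, coeff_mk_neg _ hn, zero_smul]

lemma integral_induction {p : LG 𝔤 → Prop} (h0 : p 0)
    (hadd : ∀ x y, p x → p y → p (x + y)) (h : ∀ (s : ℕ → ℂ) (v : 𝔤), p (LSer.mk s ⊗ₜ[ℂ] v))
    {X : LG 𝔤} (hX : Integral X) : p X := by
  have hX' : X = mkLoop fun n => lcoeff n X := by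
    refine LG.ext fun n => ?_
    rcases lt_or_ge n 0 with h | h
    · rw [hX n h, integral_mkLoop _ n h]
    · lift n to ℕ using h
      rw [lcoeff_mkLoop]
  rw [hX', mkLoop]
  exact Finset.sum_induction _ p hadd h0 fun j _ => h _ _

lemma Integral.lie {X Y : LG 𝔤} (hX : Integral X) (hY : Integral Y) : Integral ⁅X, Y⁆ := by
  refine integral_induction (p := fun X => Integral ⁅X, Y⁆) (by simpa using integral_zero)
    (fun x y hx hy => by rw [add_lie]; exact hx.add hy) (fun s v => ?_) hX
  refine integral_induction (p := fun Y => Integral ⁅LSer.mk s ⊗ₜ[ℂ] v, Y⁆)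
    (by simpa using integral_zero)
    (fun x y hx hy => by rw [lie_add]; exact hx.add hy) (fun s' v' n hn => ?_) hY
  rw [LieAlgebra.ExtendScalars.bracket_tmul, lcoeff_tmul, coeff_mk_mul_mk_neg _ _ hn, zero_smul]

lemma lcoeff_lie {X Y : LG 𝔤} (hX : Integral X) (hY : Integral Y) (n : ℕ) :
    lcoeff n ⁅X, Y⁆ = ∑ ij ∈ Finset.HasAntidiagonal.antidiagonal n, ⁅lcoeff ij.1 X, lcoeff ij.2 Y⁆ := by
  refine integral_induction
    (p := fun X => lcoeff n ⁅X, Y⁆ = ∑ ij ∈ Finset.HasAntidiagonal.antidiagonal n, ⁅lcoeff ij.1 X, lcoeff ij.2 Y⁆)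
    (by simp) (fun x y hx hy => ?_) (fun s v => ?_) hX
  · simp only [add_lie, map_add, hx, hy, Finset.sum_add_distrib]
  refine integral_induction (p := fun Y => lcoeff n ⁅LSer.mk s ⊗ₜ[ℂ] v, Y⁆ =
      ∑ ij ∈ Finset.HasAntidiagonal.antidiagonal n, ⁅lcoeff ij.1 (LSer.mk s ⊗ₜ[ℂ] v), lcoeff ij.2 Y⁆)
    (by simp) (fun x y hx hy => ?_) (fun s' v' => ?_) hY
  · simp only [lie_add, map_add, hx, hy, Finset.sum_add_distrib]
  · rw [LieAlgebra.ExtendScalars.bracket_tmul, lcoeff_tmul, coeff_mk_mul_mk, Finset.sum_smul]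
    refine Finset.sum_congr rfl fun ij _ => ?_
    rw [lcoeff_tmul, lcoeff_tmul, coeff_mk, coeff_mk, smul_lie, lie_smul, smul_smul]

lemma lcoeff_zero_lie {X Y : LG 𝔤} (hX : Integral X) (hY : Integral Y) :
    lcoeff 0 ⁅X, Y⁆ = ⁅lcoeff 0 X, lcoeff 0 Y⁆ := by
  have := lcoeff_lie hX hY 0
  simpa using this

lemma brk_lim_le (P Q : Submodule LSer (LG 𝔤)) : brk (lim P) (lim Q) ≤ lim (brk P Q) := by
  rw [brk_le]
  rintro - ⟨v, hv, hv', rfl⟩ - ⟨w, hw, hw', rfl⟩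
  exact ⟨⁅v, w⁆, lie_mem_brk hv hw, hv'.lie hw', lcoeff_zero_lie hv' hw'⟩

lemma solv_lim {W : Submodule LSer (LG 𝔤)} (hW : Solv W) : Solv (lim W) :=
  Solv.of_lax lim (fun P => brk_lim_le P P) lim_bot hW

lemma mem_lsub_iff {U : Submodule ℂ 𝔤} {X : LG 𝔤} : X ∈ lsub U ↔ ∀ n, lcoeff n X ∈ U := by
  refine ⟨fun h n => lcoeff_mem_of_mem_lsub h n, fun h => ?_⟩
  obtain ⟨q, hq⟩ := LinearMap.exists_leftInverse_of_injective U.subtype U.ker_subtype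
  set p : Module.End ℂ 𝔤 := U.subtype ∘ₗ q with hp
  have hX : p.baseChange LSer X = X := LG.ext fun n => by
    rw [lcoeff_baseChange]; exact congrArg Subtype.val (LinearMap.congr_fun hq ⟨_, h n⟩)
  rw [← hX]
  clear hX h
  induction X using TensorProduct.induction_on with
  | zero => simp
  | tmul s v => exact tmul_mem_lsub s (q v).2
  | add x y hx hy => rw [map_add]; exact add_mem hx hy

lemma finrank_le_finrank_lim (W : Submodule LSer (LG 𝔤)) :
    Module.finrank LSer W ≤ Module.finrank ℂ (lim W) := by
  obtain ⟨U, hU⟩ := Submodule.exists_isCompl (lim W)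
  have h : lsub U ⊓ W = ⊥ := by
    refine (Submodule.eq_bot_iff _).mpr fun X hX => ?_
    by_contra hne
    obtain ⟨m, hm, hm'⟩ := exists_leading_coeff hne
    refine hm' ?_
    rw [← Submodule.mem_bot ℂ, ← hU.inf_eq_bot]
    exact ⟨⟨_, W.smul_mem _ hX.2, hm, rfl⟩,
      lcoeff_mem_of_mem_lsub ((lsub U).smul_mem _ hX.1) 0⟩
  have h1 := Submodule.finrank_sup_add_finrank_inf_eq (lsub U) W
  have h2 := Submodule.finrank_add_eq_of_isCompl hU
  have h3 := Submodule.finrank_le (lsub U ⊔ W)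
  rw [h, finrank_bot, finrank_lsub] at h1
  rw [Module.finrank_baseChange] at h3
  omega

end FiniteDimensional

end Loops

/-! ### Exponentials of nilpotent derivations -/

open Nat in
/-- The exponential of a nilpotent derivation is an automorphism. -/
lemma exists_exp {K L : Type*} [Field K] [CharZero K] [LieRing L] [LieAlgebra K L]
    (D : LieDerivation K L L) (hD : IsNilpotent D.toLinearMap) :
    ∃ E : L ≃ₗ⁅K⁆ L, ∀ n, D.toLinearMap ^ n = 0 → ∀ x,
      E x = ∑ i ∈ Finset.range n, (i ! : K)⁻¹ • (D.toLinearMap ^ i) x := by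
  let _ : Module ℚ L := Module.compHom L (algebraMap ℚ K)
  let _ : LieAlgebra ℚ L := { lie_smul := fun q x y => lie_smul (algebraMap ℚ K q) x y }
  refine ⟨D.exp hD, fun n hn x => ?_⟩
  rw [LieDerivation.exp_map_apply, IsNilpotent.exp_eq_sum hn, LinearMap.sum_apply]
  refine Finset.sum_congr rfl fun i _ => ?_
  rw [inv_natCast_smul_eq ℚ K, LinearMap.smul_apply]

open LSer

section Limit

variable {𝔤 : Type*} [LieRing 𝔤] [LieAlgebra ℂ 𝔤]

instance : CharZero LSer := charZero_of_injective_algebraMap (algebraMap ℂ LSer).injective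

lemma lder_mem_lsub {U : Submodule ℂ 𝔤} {X : LG 𝔤} (hX : X ∈ lsub U) : lder X ∈ lsub U := by
  refine lsub_induction (p := fun X => lder X ∈ lsub U) (by simp) (fun x y hx hy => ?_)
    (fun s v hv => tmul_mem_lsub _ hv) hX
  rw [map_add]; exact add_mem hx hy

lemma baseChange_mem_lsub {U : Submodule ℂ 𝔤} {f : Module.End ℂ 𝔤} (hf : ∀ x ∈ U, f x ∈ U)
    {X : LG 𝔤} (hX : X ∈ lsub U) : f.baseChange LSer X ∈ lsub U := by
  refine lsub_induction (p := fun X => f.baseChange LSer X ∈ lsub U) (by simp)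
    (fun x y hx hy => ?_) (fun s v hv => ?_) hX
  · rw [map_add]; exact add_mem hx hy
  · rw [LinearMap.baseChange_tmul]; exact tmul_mem_lsub _ (hf v hv)

/-- A subspace stable under `∂_t + t⁻² D` has a limit stable under `D`. -/
lemma apply_mem_lim {W : Submodule LSer (LG 𝔤)} {D : Module.End ℂ 𝔤}
    (hW : ∀ X ∈ W, tpow 2 • lder X + D.baseChange LSer X ∈ W) {v : 𝔤} (hv : v ∈ lim W) :
    D v ∈ lim W := by
  obtain ⟨w, hw, hw', rfl⟩ := hv
  refine ⟨_, hW w hw, fun n hn => ?_, ?_⟩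
  · rw [map_add, lcoeff_tpow_smul, lcoeff_lder, lcoeff_baseChange, hw' n hn, map_zero, add_zero,
      hw' _ (by omega), smul_zero]
  · rw [map_add, lcoeff_tpow_smul, lcoeff_lder, lcoeff_baseChange, hw' _ (by omega), smul_zero,
      zero_add]

lemma baseChange_mem_lim {W : Submodule LSer (LG 𝔤)} {D : Module.End ℂ 𝔤}
    (hW : ∀ X ∈ W, D.baseChange LSer X ∈ W) {v : 𝔤} (hv : v ∈ lim W) :
    D v ∈ lim W := by
  obtain ⟨w, hw, hw', rfl⟩ := hv
  exact ⟨_, hW w hw, fun n hn => by rw [lcoeff_baseChange, hw' n hn, map_zero],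
    lcoeff_baseChange ..⟩

lemma exists_exp_derivation {D : Module.End ℂ 𝔤} (hD : ∀ x y, D ⁅x, y⁆ = ⁅D x, y⁆ + ⁅x, D y⁆)
    (hn : IsNilpotent D) :
    ∃ E : LG 𝔤 ≃ₗ⁅LSer⁆ LG 𝔤,
      (∀ X, tpow 2 • lder (E X) + D.baseChange LSer (E X) = E (tpow 2 • lder X)) ∧
      (∀ U : Submodule ℂ 𝔤, (∀ x ∈ U, D x ∈ U) → ∀ X ∈ lsub U, E X ∈ lsub U) ∧
      (∀ f : Module.End ℂ 𝔤, Commute f D →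
        ∀ X, f.baseChange LSer (E X) = E (f.baseChange LSer X)) := by
  have hder (X Y : LG 𝔤) :
      D.baseChange LSer ⁅X, Y⁆ = ⁅D.baseChange LSer X, Y⁆ + ⁅X, D.baseChange LSer Y⁆ := by
    induction X using TensorProduct.induction_on with
    | zero => simp
    | add x x' hx hx' => simp only [map_add, add_lie, hx, hx']; abel
    | tmul s x =>
      induction Y using TensorProduct.induction_on with
      | zero => simp
      | add y y' hy hy' => simp only [map_add, lie_add, hy, hy']; abel
      | tmul u y =>
        simp only [LieAlgebra.ExtendScalars.bracket_tmul, LinearMap.baseChange_tmul, hD,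
          TensorProduct.tmul_add]
  let N : LieDerivation LSer (LG 𝔤) (LG 𝔤) :=
    { toLinearMap := tpow (-1) • D.baseChange LSer
      leibniz' := fun X Y => by
        rw [LinearMap.smul_apply, LinearMap.smul_apply, LinearMap.smul_apply, hder, smul_add,
          lie_smul, lie_smul, ← lie_skew Y, smul_neg, sub_neg_eq_add, add_comm] }
  have hN (X : LG 𝔤) : N.toLinearMap X = tpow (-1) • D.baseChange LSer X := rfl
  have hpow (m : ℕ) (hm : D ^ m = 0) : N.toLinearMap ^ m = 0 := by
    change (tpow (-1) • D.baseChange LSer) ^ m = 0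
    rw [smul_pow, ← LinearMap.baseChange_pow, hm, LinearMap.baseChange_zero, smul_zero]
  obtain ⟨m, hm⟩ := hn
  obtain ⟨E, hE⟩ := exists_exp N ⟨m, hpow m hm⟩
  have hE' := hE (m + 1) (by rw [pow_succ, hpow m hm, zero_mul])
  replace hE := hE m (hpow m hm)
  have hcomm (f : Module.End ℂ 𝔤) (hf : Commute f D) (i : ℕ) (X : LG 𝔤) :
      f.baseChange LSer ((N.toLinearMap ^ i) X) = (N.toLinearMap ^ i) (f.baseChange LSer X) := by
    induction i with
    | zero => rfl
    | succ i ih =>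
      have h (Y : LG 𝔤) : f.baseChange LSer (D.baseChange LSer Y) =
          D.baseChange LSer (f.baseChange LSer Y) := by
        rw [← Module.End.mul_apply, ← Module.End.mul_apply, ← LinearMap.baseChange_mul,
          ← LinearMap.baseChange_mul, hf.eq]
      rw [pow_succ', Module.End.mul_apply, Module.End.mul_apply, ← ih, hN, hN, map_smul, h]
  have hlder (i : ℕ) (X : LG 𝔤) : tpow 2 • lder ((N.toLinearMap ^ i) X) =
      (N.toLinearMap ^ i) (tpow 2 • lder X) - (i : LSer) • tpow 1 • (N.toLinearMap ^ i) X := by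
    induction i with
    | zero => simp
    | succ i ih =>
      have h (Y : LG 𝔤) :
          tpow 2 • lder (N.toLinearMap Y) =
            N.toLinearMap (tpow 2 • lder Y) - tpow 1 • N.toLinearMap Y := by
        rw [hN, hN, lder_smul, der_tpow, lder_baseChange, map_smul, smul_assoc, smul_add,
          smul_comm (tpow 2), tpow_smul_tpow_smul, tpow_smul_tpow_smul, tpow_smul_tpow_smul,
          tpow_smul_tpow_smul]
        norm_num
        abel
      rw [pow_succ', Module.End.mul_apply, h, ih, map_sub, map_smul _ (i : LSer), map_smul _ (tpow 1),
        Module.End.mul_apply, Nat.cast_succ, add_smul, one_smul]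
      abel
  refine ⟨E, fun X => ?_, fun U hU X hX => ?_, fun f hf X => ?_⟩
  · have h1 : D.baseChange LSer (E X) = ∑ i ∈ Finset.range (m + 1),
        (i.factorial : LSer)⁻¹ • (i : LSer) • tpow 1 • (N.toLinearMap ^ i) X := by
      rw [Finset.sum_range_succ', Nat.cast_zero, zero_smul, smul_zero, add_zero, hE, map_sum]
      refine Finset.sum_congr rfl fun i _ => ?_
      rw [pow_succ', Module.End.mul_apply, hN, tpow_smul_tpow_smul, add_neg_cancel, tpow_zero,
        one_smul, map_smul, smul_smul, Nat.factorial_succ, Nat.cast_mul, mul_inv_rev, mul_assoc,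
        inv_mul_cancel₀ (Nat.cast_ne_zero.mpr i.succ_ne_zero), mul_one]
    have h2 : tpow 2 • lder (E X) = ∑ i ∈ Finset.range (m + 1),
        (i.factorial : LSer)⁻¹ • tpow 2 • lder ((N.toLinearMap ^ i) X) := by
      rw [hE', map_sum, Finset.smul_sum]
      refine Finset.sum_congr rfl fun i _ => ?_
      rw [inv_natCast_smul_eq LSer ℂ, inv_natCast_smul_eq LSer ℂ, map_smul, smul_comm]
    rw [h1, h2, hE', ← Finset.sum_add_distrib]
    refine Finset.sum_congr rfl fun i _ => ?_
    rw [← smul_add, hlder, sub_add_cancel]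
  · rw [hE]
    refine sum_mem fun i hi => Submodule.smul_mem _ _ ?_
    clear hi
    induction i with
    | zero => exact hX
    | succ i ih =>
      rw [pow_succ', Module.End.mul_apply, hN]
      exact Submodule.smul_mem _ _ (baseChange_mem_lsub hU ih)
  · rw [hE, hE, map_sum]
    exact Finset.sum_congr rfl fun i _ => by rw [map_smul, hcomm f hf]

/-- A limit of the images of a subalgebra under a family of exponentials. -/
lemma exists_fixed_of_derivation [FiniteDimensional ℂ 𝔤] {D : Module.End ℂ 𝔤}
    (hD : ∀ x y, D ⁅x, y⁆ = ⁅D x, y⁆ + ⁅x, D y⁆) (hn : IsNilpotent D) {p : Submodule ℂ 𝔤}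
    (hp : Solv p) (hpp : brk p p ≤ p) :
    ∃ q : Submodule ℂ 𝔤, Solv q ∧ brk q q ≤ q ∧ Module.finrank ℂ p ≤ Module.finrank ℂ q ∧
      (∀ x ∈ q, D x ∈ q) ∧
      (∀ f : Module.End ℂ 𝔤, Commute f D → (∀ x ∈ p, f x ∈ p) → ∀ x ∈ q, f x ∈ q) ∧
      (∀ B : Submodule ℂ 𝔤, (∀ x ∈ B, D x ∈ B) → brk B p ≤ p → brk B q ≤ q) := by
  obtain ⟨E, hE, hE', hE''⟩ := exists_exp_derivation hD hn
  have hmap (P Q : Submodule LSer (LG 𝔤)) :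
      brk (P.map (E : LG 𝔤 →ₗ[LSer] LG 𝔤)) (Q.map (E : LG 𝔤 →ₗ[LSer] LG 𝔤)) ≤
        (brk P Q).map (E : LG 𝔤 →ₗ[LSer] LG 𝔤) := by
    rw [brk_le]
    rintro - ⟨x, hx, rfl⟩ - ⟨y, hy, rfl⟩
    exact ⟨⁅x, y⁆, lie_mem_brk hx hy, LieEquiv.map_lie E x y⟩
  have hbrk {B P Q : Submodule ℂ 𝔤} (h : brk B P ≤ Q) :
      brk (lim ((lsub B).map (E : LG 𝔤 →ₗ[LSer] LG 𝔤)))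
        (lim ((lsub P).map (E : LG 𝔤 →ₗ[LSer] LG 𝔤))) ≤
        lim ((lsub Q).map (E : LG 𝔤 →ₗ[LSer] LG 𝔤)) :=
    (brk_lim_le _ _).trans (lim_mono ((hmap _ _).trans (Submodule.map_mono
      ((brk_lsub_le _ _).trans (lsub_mono h)))))
  refine ⟨lim ((lsub p).map (E : LG 𝔤 →ₗ[LSer] LG 𝔤)),
    solv_lim ((solv_lsub hp).map (E : LG 𝔤 →ₗ⁅LSer⁆ LG 𝔤)), hbrk hpp, ?_, ?_, ?_, ?_⟩
  · rw [← finrank_lsub p, ← LinearEquiv.finrank_map_eq E.toLinearEquiv (lsub p)]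
    exact finrank_le_finrank_lim _
  · intro x hx
    refine apply_mem_lim ?_ hx
    rintro - ⟨w, hw, rfl⟩
    exact ⟨_, (lsub p).smul_mem _ (lder_mem_lsub hw), (hE w).symm⟩
  · intro f hf hfp x hx
    refine baseChange_mem_lim ?_ hx
    rintro - ⟨w, hw, rfl⟩
    exact ⟨_, baseChange_mem_lsub hfp hw, (hE'' f hf w).symm⟩
  · intro B hB hBp
    refine le_trans (brk_mono ?_ le_rfl) (hbrk hBp)
    have h : (lsub B).map (E : LG 𝔤 →ₗ[LSer] LG 𝔤) = lsub B := by
      refine Submodule.eq_of_le_of_finrank_eq ?_ (LinearEquiv.finrank_map_eq E.toLinearEquiv _)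
      rintro - ⟨w, hw, rfl⟩
      exact hE' B hB w hw
    rw [h, lim_lsub]

end Limit

/-! ### Solvable subalgebras normalized by a solvable subalgebra -/

section Fixed

variable {𝔤 : Type*} [LieRing 𝔤] [LieAlgebra ℂ 𝔤] [FiniteDimensional ℂ 𝔤]

/-- The complex numbers as an ordered additive group. -/
def lexToComplex (γ : ℝ ×ₗ ℝ) : ℂ := ⟨(ofLex γ).1, (ofLex γ).2⟩

lemma lexToComplex_add (γ δ : ℝ ×ₗ ℝ) :
    lexToComplex (γ + δ) = lexToComplex γ + lexToComplex δ := rfl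

lemma lexToComplex_bijective : Function.Bijective lexToComplex := by
  refine ⟨fun γ δ h => ?_, fun c => ⟨toLex (c.re, c.im), rfl⟩⟩
  have h1 := congrArg Complex.re h
  have h2 := congrArg Complex.im h
  exact ofLex.injective (Prod.ext h1 h2)

/-- The grading by the generalized eigenspaces of `ad z`. -/
lemma exists_grading_ad (z : 𝔤) :
    ∃ G : Grading (ℝ ×ₗ ℝ) ℂ 𝔤, G.IsLie ∧
      (∀ c x, G.proj c x ∈ (LieAlgebra.ad ℂ 𝔤 z).maxGenEigenspace (lexToComplex c)) ∧
      (∀ c, ∀ x ∈ (LieAlgebra.ad ℂ 𝔤 z).maxGenEigenspace (lexToComplex c), G.proj c x = x) ∧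
      (∀ B : Submodule ℂ 𝔤, (∀ x ∈ B, ⁅z, x⁆ ∈ B) → ∀ x ∈ B, ∀ c, G.proj c x ∈ B) := by
  have hint : DirectSum.IsInternal
      fun c => (LieAlgebra.ad ℂ 𝔤 z).maxGenEigenspace (lexToComplex c) := by
    rw [DirectSum.isInternal_submodule_iff_iSupIndep_and_iSup_eq_top]
    refine ⟨(Module.End.independent_maxGenEigenspace _).comp lexToComplex_bijective.1, ?_⟩
    rw [lexToComplex_bijective.2.iSup_comp (g := (LieAlgebra.ad ℂ 𝔤 z).maxGenEigenspace)]
    exact Module.End.iSup_maxGenEigenspace_eq_top _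
  obtain ⟨G, h1, h2⟩ := Grading.exists_of_isInternal _ hint
  refine ⟨G, fun a b x y => h2 _ _ ?_, h1, h2, fun B hB x hx c => ?_⟩
  · rw [lexToComplex_add]
    exact LieModule.lie_mem_maxGenEigenspace_toEnd (h1 a x) (h1 b y)
  · have hx' : x ∈ ⨆ μ, B ⊓ (LieAlgebra.ad ℂ 𝔤 z).genEigenspace μ ⊤ := by
      rw [← Submodule.inf_iSup_genEigenspace hB]
      refine ⟨hx, ?_⟩
      rw [show ⨆ μ, (LieAlgebra.ad ℂ 𝔤 z).genEigenspace μ ⊤ = ⊤ from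
        Module.End.iSup_maxGenEigenspace_eq_top _]
      trivial
    refine Submodule.iSup_induction _ (motive := fun x => G.proj c x ∈ B) hx' (fun μ y hy => ?_)
      (by simp) fun y y' hy hy' => by rw [map_add]; exact add_mem hy hy'
    obtain ⟨d, rfl⟩ := lexToComplex_bijective.2 μ
    have hd : G.proj d y = y := h2 d y hy.2
    rcases eq_or_ne c d with rfl | hcd
    · rw [hd]; exact hy.1
    · rw [G.proj_of_eq hd hcd]; exact zero_mem _

/-- A step towards a subalgebra normalized by `z`. -/
lemma exists_fixed_step (z : 𝔤) {p : Submodule ℂ 𝔤} (hp : Solv p) (hpp : brk p p ≤ p) :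
    ∃ q : Submodule ℂ 𝔤, Solv q ∧ brk q q ≤ q ∧ Module.finrank ℂ p ≤ Module.finrank ℂ q ∧
      (∀ x ∈ q, ⁅z, x⁆ ∈ q) ∧
      (∀ B : Submodule ℂ 𝔤, (∀ x ∈ B, ⁅z, x⁆ ∈ B) → brk B p ≤ p → brk B q ≤ q) := by
  obtain ⟨G, hG, hG1, hG2, hG3⟩ := exists_grading_ad z
  set A : Module.End ℂ 𝔤 := LieAlgebra.ad ℂ 𝔤 z with hA
  set S : Module.End ℂ 𝔤 := ∑ c ∈ G.supp, lexToComplex c • G.proj c with hS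
  have hAx (x : 𝔤) : A x = ⁅z, x⁆ := rfl
  have hproj (c : ℝ ×ₗ ℝ) (x : 𝔤) : G.proj c (A x) = A (G.proj c x) := by
    conv_lhs => rw [← G.sum_proj x, map_sum, map_sum]
    have hd (d : ℝ ×ₗ ℝ) : G.proj d (A (G.proj d x)) = A (G.proj d x) :=
      hG2 _ _ (Module.End.mapsTo_maxGenEigenspace_of_comm (Commute.refl A) _ (hG1 d x))
    by_cases hc : c ∈ G.supp
    · rw [Finset.sum_eq_single_of_mem c hc fun d _ hdc => G.proj_of_eq (hd d) hdc.symm, hd]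
    · rw [G.proj_eq_zero hc x, map_zero]
      exact Finset.sum_eq_zero fun d _ => G.proj_eq_zero hc _
  have hSc (c : ℝ ×ₗ ℝ) (x : 𝔤) : G.proj c (S x) = lexToComplex c • G.proj c x := by
    simp only [hS, LinearMap.sum_apply, LinearMap.smul_apply, map_sum, map_smul]
    by_cases hc : c ∈ G.supp
    · rw [Finset.sum_eq_single_of_mem c hc fun d _ hdc => by
        rw [G.proj_proj_ne _ _ hdc.symm, smul_zero], G.proj_proj_self]
    · rw [G.proj_eq_zero hc x, smul_zero]
      exact Finset.sum_eq_zero fun d _ => by rw [G.proj_eq_zero hc, smul_zero]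
  have hder (x y : 𝔤) : (A - S) ⁅x, y⁆ = ⁅(A - S) x, y⁆ + ⁅x, (A - S) y⁆ := by
    have h1 : S ⁅x, y⁆ = ⁅S x, y⁆ + ⁅x, S y⁆ := by
      refine G.ext_proj fun c => ?_
      rw [hSc, map_add, hG.proj_lie, hG.proj_lie, hG.proj_lie, Finset.smul_sum,
        ← Finset.sum_add_distrib]
      refine Finset.sum_congr rfl fun i _ => ?_
      rw [hSc, hSc, smul_lie, lie_smul, ← add_smul, ← lexToComplex_add, add_sub_cancel]
    simp only [LinearMap.sub_apply, h1, hAx, sub_lie, lie_sub]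
    rw [leibniz_lie]
    abel
  have hc (c : ℝ ×ₗ ℝ) : Commute (G.proj c) (A - S) := LinearMap.ext fun x => by
    rw [Module.End.mul_apply, Module.End.mul_apply, LinearMap.sub_apply, LinearMap.sub_apply,
      map_sub, hproj, hSc]
    congr 1
    refine G.ext_proj fun d => ?_
    rw [hSc, map_smul]
    rcases eq_or_ne d c with rfl | h
    · rfl
    · rw [G.proj_proj_ne _ _ h, smul_zero, smul_zero]
  have hnil : IsNilpotent (A - S) := by
    refine ⟨Module.finrank ℂ 𝔤, LinearMap.ext fun x => G.ext_proj fun c => ?_⟩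
    have hk (k : ℕ) : G.proj c (((A - S) ^ k) x) =
        ((A - algebraMap ℂ _ (lexToComplex c)) ^ k) (G.proj c x) := by
      induction k with
      | zero => rfl
      | succ k ih =>
        rw [pow_succ', pow_succ', Module.End.mul_apply, Module.End.mul_apply, ← ih,
          LinearMap.sub_apply, LinearMap.sub_apply, map_sub, hproj, hSc,
          Module.algebraMap_end_apply]
    rw [hk, LinearMap.zero_apply, map_zero]
    have := hG1 c x
    rw [Module.End.maxGenEigenspace_eq_genEigenspace_finrank, Module.End.mem_genEigenspace_nat]
      at this
    exact this
  obtain ⟨q, hq1, hq2, hq3, hq4, hq5, hq6⟩ :=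
    exists_fixed_of_derivation hder hnil (hG.solv_gr hp) ((hG.brk_gr_le p p).trans (G.gr_mono hpp))
  have hS' (B : Submodule ℂ 𝔤) (hB : ∀ c, ∀ x ∈ B, G.proj c x ∈ B) (x : 𝔤) (hx : x ∈ B) :
      S x ∈ B := by
    rw [hS, LinearMap.sum_apply]
    exact sum_mem fun c _ => B.smul_mem _ (hB c x hx)
  refine ⟨q, hq1, hq2, (G.finrank_le_finrank_gr p).trans hq3, fun x hx => ?_, fun B hB hBp => ?_⟩
  · have := add_mem (hq4 x hx)
      (hS' q (fun c => hq5 _ (hc c) fun y hy => G.proj_mem_gr hy c) x hx)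
    rwa [LinearMap.sub_apply, sub_add_cancel, hAx] at this
  · refine hq6 B (fun x hx => sub_mem (hB x hx) (hS' B (fun c x hx => hG3 B hB x hx c) x hx)) ?_
    exact (brk_mono (G.le_gr (hG3 B hB)) le_rfl).trans
      ((hG.brk_gr_le _ _).trans (G.gr_mono hBp))

lemma exists_fixed {p : Submodule ℂ 𝔤} (hp : Solv p) (hpp : brk p p ≤ p) {B : Submodule ℂ 𝔤}
    (hB : Solv B) (hBB : brk B B ≤ B) :
    ∃ q : Submodule ℂ 𝔤, Solv q ∧ brk q q ≤ q ∧ Module.finrank ℂ p ≤ Module.finrank ℂ q ∧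
      brk B q ≤ q := by
  induction hd : Module.finrank ℂ B using Nat.strong_induction_on generalizing B with
  | _ d ih =>
  rcases eq_or_ne B ⊥ with rfl | hne
  · exact ⟨p, hp, hpp, le_rfl, brk_le.mpr fun x hx y hy => by
      rw [(Submodule.mem_bot ℂ).mp hx, zero_lie]; exact zero_mem _⟩
  have hlt : ¬ B ≤ brk B B := fun h => hne <| by
    have h' : ∀ n, dser B n = B := fun n => by
      induction n with
      | zero => rfl
      | succ n ih => rw [dser, ih]; exact le_antisymm hBB h
    obtain ⟨n, hn⟩ := hB
    rw [← hn, h' n]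
  obtain ⟨z, hz, hz'⟩ := Set.not_subset.mp hlt
  obtain ⟨f, hf, hf'⟩ := Submodule.exists_le_ker_of_notMem hz'
  have h1 : B ⊓ LinearMap.ker f < B := lt_of_le_of_ne inf_le_left fun h =>
    hf (h.ge hz).2
  have h2 : brk B B ≤ B ⊓ LinearMap.ker f := le_inf hBB hf'
  obtain ⟨q, hq1, hq2, hq3, hq4⟩ := ih _ (hd ▸ Submodule.finrank_lt_finrank_of_lt h1)
    (hB.mono inf_le_left) ((brk_mono inf_le_left inf_le_left).trans h2) rfl
  obtain ⟨r, hr1, hr2, hr3, hr4, hr5⟩ := exists_fixed_step z hq1 hq2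
  refine ⟨r, hr1, hr2, hq3.trans hr3, brk_le.mpr fun x hx y hy => ?_⟩
  have h5 := hr5 _ (fun x hx => h2 (lie_mem_brk hz hx.1)) hq4
  have hx' : x - (f x / f z) • z ∈ B ⊓ LinearMap.ker f :=
    ⟨sub_mem hx (B.smul_mem _ hz), by simp [LinearMap.mem_ker, div_mul_cancel₀ _ hf]⟩
  rw [← sub_add_cancel x ((f x / f z) • z), add_lie, smul_lie]
  exact add_mem (h5 (lie_mem_brk hx' hy)) (r.smul_mem _ (hr4 y hy))

end Fixed

/-! ### A consequence of Lie's theorem -/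

/-- Commutators in a solvable Lie algebra act nilpotently. -/
lemma isNilpotent_toEnd_lie {k L : Type*} [Field k] [CharZero k] [IsAlgClosed k] [LieRing L]
    [LieAlgebra k L] [LieAlgebra.IsSolvable L] (M : Type*) [AddCommGroup M] [Module k M]
    [LieRingModule L M] [LieModule k L M] [FiniteDimensional k M] {w : L}
    (hw : ∀ χ : Module.Dual k L, (∀ x y : L, χ ⁅x, y⁆ = 0) → χ w = 0) :
    IsNilpotent (LieModule.toEnd k L M w) := by
  induction hd : Module.finrank k M using Nat.strong_induction_on generalizing M with
  | _ d ih =>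
  rcases subsingleton_or_nontrivial M with hM | hM
  · exact ⟨1, LinearMap.ext fun m => Subsingleton.elim _ _⟩
  obtain ⟨χ, hχ⟩ := LieModule.exists_nontrivial_weightSpace_of_isSolvable k L M
  obtain ⟨⟨v, hv⟩, hv0⟩ := exists_ne (0 : LieModule.weightSpace M χ)
  replace hv0 : v ≠ 0 := fun h => hv0 (Subtype.ext h)
  rw [LieModule.mem_weightSpace] at hv
  have hχ0 (x y : L) : χ ⁅x, y⁆ = 0 := by
    have h := hv ⁅x, y⁆
    rw [lie_lie, hv, hv, lie_smul, lie_smul, hv, hv, smul_smul, smul_smul, mul_comm, sub_self] at h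
    exact (smul_eq_zero.mp h.symm).resolve_right hv0
  let N : LieSubmodule k L M :=
    { Submodule.span k {v} with
      lie_mem := fun {x m} hm => by
        obtain ⟨a, rfl⟩ := Submodule.mem_span_singleton.mp hm
        rw [lie_smul, hv, smul_smul]
        exact Submodule.smul_mem _ _ (Submodule.mem_span_singleton_self v) }
  have hlt : Module.finrank k (M ⧸ N) < d := by
    have h1 := Submodule.finrank_quotient_add_finrank N.toSubmodule
    have h2 : Module.finrank k N.toSubmodule = 1 := finrank_span_singleton hv0
    have h3 : Module.finrank k (M ⧸ N) = Module.finrank k (M ⧸ N.toSubmodule) := rfl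
    omega
  obtain ⟨n, hn⟩ := ih _ hlt (M ⧸ N) rfl
  refine ⟨n + 1, LinearMap.ext fun m => ?_⟩
  have hk (i : ℕ) : LieSubmodule.Quotient.mk' N ((LieModule.toEnd k L M w ^ i) m) =
      (LieModule.toEnd k L (M ⧸ N) w ^ i) (LieSubmodule.Quotient.mk' N m) := by
    induction i with
    | zero => rfl
    | succ i ih => rw [pow_succ', pow_succ', Module.End.mul_apply, Module.End.mul_apply, ← ih]; rfl
  have h := hk n
  rw [hn, LinearMap.zero_apply] at h
  have hmem : (LieModule.toEnd k L M w ^ n) m ∈ N :=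
    (LieSubmodule.Quotient.mk_eq_zero' (N := N)).mp h
  obtain ⟨a, ha⟩ := Submodule.mem_span_singleton.mp hmem
  rw [pow_succ', Module.End.mul_apply, ← ha, map_smul, LieModule.toEnd_apply_apply, hv, hw χ hχ0,
    zero_smul, smul_zero, LinearMap.zero_apply]

/-- Elements of the derived algebra of a solvable subalgebra are ad-nilpotent. -/
lemma isNilpotent_ad_of_mem_brk {L : Type*} [LieRing L] [LieAlgebra ℂ L] [FiniteDimensional ℂ L]
    {S : Submodule ℂ L} (hS : Solv S) (hSS : brk S S ≤ S) {w : L} (hw : w ∈ brk S S) :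
    IsNilpotent (LieAlgebra.ad ℂ L w) := by
  let S' := ofBrkLe S hSS
  have : LieAlgebra.IsSolvable S' := (isSolvable_iff_solv S').mpr hS
  refine isNilpotent_toEnd_lie (L := S') L (w := ⟨w, hSS hw⟩) fun χ hχ => ?_
  have h : brk S S ≤ (LinearMap.ker χ).map S.subtype :=
    brk_le.mpr fun x hx y hy => ⟨⟨⁅x, y⁆, hSS (lie_mem_brk hx hy)⟩, hχ ⟨x, hx⟩ ⟨y, hy⟩, rfl⟩
  obtain ⟨w', hw', rfl⟩ := h hw
  exact hw'

/-! ### The principal grading -/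

namespace Grading

/-- The grading with opposite degrees. -/
def neg {k V : Type*} [Field k] [AddCommGroup V] [Module k V] (G : Grading ℤ k V) :
    Grading ℤ k V where
  supp := G.supp.map (Equiv.neg ℤ).toEmbedding
  proj c := G.proj (-c)
  proj_proj_self c := G.proj_proj_self _
  proj_proj_ne c d h := G.proj_proj_ne _ _ (by simpa using h)
  sum_proj x := by
    rw [Finset.sum_map]
    simpa using G.sum_proj x

lemma IsLie.neg {k L : Type*} [Field k] [LieRing L] [LieAlgebra k L] {G : Grading ℤ k L}
    (hG : G.IsLie) : G.neg.IsLie := fun a b x y => by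
  have := hG (-a) (-b) x y
  rwa [← neg_add] at this

/-- Operators that act by scalars on the homogeneous components commute with the projections. -/
lemma proj_apply_of_forall {Γ k V : Type*} [Field k] [AddCommGroup V] [Module k V]
    (G : Grading Γ k V) {T : Module.End k V} {a : Γ → k}
    (hT : ∀ c x, T (G.proj c x) = a c • G.proj c x) (c : Γ) (x : V) :
    G.proj c (T x) = a c • G.proj c x := by
  conv_lhs => rw [← G.sum_proj x, map_sum, map_sum]
  simp only [hT, map_smul]
  by_cases hc : c ∈ G.supp
  · rw [Finset.sum_eq_single_of_mem c hc fun d _ hdc => by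
      rw [G.proj_proj_ne _ _ hdc.symm, smul_zero], G.proj_proj_self]
  · rw [G.proj_eq_zero hc x, smul_zero]
    exact Finset.sum_eq_zero fun d _ => by rw [G.proj_eq_zero hc, smul_zero]

/-- Eigenvectors of operators with distinct eigenvalues on the homogeneous components are
homogeneous. -/
lemma proj_eq_zero_of_apply_eq {Γ k V : Type*} [Field k] [AddCommGroup V] [Module k V]
    (G : Grading Γ k V) {T : Module.End k V} {a : Γ → k}
    (hT : ∀ c x, T (G.proj c x) = a c • G.proj c x) {μ : k} {y : V} (hy : T y = μ • y) {d : Γ}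
    (hd : a d ≠ μ) : G.proj d y = 0 := by
  have h := G.proj_apply_of_forall hT d y
  rw [hy, map_smul, eq_comm, ← sub_eq_zero, ← sub_smul] at h
  exact (smul_eq_zero.mp h).resolve_left (sub_ne_zero.mpr hd)

lemma proj_eq_self {Γ k V : Type*} [Field k] [AddCommGroup V] [Module k V]
    (G : Grading Γ k V) {c : Γ} {y : V} (h : ∀ d, d ≠ c → G.proj d y = 0) : G.proj c y = y := by
  refine G.ext_proj fun d => ?_
  rcases eq_or_ne d c with rfl | hdc
  · rw [G.proj_proj_self]
  · rw [G.proj_proj_ne _ _ hdc, h d hdc]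

/-- A subspace stable under an operator with distinct eigenvalues on the homogeneous components
is homogeneous. -/
lemma proj_mem_of_stable {Γ k V : Type*} [Field k] [AddCommGroup V] [Module k V]
    [FiniteDimensional k V] (G : Grading Γ k V) {T : Module.End k V} {a : Γ → k}
    (ha : Function.Injective a) (hT : ∀ c x, T (G.proj c x) = a c • G.proj c x)
    {B : Submodule k V} (hB : ∀ x ∈ B, T x ∈ B) {x : V} (hx : x ∈ B) (c : Γ) : G.proj c x ∈ B := by
  have hx' : x ∈ ⨆ μ, B ⊓ T.genEigenspace μ 1 := by
    rw [← Submodule.inf_iSup_genEigenspace hB]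
    refine ⟨hx, ?_⟩
    rw [← G.sum_proj x]
    exact sum_mem fun c _ => Submodule.mem_iSup_of_mem (a c)
      (Module.End.mem_eigenspace_iff.mpr (hT c x))
  refine Submodule.iSup_induction _ (motive := fun x => G.proj c x ∈ B) hx' (fun μ y hy => ?_)
    (by simp) fun y y' hy hy' => by rw [map_add]; exact add_mem hy hy'
  have hy2 : T y = μ • y := Module.End.mem_eigenspace_iff.mp hy.2
  by_cases hc : a c = μ
  · have h : G.proj c y = y := G.proj_eq_self fun d hd =>
      G.proj_eq_zero_of_apply_eq hT hy2 fun h => hd (ha (h.trans hc.symm))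
    rw [h]; exact hy.1
  · rw [G.proj_eq_zero_of_apply_eq hT hy2 hc]; exact zero_mem _

end Grading

section Principal

variable {𝔤 : Type*} [LieRing 𝔤] [LieAlgebra ℂ 𝔤] {ι : Type*} [Fintype ι]
  {𝔥 : LieSubalgebra ℂ 𝔤}

lemma exists_rho (b : LieAlgebra.Basis ι 𝔥) :
    ∃ c : ι → ℂ, (∀ i, ⁅∑ j, c j • b.h j, b.e i⁆ = b.e i) ∧
      ∀ i, ⁅∑ j, c j • b.h j, b.f i⁆ = -b.f i := by
  classical
  have hdet : IsUnit (b.A.map (Int.cast : ℤ → ℂ)).det := by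
    rw [isUnit_iff_ne_zero]
    have h := b.nondegen.det_ne_zero
    have h2 : (b.A.map (Int.cast : ℤ → ℂ)).det = (b.A.det : ℂ) :=
      ((Int.castRingHom ℂ).map_det b.A).symm
    rw [h2]
    exact_mod_cast h
  have hc (i : ι) :
      ∑ j, ((b.A.map (Int.cast : ℤ → ℂ))⁻¹.mulVec 1) j * (b.A i j : ℂ) = 1 := by
    have h : (b.A.map (Int.cast : ℤ → ℂ)).mulVec ((b.A.map (Int.cast : ℤ → ℂ))⁻¹.mulVec 1) = 1 := by
      rw [Matrix.mulVec_mulVec, Matrix.mul_nonsing_inv _ hdet, Matrix.one_mulVec]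
    have := congrFun h i
    rw [Matrix.mulVec, dotProduct] at this
    simpa only [mul_comm, Matrix.map_apply, Pi.one_apply] using this
  refine ⟨(b.A.map (Int.cast : ℤ → ℂ))⁻¹.mulVec 1, fun i => ?_, fun i => ?_⟩
  · simp_rw [sum_lie, smul_lie, b.lie_h_e, ← Int.cast_smul_eq_zsmul ℂ, smul_smul]
    rw [← Finset.sum_smul, hc, one_smul]
  · simp_rw [sum_lie, smul_lie, b.lie_h_f, ← Int.cast_smul_eq_zsmul ℂ, smul_smul]
    rw [← Finset.sum_smul]
    simp only [Int.cast_neg, mul_neg, Finset.sum_neg_distrib, hc, neg_smul, one_smul]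

lemma nPlus_le_fil (b : LieAlgebra.Basis ι 𝔥) {G : Grading ℤ ℂ 𝔤} (hG : G.IsLie)
    (h : ∀ i, G.proj 1 (b.e i) = b.e i) : (nPlus b).toSubmodule ≤ G.fil 1 := by
  have hcl : brk (G.fil 1) (G.fil 1) ≤ G.fil 1 := brk_le.mpr fun x hx y hy =>
    G.mem_fil.mpr fun d hd => G.mem_fil.mp (hG.lie_mem_fil hx hy) d (by omega)
  have : nPlus b ≤ ofBrkLe (G.fil 1) hcl := by
    rw [nPlus, LieSubalgebra.lieSpan_le]
    rintro - ⟨i, rfl⟩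
    exact G.mem_fil.mpr fun d hd => G.proj_of_eq (h i) hd.ne
  exact this

lemma cartan_eq_span (b : LieAlgebra.Basis ι 𝔥) :
    𝔥.toSubmodule = Submodule.span ℂ (Set.range b.h) := b.coe_cartan_eq_span

lemma sup_eq_top (b : LieAlgebra.Basis ι 𝔥) :
    𝔥.toSubmodule ⊔ (nMinus b).toSubmodule ⊔ (nPlus b).toSubmodule = ⊤ := by
  have h : 𝔥.toLieSubmodule ⊔ b.borelLower ⊔ b.borelUpper = ⊤ := by
    simpa using b.iSup_cartan_borelLower_borelUpper_eq_top
  have h2 := congrArg LieSubmodule.toSubmodule h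
  rw [LieSubmodule.sup_toSubmodule, LieSubmodule.sup_toSubmodule, LieSubmodule.top_toSubmodule]
    at h2
  exact h2

/-- The principal grading of `𝔤` and the principal `sl₂`-triple. -/
structure PrincipalData (b : LieAlgebra.Basis ι 𝔥) where
  /-- The grading. -/
  G : Grading ℤ ℂ 𝔤
  isLie : G.IsLie
  /-- The semisimple element that defines the grading. -/
  ρ : 𝔤
  /-- The raising element. -/
  e : 𝔤
  lie_rho : ∀ c x, ⁅ρ, G.proj c x⁆ = (c : ℂ) • G.proj c x
  sl2 : IsSl2Triple (2 • ρ) e (∑ i, b.f i)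
  proj_f : G.proj (-1) (∑ i, b.f i) = ∑ i, b.f i
  mem_cartan : ∀ x, x ∈ 𝔥 ↔ ∀ c ≠ 0, G.proj c x = 0
  mem_nPlus : ∀ x, x ∈ nPlus b ↔ ∀ c < 1, G.proj c x = 0
  mem_bPlus : ∀ x, x ∈ bPlus b ↔ ∀ c < 0, G.proj c x = 0
  mem_bMinus : ∀ x, x ∈ bMinus b ↔ ∀ c > 0, G.proj c x = 0

lemma nonempty_principalData [FiniteDimensional ℂ 𝔤] [Nontrivial 𝔤] (b : LieAlgebra.Basis ι 𝔥) :
    Nonempty (PrincipalData b) := by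
  obtain ⟨c, he, hf⟩ := exists_rho b
  set ρ : 𝔤 := ∑ j, c j • b.h j with hρ
  have hρh (i : ι) : ⁅ρ, b.h i⁆ = 0 := by
    rw [hρ, sum_lie]
    exact Finset.sum_eq_zero fun j _ => by rw [smul_lie, b.lie_h_h, smul_zero]
  let M (n : ℤ) : Submodule ℂ 𝔤 := (LieAlgebra.ad ℂ 𝔤 ρ).eigenspace (n : ℂ)
  have hM {n : ℤ} {x : 𝔤} : x ∈ M n ↔ ⁅ρ, x⁆ = (n : ℂ) • x := Module.End.mem_eigenspace_iff
  have hMM {m n : ℤ} {x y : 𝔤} (hx : x ∈ M m) (hy : y ∈ M n) : ⁅x, y⁆ ∈ M (m + n) := by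
    rw [hM] at hx hy ⊢
    rw [leibniz_lie, hx, hy, smul_lie, lie_smul, ← add_smul, Int.cast_add]
  have hcl : brk (⨆ n, M n) (⨆ n, M n) ≤ ⨆ n, M n := by
    rw [brk_le]
    intro x hx y hy
    refine Submodule.iSup_induction _ (motive := fun x => ⁅x, y⁆ ∈ ⨆ n, M n) hx
      (fun m x hx => ?_) (by simp) fun x x' hx hx' => by rw [add_lie]; exact add_mem hx hx'
    refine Submodule.iSup_induction _ (motive := fun y => ⁅x, y⁆ ∈ ⨆ n, M n) hy
      (fun n y hy => ?_) (by simp) fun x x' hx hx' => by rw [lie_add]; exact add_mem hx hx'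
    exact Submodule.mem_iSup_of_mem _ (hMM hx hy)
  have hMe (i : ι) : b.e i ∈ M 1 := hM.mpr (by simp [he])
  have hMf (i : ι) : b.f i ∈ M (-1) := hM.mpr (by simp [hf])
  have htop : ⨆ n, M n = ⊤ := by
    have h : LieSubalgebra.lieSpan ℂ 𝔤 (Set.range b.e ∪ Set.range b.f) ≤ ofBrkLe _ hcl := by
      rw [LieSubalgebra.lieSpan_le]
      rintro - (⟨i, rfl⟩ | ⟨i, rfl⟩)
      · exact Submodule.mem_iSup_of_mem 1 (hMe i)
      · exact Submodule.mem_iSup_of_mem (-1) (hMf i)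
    rw [b.span_ef] at h
    exact eq_top_iff.mpr fun x _ => h (LieSubalgebra.mem_top x)
  have hint : DirectSum.IsInternal M := by
    rw [DirectSum.isInternal_submodule_iff_iSupIndep_and_iSup_eq_top]
    exact ⟨(Module.End.eigenspaces_iSupIndep _).comp Int.cast_injective, htop⟩
  obtain ⟨G, hG1, hG2⟩ := Grading.exists_of_isInternal M hint
  have hG : G.IsLie := fun m n x y => hG2 _ _ (hMM (hG1 m x) (hG1 n y))
  have hp : (nPlus b).toSubmodule ≤ G.fil 1 := nPlus_le_fil b hG fun i => hG2 _ _ (hMe i)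
  have hn : (nMinus b).toSubmodule ≤ G.neg.fil 1 :=
    nPlus_le_fil b.symm (G := G.neg) hG.neg fun i => hG2 _ _ (hMf i)
  have hh {x : 𝔤} (hx : x ∈ 𝔥) : G.proj 0 x = x := by
    refine hG2 _ _ ?_
    rw [← LieSubalgebra.mem_toSubmodule, cartan_eq_span b] at hx
    refine Submodule.span_le.mpr ?_ hx
    rintro - ⟨i, rfl⟩
    exact hM.mpr (by simp [hρh])
  have hdec (x : 𝔤) : ∃ y ∈ 𝔥, ∃ m ∈ nMinus b, ∃ p ∈ nPlus b, y + m + p = x := by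
    have hx : x ∈ 𝔥.toSubmodule ⊔ (nMinus b).toSubmodule ⊔ (nPlus b).toSubmodule := by
      rw [sup_eq_top]; trivial
    obtain ⟨z, hz, p, hp, rfl⟩ := Submodule.mem_sup.mp hx
    obtain ⟨y, hy, m, hm, rfl⟩ := Submodule.mem_sup.mp hz
    exact ⟨y, hy, m, hm, p, hp, rfl⟩
  have hp' {x : 𝔤} (hx : x ∈ nPlus b) {c : ℤ} (hc : c < 1) : G.proj c x = 0 :=
    G.mem_fil.mp (hp hx) c hc
  have hn' {x : 𝔤} (hx : x ∈ nMinus b) {c : ℤ} (hc : -1 < c) : G.proj c x = 0 := by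
    have := G.neg.mem_fil.mp (hn hx) (-c) (by omega)
    change G.proj (- -c) x = 0 at this
    rwa [neg_neg] at this
  have hh' {x : 𝔤} (hx : x ∈ 𝔥) {c : ℤ} (hc : c ≠ 0) : G.proj c x = 0 :=
    G.proj_of_eq (hh hx) hc
  have hρM : ρ ∈ 𝔥 := by
    rw [hρ]
    refine sum_mem fun j _ => ?_
    rw [← LieSubalgebra.mem_toSubmodule, cartan_eq_span b]
    exact Submodule.smul_mem _ _ (Submodule.subset_span ⟨j, rfl⟩)
  have hρ0 : ρ ≠ 0 := by
    intro h0
    have h1 (i : ι) : b.e i = 0 := by rw [← he i, h0, zero_lie]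
    rcases isEmpty_or_nonempty ι with hι | ⟨⟨i⟩⟩
    · have h := b.span_ef
      rw [Set.range_eq_empty, Set.range_eq_empty, Set.empty_union, LieSubalgebra.span_empty] at h
      obtain ⟨x, hx⟩ := exists_ne (0 : 𝔤)
      exact hx ((LieSubalgebra.mem_bot x).mp (h ▸ LieSubalgebra.mem_top x))
    · exact (b.sl2 i).e_ne_zero (h1 i)
  refine ⟨⟨G, hG, ρ, ∑ j, (2 * c j) • b.e j, fun c x => hM.mp (hG1 c x), ⟨?_, ?_, ?_, ?_⟩, ?_,
    fun x => ?_, fun x => ?_, fun x => ?_, fun x => ?_⟩⟩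
  · rw [two_smul, ← two_smul ℂ]
    exact smul_ne_zero two_ne_zero hρ0
  · rw [hρ, sum_lie, Finset.smul_sum]
    refine Finset.sum_congr rfl fun i _ => ?_
    rw [smul_lie, lie_sum, Finset.sum_eq_single i (fun j _ hj => b.lie_e_f_ne i j hj.symm)
      (fun h => absurd (Finset.mem_univ i) h), (b.sl2 i).lie_e_f, mul_smul, two_smul, two_smul]
  · rw [nsmul_lie, lie_sum]
    congr 1
    exact Finset.sum_congr rfl fun i _ => by rw [lie_smul, he]
  · rw [nsmul_lie, lie_sum, ← smul_neg, ← Finset.sum_neg_distrib]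
    simp only [hf]
  · rw [map_sum]
    exact Finset.sum_congr rfl fun i _ => hG2 _ _ (hMf i)
  · refine ⟨fun hx c hc => hh' hx hc, fun h => ?_⟩
    obtain ⟨y, hy, m, hm, p, hp, rfl⟩ := hdec x
    convert hy using 1
    refine G.ext_proj fun c => ?_
    rcases eq_or_ne c 0 with rfl | hc
    · rw [map_add, map_add, hn' hm (by omega), hp' hp (by omega), add_zero, add_zero]
    · rw [h c hc, hh' hy hc]
  · refine ⟨fun hx c hc => hp' hx hc, fun h => ?_⟩
    obtain ⟨y, hy, m, hm, p, hp, rfl⟩ := hdec x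
    convert hp using 1
    refine G.ext_proj fun c => ?_
    rcases lt_or_ge c 1 with hc | hc
    · rw [h c hc, hp' hp hc]
    · rw [map_add, map_add, hh' hy (by omega), hn' hm (by omega), zero_add, zero_add]
  · refine ⟨fun hx c hc => ?_, fun h => ?_⟩
    · obtain ⟨y, hy, p, hp, rfl⟩ := Submodule.mem_sup.mp hx
      rw [map_add, hh' hy hc.ne, hp' hp (by omega), add_zero]
    · obtain ⟨y, hy, m, hm, p, hp, rfl⟩ := hdec x
      refine Set.mem_of_eq_of_mem ?_
        (Submodule.add_mem_sup (S := 𝔥.toSubmodule) (T := (nPlus b).toSubmodule) hy hp)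
      refine G.ext_proj fun c => ?_
      rcases lt_or_ge c 0 with hc | hc
      · rw [h c hc, map_add, hp' hp (by omega), hh' hy hc.ne, zero_add]
      · rw [map_add, map_add, map_add, hn' hm (by omega), add_zero]
  · refine ⟨fun hx c hc => ?_, fun h => ?_⟩
    · obtain ⟨y, hy, p, hp, rfl⟩ := Submodule.mem_sup.mp hx
      rw [map_add, hh' hy hc.ne', hn' hp (by omega), add_zero]
    · obtain ⟨y, hy, m, hm, p, hp, rfl⟩ := hdec x
      refine Set.mem_of_eq_of_mem ?_
        (Submodule.add_mem_sup (S := 𝔥.toSubmodule) (T := (nMinus b).toSubmodule) hy hm)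
      refine G.ext_proj fun c => ?_
      rcases lt_or_ge 0 c with hc | hc
      · rw [h c hc, map_add, hn' hm (by omega), hh' hy hc.ne', zero_add]
      · rw [map_add, hp' hp (by omega), add_zero]

namespace PrincipalData

variable {b : LieAlgebra.Basis ι 𝔥}

lemma proj_rho (D : PrincipalData b) : D.G.proj 0 D.ρ = D.ρ :=
  D.G.proj_eq_self fun d hd => D.G.proj_eq_zero_of_apply_eq (T := LieAlgebra.ad ℂ 𝔤 D.ρ)
    (a := fun c : ℤ => (c : ℂ)) D.lie_rho (μ := 0) (by simp) (Int.cast_ne_zero.mpr hd)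

lemma rho_mem (D : PrincipalData b) : D.ρ ∈ bMinus b :=
  (D.mem_bMinus _).mpr fun _ hc => D.G.proj_of_eq D.proj_rho hc.ne'

lemma f_mem (D : PrincipalData b) : ∑ i, b.f i ∈ bMinus b :=
  (D.mem_bMinus _).mpr fun _ hc => D.G.proj_of_eq D.proj_f (by omega)

/-- `ad f` is injective on elements of positive degree. -/
lemma eq_zero_of_lie_f [FiniteDimensional ℂ 𝔤] (D : PrincipalData b) {j : ℤ} (hj : 1 ≤ j) {y : 𝔤} (hy : D.G.proj j y = y)
    (h : ⁅∑ i, b.f i, y⁆ = 0) : y = 0 := by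
  by_contra hne
  have hp : D.sl2.symm.HasPrimitiveVectorWith y (-(2 * j : ℂ)) :=
    ⟨hne, by rw [neg_lie, nsmul_lie, ← hy, D.lie_rho, neg_smul, mul_smul, two_smul, two_smul], h⟩
  obtain ⟨n, hn⟩ := hp.exists_nat
  have h' : -(2 * j) = (n : ℤ) := by exact_mod_cast hn
  omega

lemma proj_lie_f (D : PrincipalData b) {j : ℤ} {y : 𝔤} (hy : D.G.proj j y = y) :
    D.G.proj (j - 1) ⁅∑ i, b.f i, y⁆ = ⁅∑ i, b.f i, y⁆ := by
  have := D.isLie (-1) j (∑ i, b.f i) y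
  rwa [hy, D.proj_f, neg_add_eq_sub] at this

lemma eq_zero_of_mem_cartan (b : LieAlgebra.Basis ι 𝔥) [LieAlgebra.HasTrivialRadical ℂ 𝔤] {w : 𝔤} (hw : w ∈ 𝔥)
    (hn : IsNilpotent (LieAlgebra.ad ℂ 𝔤 w)) : w = 0 := by
  obtain ⟨n, hn⟩ := hn
  have key (x : 𝔤) (hx : x ≠ 0) (a : ℂ) (h : ⁅w, x⁆ = a • x) : ⁅w, x⁆ = 0 := by
    have hk (k : ℕ) : (LieAlgebra.ad ℂ 𝔤 w ^ k) x = a ^ k • x := by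
      induction k with
      | zero => simp
      | succ k ih =>
        rw [pow_succ', Module.End.mul_apply, ih, map_smul, LieAlgebra.ad_apply, h, smul_smul,
          pow_succ]
    have h0 := hk n
    rw [hn, LinearMap.zero_apply, eq_comm, smul_eq_zero] at h0
    rw [h, eq_zero_of_pow_eq_zero (h0.resolve_right hx), zero_smul]
  have he (i : ι) : ⁅w, b.e i⁆ = 0 :=
    key _ (b.sl2 i).e_ne_zero _ (b.baseSupp_apply_smul_e i ⟨w, hw⟩).symm
  have hf (i : ι) : ⁅w, b.f i⁆ = 0 :=
    key _ (b.sl2 i).f_ne_zero (-b.baseSupp i ⟨w, hw⟩)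
      (by rw [neg_smul, b.baseSupp_apply_smul_f i ⟨w, hw⟩, neg_neg]; rfl)
  have hcl : brk (LinearMap.ker (LieAlgebra.ad ℂ 𝔤 w)) (LinearMap.ker (LieAlgebra.ad ℂ 𝔤 w)) ≤
      LinearMap.ker (LieAlgebra.ad ℂ 𝔤 w) := brk_le.mpr fun x hx y hy => by
    rw [LinearMap.mem_ker, LieAlgebra.ad_apply] at hx hy ⊢
    rw [leibniz_lie, hx, hy, zero_lie, lie_zero, add_zero]
  have h : LieSubalgebra.lieSpan ℂ 𝔤 (Set.range b.e ∪ Set.range b.f) ≤ ofBrkLe _ hcl := by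
    rw [LieSubalgebra.lieSpan_le]
    rintro - (⟨i, rfl⟩ | ⟨i, rfl⟩)
    · exact he i
    · exact hf i
  rw [b.span_ef] at h
  have hw0 : w ∈ LieAlgebra.center ℂ 𝔤 := by
    rw [LieModule.mem_maxTrivSubmodule]
    intro x
    have hx : ⁅w, x⁆ = 0 := h (LieSubalgebra.mem_top x)
    rw [← lie_skew, hx, neg_zero]
  rw [LieAlgebra.center_eq_bot] at hw0
  exact (LieSubmodule.mem_bot w).mp hw0

/-- A homogeneous solvable subalgebra that contains `f` lies in `𝔟₋`. -/
lemma le_bMinus [FiniteDimensional ℂ 𝔤] (D : PrincipalData b) [LieAlgebra.HasTrivialRadical ℂ 𝔤] {S : Submodule ℂ 𝔤} (hS : Solv S)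
    (hSS : brk S S ≤ S) (hSG : ∀ x ∈ S, ∀ c, D.G.proj c x ∈ S) (hf : ∑ i, b.f i ∈ S) :
    S ≤ bMinus b := by
  intro x hx
  rw [D.mem_bMinus]
  intro c hc
  lift c to ℕ using hc.le
  by_contra hne
  obtain ⟨y, hy⟩ : ∃ y, y = D.G.proj c x := ⟨_, rfl⟩
  have hyS : y ∈ S := hy ▸ hSG x hx c
  have key (k : ℕ) (hk : k ≤ c) : (LieAlgebra.ad ℂ 𝔤 (∑ i, b.f i) ^ k) y ∈ S ∧
      (k ≠ 0 → (LieAlgebra.ad ℂ 𝔤 (∑ i, b.f i) ^ k) y ∈ brk S S) ∧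
      (LieAlgebra.ad ℂ 𝔤 (∑ i, b.f i) ^ k) y ≠ 0 ∧
      D.G.proj (c - k) ((LieAlgebra.ad ℂ 𝔤 (∑ i, b.f i) ^ k) y) =
        (LieAlgebra.ad ℂ 𝔤 (∑ i, b.f i) ^ k) y := by
    induction k with
    | zero => exact ⟨hyS, by simp, hy ▸ hne, by simp [hy, D.G.proj_proj_self]⟩
    | succ k ih =>
      obtain ⟨h1, -, h3, h4⟩ := ih (by omega)
      have h5 : (LieAlgebra.ad ℂ 𝔤 (∑ i, b.f i) ^ (k + 1)) y =
          ⁅∑ i, b.f i, (LieAlgebra.ad ℂ 𝔤 (∑ i, b.f i) ^ k) y⁆ := by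
        rw [pow_succ', Module.End.mul_apply, LieAlgebra.ad_apply]
      rw [h5]
      have h6 := lie_mem_brk hf h1
      refine ⟨hSS h6, fun _ => h6, fun h0 => h3 (D.eq_zero_of_lie_f (by omega) h4 h0), ?_⟩
      have := D.proj_lie_f h4
      rwa [sub_sub] at this
  obtain ⟨-, h2, h3, h4⟩ := key c le_rfl
  rw [sub_self] at h4
  exact h3 (eq_zero_of_mem_cartan b ((D.mem_cartan _).mpr fun d hd => D.G.proj_of_eq h4 hd)
    (isNilpotent_ad_of_mem_brk hS hSS (h2 (by simp at hc; omega))))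

lemma brk_bMinus_le (D : PrincipalData b) : brk (bMinus b) (bMinus b) ≤ bMinus b := by
  rw [brk_le]
  intro x hx y hy
  rw [D.mem_bMinus] at hx hy ⊢
  intro c hc
  rw [D.isLie.proj_lie]
  refine Finset.sum_eq_zero fun i _ => ?_
  rcases lt_or_ge 0 i with hi | hi
  · rw [hx i hi, zero_lie]
  · rw [hy (c - i) (by omega), lie_zero]

lemma solv_bMinus (D : PrincipalData b) : Solv (bMinus b) := by
  have key (n : ℕ) : ∀ x ∈ dser (bMinus b) (n + 1), ∀ c : ℤ, -(n + 1 : ℤ) < c →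
      D.G.proj c x = 0 := by
    induction n with
    | zero =>
      intro x hx c hc
      have h : dser (bMinus b) 1 ≤ ⨅ (c : ℤ) (_ : -1 < c), LinearMap.ker (D.G.proj c) := by
        refine brk_le.mpr fun x hx y hy => ?_
        simp only [Submodule.mem_iInf, LinearMap.mem_ker]
        intro c hc
        change x ∈ bMinus b at hx
        change y ∈ bMinus b at hy
        rcases lt_or_ge 0 c with h0 | h0
        · exact (D.mem_bMinus _).mp (D.brk_bMinus_le (lie_mem_brk hx hy)) c h0
        · obtain rfl : c = 0 := by omega
          rw [D.mem_bMinus] at hx hy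
          rw [D.isLie.proj_lie]
          refine Finset.sum_eq_zero fun i _ => ?_
          rcases lt_trichotomy i 0 with hi | rfl | hi
          · rw [hy _ (by omega), lie_zero]
          · have hx0 : D.G.proj 0 x ∈ 𝔥 :=
              (D.mem_cartan _).mpr fun d hd => D.G.proj_proj_ne _ _ hd _
            have hy0 : D.G.proj 0 y ∈ 𝔥 :=
              (D.mem_cartan _).mpr fun d hd => D.G.proj_proj_ne _ _ hd _
            have := b.isLieAbelian_cartan
            rw [zero_sub, neg_zero]
            exact congrArg Subtype.val (trivial_lie_zero 𝔥 𝔥 ⟨_, hx0⟩ ⟨_, hy0⟩)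
          · rw [hx _ hi, zero_lie]
      have := h hx
      simp only [Submodule.mem_iInf, LinearMap.mem_ker] at this
      exact this c (by simpa using hc)
    | succ n ih =>
      intro x hx c hc
      have h : dser (bMinus b) (n + 1 + 1) ≤
          ⨅ (c : ℤ) (_ : -(n + 2 : ℤ) < c), LinearMap.ker (D.G.proj c) := by
        refine brk_le.mpr fun x hx y hy => ?_
        simp only [Submodule.mem_iInf, LinearMap.mem_ker]
        intro c hc
        rw [D.isLie.proj_lie]
        refine Finset.sum_eq_zero fun i _ => ?_
        rcases lt_or_ge (-(n + 1 : ℤ)) i with hi | hi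
        · rw [ih x hx i hi, zero_lie]
        · rw [ih y hy _ (by omega), lie_zero]
      have := h hx
      simp only [Submodule.mem_iInf, LinearMap.mem_ker] at this
      exact this c (by push_cast at hc; omega)
  obtain ⟨N, hN⟩ : ∃ N : ℕ, ∀ c ∈ D.G.supp, -(N + 1 : ℤ) < c := by
    obtain ⟨m, hm⟩ := D.G.supp.bddBelow
    exact ⟨m.natAbs, fun c hc => by have := hm hc; omega⟩
  refine ⟨N + 1, (Submodule.eq_bot_iff _).mpr fun x hx => ?_⟩
  rw [← D.G.sum_proj x]
  exact Finset.sum_eq_zero fun c hc => key N x hx c (hN c hc)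

variable [FiniteDimensional ℂ 𝔤] [LieAlgebra.HasTrivialRadical ℂ 𝔤]

lemma finrank_le (D : PrincipalData b) {P : Submodule ℂ 𝔤} (hP : Solv P) (hPP : brk P P ≤ P) :
    Module.finrank ℂ P ≤ Module.finrank ℂ (bMinus b) := by
  obtain ⟨q, hq, hqq, hle, hn⟩ := exists_fixed hP hPP D.solv_bMinus D.brk_bMinus_le
  have hS := Solv.sup D.solv_bMinus D.brk_bMinus_le hq hqq hn
  have hSS : brk (bMinus b ⊔ q) (bMinus b ⊔ q) ≤ bMinus b ⊔ q :=
    (brk_sup_sup hqq hn).trans (sup_le_sup_right D.brk_bMinus_le _)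
  have h := D.le_bMinus hS hSS (fun x hx c =>
    D.G.proj_mem_of_stable (T := LieAlgebra.ad ℂ 𝔤 D.ρ) (a := fun c : ℤ => (c : ℂ))
      Int.cast_injective D.lie_rho
      (fun y hy => hSS (lie_mem_brk (Submodule.mem_sup_left D.rho_mem) hy)) hx c)
    (Submodule.mem_sup_left D.f_mem)
  exact hle.trans (Submodule.finrank_mono (le_sup_right.trans h))

/-- The Borel subalgebras are the solvable subalgebras of maximal dimension. -/
lemma isBorel_iff (D : PrincipalData b) (B : LieSubalgebra ℂ 𝔤) : IsBorel B ↔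
    Solv B.toSubmodule ∧ Module.finrank ℂ B.toSubmodule = Module.finrank ℂ (bMinus b) := by
  constructor
  · intro h
    have hB := (isSolvable_iff_solv B).mp h.prop
    refine ⟨hB, le_antisymm (D.finrank_le hB (brk_toSubmodule_le B)) ?_⟩
    obtain ⟨q, hq, hqq, hle, hn⟩ :=
      exists_fixed D.solv_bMinus D.brk_bMinus_le hB (brk_toSubmodule_le B)
    have hS := Solv.sup hB (brk_toSubmodule_le B) hq hqq hn
    have hSS : brk (B.toSubmodule ⊔ q) (B.toSubmodule ⊔ q) ≤ B.toSubmodule ⊔ q :=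
      (brk_sup_sup hqq hn).trans (sup_le_sup_right (brk_toSubmodule_le B) _)
    have h2 : ofBrkLe _ hSS ≤ B := h.le_of_ge ((isSolvable_iff_solv (ofBrkLe _ hSS)).mpr hS)
      (show B.toSubmodule ≤ B.toSubmodule ⊔ q from le_sup_left)
    have h3 : B.toSubmodule ⊔ q ≤ B.toSubmodule := h2
    exact hle.trans (Submodule.finrank_mono (le_sup_right.trans h3))
  · rintro ⟨hB, hd⟩
    refine ⟨(isSolvable_iff_solv B).mpr hB, fun C hC hBC => ?_⟩
    have h : B.toSubmodule = C.toSubmodule := Submodule.eq_of_le_of_finrank_le hBC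
      (hd ▸ D.finrank_le ((isSolvable_iff_solv C).mp hC) (brk_toSubmodule_le C))
    exact h.ge

end PrincipalData

end Principal

open LSer

/-! ### Connections with a simple pole and nilpotent residue -/

section NilpotentResidue

/-- Solves a recursion for the coefficients of a power series. -/
def solveRec {E : Type*} [Zero E] (F : ℕ → (ℕ → E) → E) (m : ℕ) : E :=
  F m fun j => if _ : j < m then solveRec F j else 0
termination_by m

lemma isUnit_natCast_add {k A : Type*} [Field k] [CharZero k] [Ring A] [Algebra k A] {N : A}
    (hN : IsNilpotent N) {m : ℕ} (hm : m ≠ 0) : IsUnit ((m : A) + N) := by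
  have hu : IsUnit (m : A) := by
    have := (isUnit_iff_ne_zero.mpr (Nat.cast_ne_zero.mpr hm : (m : k) ≠ 0)).map (algebraMap k A)
    rwa [map_natCast] at this
  exact hN.isUnit_add_left_of_commute hu (Nat.cast_commute m N).symm

variable {𝔤 : Type*} [LieRing 𝔤] [LieAlgebra ℂ 𝔤] [FiniteDimensional ℂ 𝔤]

lemma Integral.ext {X Y : LG 𝔤} (hX : Integral X) (hY : Integral Y)
    (h : ∀ n : ℕ, lcoeff n X = lcoeff n Y) : X = Y := by
  refine LG.ext fun n => ?_
  rcases lt_or_ge n 0 with hn | hn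
  · rw [hX n hn, hY n hn]
  · lift n to ℕ using hn
    exact h n

lemma Integral.mk_smul {X : LG 𝔤} (hX : Integral X) (s : ℕ → ℂ) : Integral (LSer.mk s • X) := by
  refine integral_induction (p := fun X => Integral (LSer.mk s • X)) (by simpa using integral_zero)
    (fun x y hx hy => by rw [smul_add]; exact hx.add hy) (fun s' v n hn => ?_) hX
  rw [TensorProduct.smul_tmul', lcoeff_tmul, smul_eq_mul, coeff_mk_mul_mk_neg _ _ hn, zero_smul]

lemma lcoeff_zero_mk_smul {X : LG 𝔤} (hX : Integral X) (s : ℕ → ℂ) :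
    lcoeff 0 (LSer.mk s • X) = s 0 • lcoeff 0 X := by
  refine integral_induction (p := fun X => lcoeff 0 (LSer.mk s • X) = s 0 • lcoeff 0 X) (by simp)
    (fun x y hx hy => by rw [smul_add, map_add, map_add, hx, hy, smul_add]) (fun s' v => ?_) hX
  have h := coeff_mk_mul_mk s s' 0
  have h' := coeff_mk s' 0
  rw [Finset.Nat.antidiagonal_zero, Finset.sum_singleton] at h
  rw [Nat.cast_zero] at h h'
  rw [TensorProduct.smul_tmul', lcoeff_tmul, lcoeff_tmul, smul_eq_mul, h, h', mul_smul]

omit [FiniteDimensional ℂ 𝔤] in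
lemma eq_zero_of_natCast_smul_add {x y : 𝔤} (hx : IsNilpotent (LieAlgebra.ad ℂ 𝔤 x)) {m : ℕ}
    (hm : m ≠ 0) (h : (m : ℂ) • y + ⁅x, y⁆ = 0) : y = 0 := by
  have hu : IsUnit ((m : Module.End ℂ 𝔤) + LieAlgebra.ad ℂ 𝔤 x) := isUnit_natCast_add (k := ℂ) hx hm
  have hinj := ((Module.End.isUnit_iff _).mp hu).1
  refine hinj ?_
  rw [map_zero, LinearMap.add_apply, Module.End.natCast_apply, LieAlgebra.ad_apply,
    ← Nat.cast_smul_eq_nsmul ℂ, h]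

variable {C : LG 𝔤}

lemma lcoeff_tpow_cov (hC : ∀ n < -1, lcoeff n C = 0) {Y : LG 𝔤} (hY : Integral Y) :
    Integral (tpow 1 • cov C Y) ∧ ∀ n : ℕ, lcoeff n (tpow 1 • cov C Y) = (n : ℂ) • lcoeff n Y +
      ∑ ij ∈ Finset.HasAntidiagonal.antidiagonal n, ⁅lcoeff (ij.1 - 1) C, lcoeff ij.2 Y⁆ := by
  have hC' : Integral (tpow 1 • C) := fun n hn => by rw [lcoeff_tpow_smul]; exact hC _ (by omega)
  have h : tpow 1 • cov C Y = tpow 1 • lder Y + ⁅tpow 1 • C, Y⁆ := by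
    rw [cov, smul_add, smul_lie]
  have h1 (n : ℤ) : lcoeff n (tpow 1 • lder Y) = (n : ℂ) • lcoeff n Y := by
    rw [lcoeff_tpow_smul, lcoeff_lder]
    simp
  rw [h]
  refine ⟨Integral.add (fun n hn => by rw [h1, hY n hn, smul_zero]) (hC'.lie hY), fun n => ?_⟩
  rw [map_add, h1, lcoeff_lie hC' hY]
  simp only [lcoeff_tpow_smul, Int.cast_natCast]

lemma eq_zero_of_cov_eq_zero (hC : ∀ n < -1, lcoeff n C = 0)
    (hx : IsNilpotent (LieAlgebra.ad ℂ 𝔤 (lcoeff (-1) C))) {Y : LG 𝔤} (hY : Integral Y)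
    (hY0 : lcoeff 0 Y = 0) (h : cov C Y = 0) : Y = 0 := by
  refine hY.ext integral_zero fun n => ?_
  rw [map_zero]
  induction n using Nat.strong_induction_on with
  | _ n ih =>
  rcases eq_or_ne n 0 with rfl | hn
  · exact hY0
  · refine eq_zero_of_natCast_smul_add hx hn ?_
    have h1 := (lcoeff_tpow_cov hC hY).2 n
    rw [h, smul_zero, map_zero, Finset.sum_eq_single (0, n)] at h1
    · simpa using h1.symm
    · rintro ⟨i, j⟩ hij hne
      rw [Finset.HasAntidiagonal.mem_antidiagonal] at hij
      rw [ih j, lie_zero]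
      dsimp only at hij
      rcases Nat.eq_zero_or_pos i with rfl | hi
      · exact absurd (by rw [← hij, zero_add]) hne
      · omega
    · simp

lemma exists_fundamental_solution (hC : ∀ n < -1, lcoeff n C = 0)
    (hx : IsNilpotent (LieAlgebra.ad ℂ 𝔤 (lcoeff (-1) C))) :
    ∃ σ : 𝔤 →ₗ[ℂ] LG 𝔤, (∀ v, Integral (σ v)) ∧ (∀ v, lcoeff 0 (σ v) = v) ∧
      (∀ v, tpow 1 • cov C (σ v) = σ ⁅lcoeff (-1) C, v⁆) ∧ ∀ v w, σ ⁅v, w⁆ = ⁅σ v, σ w⁆ := by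
  set X : Module.End ℂ 𝔤 := LieAlgebra.ad ℂ 𝔤 (lcoeff (-1) C) with hX
  have hsurj (m : ℕ) (hm : m ≠ 0) (r : Module.End ℂ 𝔤) :
      ∃ y : Module.End ℂ 𝔤, (m : ℂ) • y + (X * y - y * X) = r := by
    have hN : IsNilpotent (LinearMap.mulLeft ℂ X - LinearMap.mulRight ℂ X) := by
      refine (LinearMap.commute_mulLeft_right X X).isNilpotent_sub ?_ ?_
      · rwa [LinearMap.isNilpotent_mulLeft_iff]
      · rwa [LinearMap.isNilpotent_mulRight_iff]
    obtain ⟨y, hy⟩ := ((Module.End.isUnit_iff _).mp (isUnit_natCast_add (k := ℂ) hN hm)).2 r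
    refine ⟨y, ?_⟩
    rw [← hy, LinearMap.add_apply, Module.End.natCast_apply, ← Nat.cast_smul_eq_nsmul ℂ]
    rfl
  choose! R hR using hsurj
  set y : ℕ → Module.End ℂ 𝔤 := solveRec fun m p => if m = 0 then 1 else
    R m (-∑ j ∈ Finset.range m, LieAlgebra.ad ℂ 𝔤 (lcoeff (m - j - 1) C) * p j) with hy
  have hy0 : y 0 = 1 := by rw [hy, solveRec, if_pos rfl]
  have hym (m : ℕ) (hm : m ≠ 0) : (m : ℂ) • y m + (X * y m - y m * X) =
      -∑ j ∈ Finset.range m, LieAlgebra.ad ℂ 𝔤 (lcoeff (m - j - 1) C) * y j := by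
    conv_lhs => rw [hy, solveRec, if_neg hm, ← hy]
    rw [hR m hm, neg_inj]
    refine Finset.sum_congr rfl fun j hj => ?_
    dsimp only
    rw [dif_pos (Finset.mem_range.mp hj)]
  let σ : 𝔤 →ₗ[ℂ] LG 𝔤 :=
    { toFun := fun v => mkLoop fun m => y m v
      map_add' := fun v w => (integral_mkLoop _).ext ((integral_mkLoop _).add (integral_mkLoop _))
        fun n => by simp only [map_add, lcoeff_mkLoop]
      map_smul' := fun c v => (integral_mkLoop _).ext
        (fun n hn => by rw [RingHom.id_apply, map_smul, integral_mkLoop _ n hn, smul_zero])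
        fun n => by simp only [map_smul, lcoeff_mkLoop, RingHom.id_apply] }
  have hσ1 (v : 𝔤) : Integral (σ v) := integral_mkLoop _
  have hσ2 (n : ℕ) (v : 𝔤) : lcoeff n (σ v) = y n v := lcoeff_mkLoop _ n
  have hσ0 (v : 𝔤) : lcoeff 0 (σ v) = v := (hσ2 0 v).trans (by rw [hy0]; rfl)
  have hσ3 (v : 𝔤) : tpow 1 • cov C (σ v) = σ ⁅lcoeff (-1) C, v⁆ := by
    obtain ⟨h1, h2⟩ := lcoeff_tpow_cov hC (hσ1 v)
    refine h1.ext (hσ1 _) fun n => ?_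
    rw [h2, hσ2, hσ2, ← Finset.Nat.sum_antidiagonal_swap,
      Finset.Nat.sum_antidiagonal_eq_sum_range_succ_mk, Finset.sum_range_succ]
    simp only [Prod.fst_swap, Prod.snd_swap, hσ2, Nat.sub_self, Nat.cast_zero, zero_sub]
    rcases eq_or_ne n 0 with rfl | hn
    · simp [hy0]
    have h3 := LinearMap.congr_fun (hym n hn) v
    simp only [LinearMap.add_apply, LinearMap.sub_apply, LinearMap.smul_apply, LinearMap.neg_apply,
      LinearMap.sum_apply, Module.End.mul_apply, hX, LieAlgebra.ad_apply] at h3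
    rw [← add_eq_zero_iff_eq_neg] at h3
    rw [← sub_eq_zero, ← h3]
    have h4 : ∀ k ∈ Finset.range n, ⁅lcoeff ((n - k : ℕ) - 1 : ℤ) C, y k v⁆ =
        ⁅lcoeff (n - k - 1 : ℤ) C, y k v⁆ := fun k hk => by
      rw [Nat.cast_sub (Finset.mem_range.mp hk).le]
    rw [Finset.sum_congr rfl h4]
    abel
  refine ⟨σ, hσ1, hσ0, hσ3, ?_⟩
  have hcov (v : 𝔤) : cov C (σ v) = tpow (-1) • σ ⁅lcoeff (-1) C, v⁆ := by
    rw [← hσ3, tpow_smul_tpow_smul, neg_add_cancel, tpow_zero, one_smul]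
  obtain ⟨N, hN⟩ := hx
  have key (n : ℕ) : ∀ i j, i + j = n → ∀ v w, (X ^ i) v = 0 → (X ^ j) w = 0 →
      σ ⁅v, w⁆ - ⁅σ v, σ w⁆ = 0 := by
    induction n with
    | zero =>
      intro i j hij v w hv hw
      obtain rfl : i = 0 := by omega
      rw [pow_zero, Module.End.one_apply] at hv
      simp [hv]
    | succ n ih =>
      intro i j hij v w hv hw
      rcases Nat.eq_zero_or_pos i with rfl | hi
      · rw [pow_zero, Module.End.one_apply] at hv
        simp [hv]
      rcases Nat.eq_zero_or_pos j with rfl | hj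
      · rw [pow_zero, Module.End.one_apply] at hw
        simp [hw]
      obtain ⟨i, rfl⟩ := Nat.exists_eq_add_of_le' hi
      obtain ⟨j, rfl⟩ := Nat.exists_eq_add_of_le' hj
      refine eq_zero_of_cov_eq_zero hC ⟨N, hN⟩ ((hσ1 _).sub ((hσ1 v).lie (hσ1 w))) ?_ ?_
      · rw [map_sub, lcoeff_zero_lie (hσ1 v) (hσ1 w), hσ0, hσ0, hσ0, sub_self]
      · rw [pow_succ, Module.End.mul_apply] at hv hw
        have h1 := ih i (j + 1) (by omega) (X v) w hv (by rw [pow_succ, Module.End.mul_apply, hw])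
        have h2 := ih (i + 1) j (by omega) v (X w) (by rw [pow_succ, Module.End.mul_apply, hv]) hw
        rw [hX, LieAlgebra.ad_apply] at h1 h2
        rw [cov_sub, cov_lie, hcov, hcov, hcov, smul_lie, lie_smul, ← smul_add, ← smul_sub,
          leibniz_lie, map_add]
        rw [sub_eq_zero] at h1 h2
        rw [h1, h2, sub_self, smul_zero]
  intro v w
  rw [← sub_eq_zero]
  exact key (N + N) N N rfl v w (by rw [hN]; rfl) (by rw [hN]; rfl)

/-- Reduction of a connection with simple pole and nilpotent residue to its residue. -/
lemma exists_logForm (hC : ∀ n < -1, lcoeff n C = 0)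
    (hx : IsNilpotent (LieAlgebra.ad ℂ 𝔤 (lcoeff (-1) C))) :
    ∃ Φ : LG 𝔤 ≃ₗ⁅LSer⁆ LG 𝔤,
      (∀ Y, Φ (cov (tpow (-1) ⊗ₜ[ℂ] lcoeff (-1) C) Y) = cov C (Φ Y)) ∧
      ∀ W : Submodule LSer (LG 𝔤), lim (W.map (Φ : LG 𝔤 →ₗ[LSer] LG 𝔤)) = lim W := by
  obtain ⟨σ, h1, h2, h3, h4⟩ := exists_fundamental_solution hC hx
  let φ : LG 𝔤 →ₗ[LSer] LG 𝔤 := σ.liftBaseChange LSer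
  have hφ (s : LSer) (v : 𝔤) : φ (s ⊗ₜ[ℂ] v) = s • σ v := LinearMap.liftBaseChange_tmul ..
  have hlie (X Y : LG 𝔤) : φ ⁅X, Y⁆ = ⁅φ X, φ Y⁆ := by
    induction X using TensorProduct.induction_on with
    | zero => simp
    | add x x' hx hx' => simp only [map_add, add_lie, hx, hx']
    | tmul s x =>
      induction Y using TensorProduct.induction_on with
      | zero => simp
      | add y y' hy hy' => simp only [map_add, lie_add, hy, hy']
      | tmul u y =>
        rw [LieAlgebra.ExtendScalars.bracket_tmul, hφ, hφ, hφ, h4, smul_lie, lie_smul, smul_smul]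
  have hint {Y : LG 𝔤} (hY : Integral Y) : Integral (φ Y) ∧ lcoeff 0 (φ Y) = lcoeff 0 Y := by
    refine integral_induction (p := fun Y => Integral (φ Y) ∧ lcoeff 0 (φ Y) = lcoeff 0 Y)
      (by simpa using integral_zero) (fun x y hx hy => ?_) (fun s v => ?_) hY
    · simp only [map_add]
      exact ⟨hx.1.add hy.1, by rw [hx.2, hy.2]⟩
    · rw [hφ]
      refine ⟨(h1 v).mk_smul s, ?_⟩
      rw [lcoeff_zero_mk_smul (h1 v), h2, lcoeff_tmul]
      congr 1
      exact (coeff_mk s 0).symm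
  have hinj : Function.Injective φ := by
    rw [injective_iff_map_eq_zero]
    intro X hX
    by_contra hne
    obtain ⟨m, hm, hm'⟩ := exists_leading_coeff hne
    rw [← (hint hm).2, map_smul, hX, smul_zero, map_zero] at hm'
    exact hm' rfl
  have hbij : Function.Bijective φ := ⟨hinj, LinearMap.surjective_of_injective hinj⟩
  have hint' {Y : LG 𝔤} (hY : Integral (φ Y)) : Integral Y := by
    rcases eq_or_ne Y 0 with rfl | hne
    · exact integral_zero
    obtain ⟨m, hm, hm'⟩ := exists_leading_coeff hne
    rcases le_or_gt m 0 with h | h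
    · have := integral_tpow_smul hm (n := -m) (by omega)
      rwa [tpow_smul_tpow_smul, neg_add_cancel, tpow_zero, one_smul] at this
    · rw [← (hint hm).2, map_smul, lcoeff_tpow_smul, hY _ (by omega)] at hm'
      exact absurd rfl hm'
  let φ' : LG 𝔤 →ₗ⁅LSer⁆ LG 𝔤 := { φ with map_lie' := hlie _ _ }
  let Φ : LG 𝔤 ≃ₗ⁅LSer⁆ LG 𝔤 := LieEquiv.ofBijective φ' hbij
  have hΦ (Y : LG 𝔤) : Φ Y = φ Y := rfl
  refine ⟨Φ, fun Y => ?_, fun W => ?_⟩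
  · rw [hΦ, hΦ]
    induction Y using TensorProduct.induction_on with
    | zero => simp [cov]
    | add x y hx hy => rw [cov_add, map_add, map_add, hx, hy, cov_add]
    | tmul s v =>
      have hcov : cov C (σ v) = tpow (-1) • σ ⁅lcoeff (-1) C, v⁆ := by
        rw [← h3, tpow_smul_tpow_smul, neg_add_cancel, tpow_zero, one_smul]
      rw [hφ, cov_smul, hcov, cov, lder_tmul, LieAlgebra.ExtendScalars.bracket_tmul, map_add, hφ,
        hφ, smul_smul, mul_comm]
  · apply le_antisymm
    · rintro - ⟨-, ⟨w, hw, rfl⟩, hw', rfl⟩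
      exact ⟨w, hw, hint' hw', (hint (hint' hw')).2.symm⟩
    · rintro - ⟨w, hw, hw', rfl⟩
      exact ⟨_, ⟨w, hw, rfl⟩, (hint hw').1, (hint hw').2⟩

lemma exists_bound (φ : LG 𝔤 →ₗ[LSer] LSer) :
    ∃ B : ℤ, ∀ Y, Integral Y → ∀ n < B, coeff n (φ Y) = 0 := by
  choose N hN using fun j => exists_coeff_eq_zero (φ (1 ⊗ₜ[ℂ] Module.finBasis ℂ 𝔤 j))
  obtain ⟨B, hB⟩ := (Set.finite_range N).bddBelow
  refine ⟨B, fun Y hY n hn => ?_⟩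
  have hY' : Y = mkLoop fun n => lcoeff n Y :=
    hY.ext (integral_mkLoop _) fun n => (lcoeff_mkLoop (fun n => lcoeff n Y) n).symm
  rw [hY', mkLoop, map_sum, map_sum]
  refine Finset.sum_eq_zero fun j _ => ?_
  have hs (s : LSer) : φ (s ⊗ₜ[ℂ] Module.finBasis ℂ 𝔤 j) =
      s * φ (1 ⊗ₜ[ℂ] Module.finBasis ℂ 𝔤 j) := by
    rw [← smul_eq_mul, ← map_smul, TensorProduct.smul_tmul', smul_eq_mul, mul_one]
  have hq : tpow (-N j) * φ (1 ⊗ₜ[ℂ] Module.finBasis ℂ 𝔤 j) = LSer.mk _ :=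
    eq_mk fun m hm => by rw [coeff_tpow_mul]; exact hN j _ (by omega)
  obtain ⟨p, hp⟩ : ∃ p, φ (1 ⊗ₜ[ℂ] Module.finBasis ℂ 𝔤 j) = tpow (N j) * LSer.mk p :=
    ⟨_, by rw [← hq, ← mul_assoc, tpow_mul, add_neg_cancel, tpow_zero, one_mul]⟩
  rw [hs, hp, mul_left_comm, coeff_tpow_mul, coeff_mk_mul_mk_neg]
  have := hB ⟨j, rfl⟩
  omega

/-- A subspace is closed in the `t`-adic topology. -/
lemma mem_of_forall_integral {W : Submodule LSer (LG 𝔤)} {X : LG 𝔤}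
    (h : ∀ M : ℕ, ∃ w ∈ W, Integral (tpow (-M) • (X - w))) : X ∈ W := by
  by_contra hX
  obtain ⟨φ, hφ, hφ'⟩ := Submodule.exists_le_ker_of_notMem hX
  obtain ⟨B, hB⟩ := exists_bound φ
  refine hφ (LSer.ext fun n => ?_)
  rw [map_zero]
  obtain ⟨w, hw, hw'⟩ := h (n - B + 1).toNat
  have h1 := hB _ hw' (n - (n - B + 1).toNat) (by omega)
  rw [map_smul, smul_eq_mul, coeff_tpow_mul, map_sub, show φ w = 0 from hφ' hw, sub_zero] at h1
  simpa using h1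

/-- A subspace that is horizontal for `∂_t + t⁻¹ x`, with `x` nilpotent, is constant. -/
lemma eq_lsub_lim {x : 𝔤} (hx : IsNilpotent (LieAlgebra.ad ℂ 𝔤 x))
    {W : Submodule LSer (LG 𝔤)} (hW : ∀ Y ∈ W, cov (tpow (-1) ⊗ₜ[ℂ] x) Y ∈ W) :
    W = lsub (lim W) ∧ ∀ v ∈ lim W, ⁅x, v⁆ ∈ lim W := by
  set T : LG 𝔤 → LG 𝔤 := fun Y => tpow 1 • cov (tpow (-1) ⊗ₜ[ℂ] x) Y with hT
  have hTW {Y : LG 𝔤} (hY : Y ∈ W) : T Y ∈ W := W.smul_mem _ (hW Y hY)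
  have hTc (n : ℤ) (Y : LG 𝔤) : lcoeff n (T Y) = (n : ℂ) • lcoeff n Y + ⁅x, lcoeff n Y⁆ := by
    have h : tpow (-1) ⊗ₜ[ℂ] x = tpow (-1) • ((1 : LSer) ⊗ₜ[ℂ] x : LG 𝔤) := by
      rw [TensorProduct.smul_tmul', smul_eq_mul, mul_one]
    rw [hT]
    dsimp only
    rw [cov, smul_add, map_add, lcoeff_tpow_smul, lcoeff_lder, h, smul_lie, tpow_smul_tpow_smul,
      add_neg_cancel, tpow_zero, one_smul, lcoeff_one_tmul_lie]
    simp
  have hTN (k : ℕ) (n : ℤ) (Y : LG 𝔤) : lcoeff n (T^[k] Y) =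
      (((n : ℂ) • (1 : Module.End ℂ 𝔤) + LieAlgebra.ad ℂ 𝔤 x) ^ k) (lcoeff n Y) := by
    induction k with
    | zero => rfl
    | succ k ih =>
      rw [Function.iterate_succ_apply', hTc, ih, pow_succ', Module.End.mul_apply,
        LinearMap.add_apply, LinearMap.smul_apply, Module.End.one_apply, LieAlgebra.ad_apply]
  have hTWk (k : ℕ) {Y : LG 𝔤} (hY : Y ∈ W) : T^[k] Y ∈ W := by
    induction k with
    | zero => exact hY
    | succ k ih => rw [Function.iterate_succ_apply']; exact hTW ih
  have hxV : ∀ v ∈ lim W, ⁅x, v⁆ ∈ lim W := by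
    rintro - ⟨w, hw, hw', rfl⟩
    refine ⟨T w, hTW hw, fun n hn => ?_, ?_⟩
    · rw [hTc, hw' n hn, lie_zero, smul_zero, add_zero]
    · rw [hTc, Int.cast_zero, zero_smul, zero_add]
  refine ⟨?_, hxV⟩
  obtain ⟨N, hN⟩ := hx
  have hV (m : ℕ) (hm : m ≠ 0) (u : 𝔤)
      (hu : (((m : ℂ) • (1 : Module.End ℂ 𝔤) + LieAlgebra.ad ℂ 𝔤 x) ^ N) u ∈ lim W) :
      u ∈ lim W := by
    set P := ((m : ℂ) • (1 : Module.End ℂ 𝔤) + LieAlgebra.ad ℂ 𝔤 x) ^ N with hP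
    have hPV : ∀ v ∈ lim W, P v ∈ lim W := by
      rw [hP]
      intro v hv
      clear hu hP
      clear P
      clear hN
      induction N with
      | zero => exact hv
      | succ k ih =>
        rw [pow_succ', Module.End.mul_apply, LinearMap.add_apply, LinearMap.smul_apply]
        exact add_mem (Submodule.smul_mem _ _ ih) (hxV _ ih)
    have hunit : IsUnit P := by
      have h : (m : ℂ) • (1 : Module.End ℂ 𝔤) = (m : Module.End ℂ 𝔤) := by
        rw [Nat.cast_smul_eq_nsmul, nsmul_one]
      rw [hP, h]
      exact (isUnit_natCast_add (k := ℂ) ⟨N, hN⟩ hm).pow N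
    have hinj := ((Module.End.isUnit_iff _).mp hunit).1
    have hsurj : Function.Surjective (P.restrict hPV) :=
      LinearMap.surjective_of_injective fun a b h => Subtype.ext (hinj (congrArg Subtype.val h))
    obtain ⟨v, hv⟩ := hsurj ⟨_, hu⟩
    rw [← hinj (congrArg Subtype.val hv)]
    exact v.2
  have key (M : ℕ) : ∀ v ∈ lim W, ∃ w ∈ W, Integral w ∧ lcoeff 0 w = v ∧
      ∀ i : ℤ, 0 < i → i < M + 1 → lcoeff i w = 0 := by
    induction M with
    | zero =>
      rintro - ⟨w, hw, hw', rfl⟩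
      exact ⟨w, hw, hw', rfl, fun i _ _ => by omega⟩
    | succ M ih =>
      intro v hv
      obtain ⟨w, hw, hw', hw0, hwi⟩ := ih v hv
      have hmem : lcoeff (M + 1 : ℕ) w ∈ lim W := by
        refine hV (M + 1) M.succ_ne_zero _ ?_
        refine ⟨tpow (-(M + 1 : ℕ)) • T^[N] w, W.smul_mem _ (hTWk N hw), fun n hn => ?_, ?_⟩
        · rw [lcoeff_tpow_smul, sub_neg_eq_add, hTN]
          rcases lt_trichotomy (n + (M + 1 : ℕ)) 0 with h | h | h
          · rw [hw' _ h, map_zero]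
          · rw [h, Int.cast_zero, zero_smul, zero_add, hN, LinearMap.zero_apply]
          · rw [hwi _ h (by push_cast at *; omega), map_zero]
        · rw [lcoeff_tpow_smul, sub_neg_eq_add, zero_add, hTN]
          rfl
      obtain ⟨u, hu, hu', hu0⟩ := hmem
      refine ⟨w - tpow (M + 1 : ℕ) • u, sub_mem hw (W.smul_mem _ hu),
        hw'.sub (integral_tpow_smul hu' (by omega)), ?_, fun i hi hi' => ?_⟩
      · rw [map_sub, lcoeff_tpow_smul, hu' _ (by omega), sub_zero, hw0]
      · rw [map_sub, lcoeff_tpow_smul]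
        rcases eq_or_ne i (M + 1 : ℕ) with rfl | hne
        · rw [sub_self, hu0, sub_self]
        · rw [hwi i hi (by push_cast at *; omega), hu' _ (by push_cast at *; omega), sub_self]
  have hle : lsub (lim W) ≤ W := by
    intro X hX
    refine lsub_induction (p := fun X => X ∈ W) (zero_mem _) (fun _ _ => add_mem)
      (fun s v hv => ?_) hX
    have h1 : (1 : LSer) ⊗ₜ[ℂ] v ∈ W := by
      refine mem_of_forall_integral fun M => ?_
      obtain ⟨w, hw, hw', hw0, hwi⟩ := key M v hv
      refine ⟨w, hw, fun n hn => ?_⟩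
      rw [lcoeff_tpow_smul, map_sub, lcoeff_tmul, coeff_one]
      split_ifs with h
      · rw [h, hw0, one_smul, sub_self]
      · rw [zero_smul, zero_sub, neg_eq_zero]
        rcases lt_or_gt_of_ne h with h' | h'
        · exact hw' _ h'
        · exact hwi _ h' (by omega)
    have h2 : s ⊗ₜ[ℂ] v = s • ((1 : LSer) ⊗ₜ[ℂ] v : LG 𝔤) := by
      rw [TensorProduct.smul_tmul', smul_eq_mul, mul_one]
    rw [h2]
    exact W.smul_mem _ h1
  refine (Submodule.eq_of_le_of_finrank_le hle ?_).symm
  rw [finrank_lsub]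
  exact finrank_le_finrank_lim W

end NilpotentResidue

/-! ### The unipotent group of a graded Lie algebra -/

section Unipotent

variable {K L : Type*} [Field K] [LieRing L] [LieAlgebra K L]

/-- A grading element and a compatible `sl₂`-triple. -/
structure IsPrincipal (G : Grading ℤ K L) (ρ e f : L) : Prop where
  isLie : G.IsLie
  lie_rho : ∀ c x, ⁅ρ, G.proj c x⁆ = (c : K) • G.proj c x
  sl2 : IsSl2Triple (2 • ρ) e f
  proj_f : G.proj (-1) f = f

/-- The group generated by the exponentials of the elements of positive degree. -/
def unip (G : Grading ℤ K L) : Subgroup (L ≃ₗ[K] L) :=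
  Subgroup.closure {g | ∃ X ∈ G.fil 1, ∀ n, LieAlgebra.ad K L X ^ n = 0 → ∀ x,
    g x = ∑ i ∈ Finset.range n, (i.factorial : K)⁻¹ • (LieAlgebra.ad K L X ^ i) x}

namespace Grading

variable (G : Grading ℤ K L)

lemma fil_anti {c d : ℤ} (h : c ≤ d) : G.fil d ≤ G.fil c := fun _ hx =>
  G.mem_fil.mpr fun a ha => G.mem_fil.mp hx a (ha.trans_le h)

lemma exists_fil_eq_top : ∃ c, G.fil c = ⊤ := by
  obtain ⟨m, hm⟩ := G.supp.bddBelow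
  exact ⟨m, eq_top_iff.mpr fun x _ => G.mem_fil.mpr fun d hd =>
    G.proj_eq_zero (fun h => absurd (hm h) (not_le.mpr hd)) x⟩

lemma exists_fil_eq_bot : ∃ c, G.fil c = ⊥ := by
  obtain ⟨m, hm⟩ := G.supp.bddAbove
  refine ⟨m + 1, (Submodule.eq_bot_iff _).mpr fun x hx => G.ext_proj fun d => ?_⟩
  rw [map_zero]
  rcases lt_or_ge d (m + 1) with h | h
  · exact G.mem_fil.mp hx d h
  · exact G.proj_eq_zero (fun h' => by have := hm h'; omega) x

lemma sub_proj_mem_fil {c : ℤ} {x : L} (hx : x ∈ G.fil c) : x - G.proj c x ∈ G.fil (c + 1) := by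
  refine G.mem_fil.mpr fun d hd => ?_
  rw [map_sub]
  rcases eq_or_ne d c with rfl | h
  · rw [G.proj_proj_self, sub_self]
  · rw [G.proj_proj_ne _ _ h, G.mem_fil.mp hx d (by omega), sub_zero]

lemma mem_fil_of_proj_eq_zero {c : ℤ} {x : L} (hx : x ∈ G.fil c) (h : G.proj c x = 0) :
    x ∈ G.fil (c + 1) := by
  have := G.sub_proj_mem_fil hx
  rwa [h, sub_zero] at this

lemma proj_mem_fil (c : ℤ) (x : L) : G.proj c x ∈ G.fil c :=
  G.mem_fil.mpr fun _ hd => G.proj_proj_ne _ _ hd.ne _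

variable {G}

lemma IsLie.ad_pow_mem_fil (hG : G.IsLie) {a c : ℤ} {X x : L} (hX : X ∈ G.fil a)
    (hx : x ∈ G.fil c) (n : ℕ) : (LieAlgebra.ad K L X ^ n) x ∈ G.fil (c + n * a) := by
  induction n with
  | zero => simpa using hx
  | succ n ih =>
    rw [pow_succ', Module.End.mul_apply, LieAlgebra.ad_apply]
    have := hG.lie_mem_fil hX ih
    convert this using 2
    push_cast
    ring

lemma IsLie.isNilpotent_ad (hG : G.IsLie) {X : L} (hX : X ∈ G.fil 1) :
    IsNilpotent (LieAlgebra.ad K L X) := by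
  obtain ⟨a, ha⟩ := G.exists_fil_eq_top
  obtain ⟨c, hc⟩ := G.exists_fil_eq_bot
  refine ⟨(c - a).toNat, LinearMap.ext fun x => ?_⟩
  have hx : x ∈ G.fil a := ha ▸ Submodule.mem_top
  have := G.fil_anti (show c ≤ a + (c - a).toNat * 1 by omega) (hG.ad_pow_mem_fil hX hx _)
  rw [hc] at this
  exact (Submodule.mem_bot K).mp this

end Grading

/-- The exponential of a nilpotent inner derivation. -/
lemma exists_exp_ad [CharZero K] {X : L} (hX : IsNilpotent (LieAlgebra.ad K L X)) :
    ∃ E : L ≃ₗ⁅K⁆ L, ∀ n, LieAlgebra.ad K L X ^ n = 0 → ∀ x,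
      E x = ∑ i ∈ Finset.range n, (i.factorial : K)⁻¹ • (LieAlgebra.ad K L X ^ i) x := by
  have h : (LieDerivation.ad K L X).toLinearMap = LieAlgebra.ad K L X :=
    LieDerivation.coe_ad_apply_eq_ad_apply X
  have := exists_exp (LieDerivation.ad K L X) (h ▸ hX)
  rwa [h] at this

variable [CharZero K] {G : Grading ℤ K L}

lemma exists_mem_unip (hG : G.IsLie) {X : L} (hX : X ∈ G.fil 1) :
    ∃ g ∈ unip G, ∀ n, LieAlgebra.ad K L X ^ n = 0 → ∀ x,
      g x = ∑ i ∈ Finset.range n, (i.factorial : K)⁻¹ • (LieAlgebra.ad K L X ^ i) x := by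
  obtain ⟨E, hE⟩ := exists_exp_ad (hG.isNilpotent_ad hX)
  exact ⟨E.toLinearEquiv, Subgroup.subset_closure ⟨X, hX, hE⟩, hE⟩

variable [FiniteDimensional K L]

lemma unip_induction (hG : G.IsLie) {g : L ≃ₗ[K] L} (hg : g ∈ unip G) :
    (∀ x y, g ⁅x, y⁆ = ⁅g x, g y⁆) ∧ ∀ c, ∀ x ∈ G.fil c, g x - x ∈ G.fil (c + 1) := by
  induction hg using Subgroup.closure_induction with
  | mem g hg =>
    obtain ⟨X, hX, hg⟩ := hg
    have hnil := hG.isNilpotent_ad hX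
    obtain ⟨E, hE⟩ := exists_exp_ad hnil
    obtain ⟨n, hn⟩ := hnil
    have hgE (x : L) : g x = E x := (hg n hn x).trans (hE n hn x).symm
    refine ⟨fun x y => by rw [hgE, hgE, hgE, LieEquiv.map_lie], fun c x hx => ?_⟩
    rw [hg (n + 1) (by rw [pow_succ, hn, zero_mul]), Finset.sum_range_succ']
    simp only [pow_zero, Nat.factorial_zero, Nat.cast_one, inv_one, one_smul, Module.End.one_apply,
      add_sub_cancel_right]
    refine sum_mem fun i _ => Submodule.smul_mem _ _ ?_
    exact G.fil_anti (by push_cast; omega) (hG.ad_pow_mem_fil hX hx (i + 1))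
  | one => exact ⟨fun _ _ => rfl, fun c x _ => by simp⟩
  | mul g h _ _ hg hh =>
    refine ⟨fun x y => ?_, fun c x hx => ?_⟩
    · rw [LinearEquiv.mul_apply, hh.1, hg.1]; rfl
    · have h1 := hh.2 c x hx
      have h2 : h x ∈ G.fil c := by
        rw [← sub_add_cancel (h x) x]; exact add_mem (G.fil_anti (by omega) h1) hx
      rw [LinearEquiv.mul_apply, ← sub_add_sub_cancel _ (h x)]
      exact add_mem (hg.2 c _ h2) h1
  | inv g _ hg =>
    have hinv (x : L) : g (g⁻¹ x) = x := g.apply_symm_apply x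
    refine ⟨fun x y => g.injective ?_, fun c x hx => ?_⟩
    · rw [hg.1, hinv, hinv, hinv]
    · have hmap : ∀ y ∈ G.fil c, (g : L →ₗ[K] L) y ∈ G.fil c := fun y hy => by
        change g y ∈ _
        rw [← sub_add_cancel (g y) y]; exact add_mem (G.fil_anti (by omega) (hg.2 c y hy)) hy
      have hsurj : Function.Surjective ((g : L →ₗ[K] L).restrict hmap) :=
        LinearMap.surjective_of_injective fun a b h =>
          Subtype.ext (g.injective (congrArg Subtype.val h))
      obtain ⟨y, hy⟩ := hsurj ⟨x, hx⟩
      have hy' : g y = x := congrArg Subtype.val hy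
      have h1 : g⁻¹ x = y := by rw [← hy']; exact g.symm_apply_apply _
      have h2 := hg.2 c y y.2
      rw [hy'] at h2
      rw [h1, ← neg_sub]
      exact neg_mem h2

lemma unip_map_lie (hG : G.IsLie) {g : L ≃ₗ[K] L} (hg : g ∈ unip G) (x y : L) :
    g ⁅x, y⁆ = ⁅g x, g y⁆ := (unip_induction hG hg).1 x y

lemma unip_sub_mem (hG : G.IsLie) {g : L ≃ₗ[K] L} (hg : g ∈ unip G) {c : ℤ} {x : L}
    (hx : x ∈ G.fil c) : g x - x ∈ G.fil (c + 1) := (unip_induction hG hg).2 c x hx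

lemma unip_mem_fil (hG : G.IsLie) {g : L ≃ₗ[K] L} (hg : g ∈ unip G) {c : ℤ} {x : L}
    (hx : x ∈ G.fil c) : g x ∈ G.fil c := by
  rw [← sub_add_cancel (g x) x]
  exact add_mem (G.fil_anti (by omega) (unip_sub_mem hG hg hx)) hx

lemma unip_proj (hG : G.IsLie) {g : L ≃ₗ[K] L} (hg : g ∈ unip G) {c : ℤ} {x : L}
    (hx : x ∈ G.fil c) : G.proj c (g x) = G.proj c x := by
  rw [← sub_eq_zero, ← map_sub]
  exact G.mem_fil.mp (unip_sub_mem hG hg hx) c (by omega)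

lemma gr_map_le (hG : G.IsLie) {g : L ≃ₗ[K] L} (hg : g ∈ unip G) (W : Submodule K L) :
    G.gr (W.map (g : L →ₗ[K] L)) ≤ G.gr W := by
  intro x hx
  rw [Grading.mem_gr] at hx ⊢
  intro c
  obtain ⟨-, ⟨w, hw, rfl⟩, hc, h⟩ := hx c
  have hc' : w ∈ G.fil c := by
    have := unip_mem_fil hG (inv_mem hg) hc
    rwa [show g⁻¹ ((g : L →ₗ[K] L) w) = w from g.symm_apply_apply w] at this
  exact ⟨w, hw, hc', by rw [← h]; exact (unip_proj hG hg hc').symm⟩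

variable {ρ e f : L}

namespace IsPrincipal

omit [FiniteDimensional K L] in
lemma proj_rho (hP : IsPrincipal G ρ e f) : G.proj 0 ρ = ρ :=
  G.proj_eq_self fun d hd => G.proj_eq_zero_of_apply_eq (T := LieAlgebra.ad K L ρ)
    (a := fun c : ℤ => (c : K)) hP.lie_rho (μ := 0) (by simp) (Int.cast_ne_zero.mpr hd)

omit [FiniteDimensional K L] in
lemma rho_mem_fil (hP : IsPrincipal G ρ e f) : ρ ∈ G.fil 0 := by
  rw [← hP.proj_rho]; exact G.proj_mem_fil _ _

omit [CharZero K] [FiniteDimensional K L] in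
lemma proj_lie_rho (hP : IsPrincipal G ρ e f) (c : ℤ) (x : L) :
    G.proj c ⁅ρ, x⁆ = (c : K) • G.proj c x :=
  G.proj_apply_of_forall (T := LieAlgebra.ad K L ρ) (a := fun c : ℤ => (c : K)) hP.lie_rho c x

omit [FiniteDimensional K L] in
/-- All elements `ρ + y` with `y` of positive degree are conjugate. -/
lemma exists_unip_apply (hP : IsPrincipal G ρ e f) {y : L} (hy : y ∈ G.fil 1) :
    ∃ g ∈ unip G, g (ρ + y) = ρ := by
  obtain ⟨M, hM⟩ := G.exists_fil_eq_bot
  have key (k : ℕ) : ∀ j : ℤ, 1 ≤ j → M ≤ j + k → ∀ y ∈ G.fil j, ∃ g ∈ unip G, g (ρ + y) = ρ := by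
    induction k with
    | zero =>
      intro j _ hj y hy
      have := G.fil_anti (by simpa using hj) hy
      rw [hM, Submodule.mem_bot] at this
      exact ⟨1, one_mem _, by rw [this, add_zero]; rfl⟩
    | succ k ih =>
      intro j hj hjM y hy
      have hj0 : (j : K) ≠ 0 := Int.cast_ne_zero.mpr (by omega)
      set X := (j : K)⁻¹ • G.proj j y with hX
      have hXj : X ∈ G.fil j := Submodule.smul_mem _ _ (G.proj_mem_fil _ _)
      have hX1 : X ∈ G.fil 1 := G.fil_anti hj hXj
      obtain ⟨g, hg, hgx⟩ := exists_mem_unip hP.isLie hX1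
      obtain ⟨n, hn⟩ := hP.isLie.isNilpotent_ad hX1
      have hXρ : ⁅X, ρ⁆ = -G.proj j y := by
        rw [← lie_skew, hX, lie_smul, hP.lie_rho, smul_smul, inv_mul_cancel₀ hj0, one_smul]
      have hw : ρ + y ∈ G.fil 0 := add_mem hP.rho_mem_fil (G.fil_anti (by omega) hy)
      have hmem : g (ρ + y) - ρ ∈ G.fil (j + 1) := by
        have h1 := hgx (n + 1 + 1) (by rw [pow_succ, pow_succ, hn, zero_mul, zero_mul]) (ρ + y)
        rw [Finset.sum_range_succ', Finset.sum_range_succ'] at h1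
        have h2 : g (ρ + y) - ρ = (∑ i ∈ Finset.range n, ((i + 1 + 1).factorial : K)⁻¹ •
            (LieAlgebra.ad K L X ^ (i + 1 + 1)) (ρ + y)) + (⁅X, y⁆ + (y - G.proj j y)) := by
          rw [h1]
          simp [hXρ]
          abel
        rw [h2]
        refine add_mem (sum_mem fun i _ => Submodule.smul_mem _ _ ?_) (add_mem ?_ ?_)
        · refine G.fil_anti ?_ (hP.isLie.ad_pow_mem_fil hXj hw (i + 1 + 1))
          push_cast
          nlinarith [mul_nonneg (Int.natCast_nonneg i) (zero_le_one.trans hj)]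
        · exact G.fil_anti (by omega) (hP.isLie.lie_mem_fil hXj hy)
        · exact G.sub_proj_mem_fil hy
      obtain ⟨g', hg', h⟩ := ih (j + 1) (by omega) (by push_cast at *; omega) _ hmem
      refine ⟨g' * g, mul_mem hg' hg, ?_⟩
      rw [add_sub_cancel] at h
      exact h
  exact key (M - 1).toNat 1 le_rfl (by omega) y hy

/-- A unipotent element that stabilizes the opposite Borel subalgebra is trivial. -/
lemma eq_one_of_map_le (hP : IsPrincipal G ρ e f) {g : L ≃ₗ[K] L} (hg : g ∈ unip G)
    (h : ∀ x, (∀ c > 0, G.proj c x = 0) → ∀ c > 0, G.proj c (g x) = 0) : g = 1 := by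
  have hgρ : g ρ = ρ := by
    rw [← sub_eq_zero]
    have h1 := unip_sub_mem hP.isLie hg hP.rho_mem_fil
    have hρ : ∀ c > 0, G.proj c ρ = 0 := fun c hc => G.proj_of_eq hP.proj_rho hc.ne'
    refine G.ext_proj fun c => ?_
    rw [map_zero]
    rcases lt_or_ge c 1 with hc | hc
    · exact G.mem_fil.mp h1 c (by omega)
    · rw [map_sub, h ρ hρ c (by omega), hρ c (by omega), sub_zero]
  have hc (c : ℤ) (x : L) : g (G.proj c x) = G.proj c x := by
    have h1 : ⁅ρ, g (G.proj c x)⁆ = (c : K) • g (G.proj c x) := by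
      conv_lhs => rw [← hgρ]
      rw [← unip_map_lie hP.isLie hg, hP.lie_rho, map_smul]
    have h2 : G.proj c (g (G.proj c x)) = g (G.proj c x) := G.proj_eq_self fun d hd =>
      G.proj_eq_zero_of_apply_eq (T := LieAlgebra.ad K L ρ) (a := fun c : ℤ => (c : K)) hP.lie_rho
        h1 fun h => hd (Int.cast_injective h)
    rw [← h2, unip_proj hP.isLie hg (G.proj_mem_fil c x), G.proj_proj_self]
  refine LinearEquiv.ext fun x => ?_
  change g x = x
  conv_lhs => rw [← G.sum_proj x]
  rw [map_sum]
  simp only [hc]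
  exact G.sum_proj x

/-- The action of the unipotent group on connections is free. -/
lemma eq_one_of_commute (hP : IsPrincipal G ρ e f) {g : L ≃ₗ[K] L} (hg : g ∈ unip G) (d : L →+ L)
    (hd : ∀ c, ∀ x ∈ G.fil c, d x + ⁅f, x⁆ ∈ G.fil c) (h : ∀ x, g (d x) = d (g x)) : g = 1 := by
  set δ : Module.End K L := (g : L →ₗ[K] L) - 1 with hδ
  have hδx (x : L) : δ x = g x - x := rfl
  have hδd (x : L) : δ (d x) = d (δ x) := by rw [hδx, hδx, h, map_sub]
  have hf : f ∈ G.fil (-1) := by rw [← hP.proj_f]; exact G.proj_mem_fil _ _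
  have key (j : ℕ) : ∀ c, ∀ x ∈ G.fil c, δ x ∈ G.fil (c + (j + 1)) := by
    induction j with
    | zero => exact fun c x hx => by simpa [hδx] using unip_sub_mem hP.isLie hg hx
    | succ j ih =>
      set m : ℤ := (j : ℤ) + 1 with hm
      let δ' : Module.End K L := ∑ c ∈ G.supp, G.proj (c + m) ∘ₗ δ ∘ₗ G.proj c
      have hδ' (c : ℤ) (x : L) (hx : G.proj c x = x) : δ' x = G.proj (c + m) (δ x) := by
        simp only [δ', LinearMap.sum_apply, LinearMap.comp_apply]
        by_cases hc : c ∈ G.supp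
        · rw [Finset.sum_eq_single_of_mem c hc fun a _ ha => by
            rw [G.proj_of_eq hx ha, map_zero, map_zero], hx]
        · have hx0 : x = 0 := by rw [← hx, G.proj_eq_zero hc]
          simp [hx0]
      have hhom (c : ℤ) (x : L) (hx : G.proj c x = x) : ⁅f, δ' x⁆ = δ' ⁅f, x⁆ := by
        have hxc : x ∈ G.fil c := hx ▸ G.proj_mem_fil c x
        have hfx : G.proj (c - 1) ⁅f, x⁆ = ⁅f, x⁆ := by
          have := hP.isLie (-1) c f x
          rwa [hx, hP.proj_f, neg_add_eq_sub] at this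
        have h1 : G.proj (c - 1 + m) (d (δ x) + ⁅f, δ x⁆) = 0 :=
          G.mem_fil.mp (hd _ _ (ih c x hxc)) _ (by omega)
        have h2 : G.proj (c - 1 + m) (δ (d x + ⁅f, x⁆)) = 0 :=
          G.mem_fil.mp (ih c _ (hd c x hxc)) _ (by omega)
        have h3 : G.proj (c - 1 + m) ⁅f, δ x⁆ = ⁅f, G.proj (c + m) (δ x)⁆ := by
          have := hP.isLie.proj_lie_of_mem_fil hf (ih c x hxc)
          rw [hP.proj_f] at this
          convert this using 3
          ring
        rw [hδ' c x hx, hδ' _ _ hfx, ← h3]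
        rw [map_add, ← hδd] at h1
        rw [map_add, map_add] at h2
        exact add_left_cancel (h1.trans h2.symm)
      have hlief : ⁅f, δ'⁆ = 0 := by
        refine LinearMap.ext fun x => ?_
        rw [LieHom.lie_apply, LinearMap.zero_apply, sub_eq_zero, ← G.sum_proj x, map_sum, lie_sum,
          lie_sum, map_sum]
        exact Finset.sum_congr rfl fun c _ => hhom c _ (G.proj_proj_self c x)
      have hlieh : ⁅-(2 • ρ), δ'⁆ = (-(2 * m : ℤ) : K) • δ' := by
        refine LinearMap.ext fun x => ?_
        rw [LieHom.lie_apply, LinearMap.smul_apply, ← G.sum_proj x, map_sum, lie_sum, lie_sum,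
          map_sum, Finset.smul_sum, ← Finset.sum_sub_distrib]
        refine Finset.sum_congr rfl fun c _ => ?_
        have h1 := hP.lie_rho (c + m) (δ (G.proj c x))
        rw [neg_lie, neg_lie, nsmul_lie, nsmul_lie, hP.lie_rho, hδ' c _ (G.proj_proj_self c x), h1,
          map_neg, map_nsmul, map_smul, hδ' c _ (G.proj_proj_self c x), ← Nat.cast_smul_eq_nsmul K,
          ← Nat.cast_smul_eq_nsmul K, smul_smul, smul_smul, ← neg_smul, ← neg_smul, ← sub_smul]
        congr 1
        push_cast
        ring
      have hδ0 : δ' = 0 := by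
        by_contra hne
        have hprim : hP.sl2.symm.HasPrimitiveVectorWith δ' (-(2 * m : ℤ) : K) :=
          ⟨hne, hlieh, hlief⟩
        obtain ⟨n, hn⟩ := hprim.exists_nat
        have : -(2 * m) = (n : ℤ) := by exact_mod_cast hn
        omega
      intro c x hx
      have h1 : δ x ∈ G.fil (c + m) := ih c x hx
      have h2 : G.proj (c + m) (δ x) = 0 := by
        have h3 := hδ' c _ (G.proj_proj_self c x)
        rw [hδ0, LinearMap.zero_apply] at h3
        have h4 := G.mem_fil.mp (ih _ _ (G.sub_proj_mem_fil hx)) (c + m) (by omega)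
        rwa [map_sub, map_sub, ← h3, sub_zero] at h4
      have := G.mem_fil_of_proj_eq_zero h1 h2
      convert this using 2
      push_cast
      ring
  obtain ⟨a, ha⟩ := G.exists_fil_eq_top
  obtain ⟨c, hc⟩ := G.exists_fil_eq_bot
  refine LinearEquiv.ext fun x => ?_
  have h1 := G.fil_anti (show c ≤ a + ((c - a).toNat + 1) by omega)
    (key (c - a).toNat a x (ha ▸ Submodule.mem_top))
  rw [hc, Submodule.mem_bot, hδx, sub_eq_zero] at h1
  exact h1

end IsPrincipal

end Unipotent

/-! ### Base change of the principal grading -/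

section BaseChange

open LSer

variable {𝔤 : Type*} [LieRing 𝔤] [LieAlgebra ℂ 𝔤]

lemma one_tmul_lie (x y : 𝔤) : ⁅((1 : LSer) ⊗ₜ[ℂ] x : LG 𝔤), (1 : LSer) ⊗ₜ[ℂ] y⁆ =
    (1 : LSer) ⊗ₜ[ℂ] ⁅x, y⁆ := by
  rw [LieAlgebra.ExtendScalars.bracket_tmul, mul_one]

lemma PrincipalData.isPrincipal_baseChange {ι : Type*} [Fintype ι] {𝔥 : LieSubalgebra ℂ 𝔤}
    {b : LieAlgebra.Basis ι 𝔥} (D : PrincipalData b) :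
    IsPrincipal (D.G.baseChange LSer) ((1 : LSer) ⊗ₜ[ℂ] D.ρ) (1 ⊗ₜ[ℂ] D.e) (1 ⊗ₜ[ℂ] ∑ i, b.f i) where
  isLie := D.isLie.baseChange LSer
  lie_rho c X := by
    induction X using TensorProduct.induction_on with
    | zero => simp
    | add x y hx hy => rw [map_add, lie_add, hx, hy, smul_add]
    | tmul s v =>
      change ⁅_, s ⊗ₜ[ℂ] D.G.proj c v⁆ = _ • s ⊗ₜ[ℂ] D.G.proj c v
      rw [LieAlgebra.ExtendScalars.bracket_tmul, one_mul, D.lie_rho, TensorProduct.tmul_smul,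
        TensorProduct.smul_tmul', TensorProduct.smul_tmul', smul_eq_mul, Algebra.smul_def,
        map_intCast]
  sl2 := by
    have h2 : (2 • ((1 : LSer) ⊗ₜ[ℂ] D.ρ) : LG 𝔤) = 1 ⊗ₜ[ℂ] (2 • D.ρ) :=
      (TensorProduct.tmul_smul ..).symm
    refine ⟨?_, ?_, ?_, ?_⟩
    · rw [h2]
      intro h
      have := lcoeff_zero_one_tmul (2 • D.ρ)
      rw [h, map_zero] at this
      exact D.sl2.h_ne_zero this.symm
    · rw [h2, one_tmul_lie, D.sl2.lie_e_f]
    · rw [h2, one_tmul_lie, D.sl2.lie_h_e_nsmul, TensorProduct.tmul_smul]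
    · rw [h2, one_tmul_lie, D.sl2.lie_h_f_nsmul, TensorProduct.tmul_neg, TensorProduct.tmul_smul]
  proj_f := by
    change (1 : LSer) ⊗ₜ[ℂ] D.G.proj (-1) _ = _
    rw [D.proj_f]

variable [FiniteDimensional ℂ 𝔤]

/-- The loop algebra is semisimple. -/
lemma isKilling_loop [LieAlgebra.IsKilling ℂ 𝔤] : LieAlgebra.IsKilling LSer (LG 𝔤) where
  killingCompl_top_eq_bot := by
    refine (LieSubmodule.eq_bot_iff _).mpr fun X hX => LG.ext fun n => ?_
    have h (y : 𝔤) : killingForm LSer (LG 𝔤) X (1 ⊗ₜ[ℂ] y) = 0 :=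
      (LieModule.traceForm_comm ..).trans
        ((LieIdeal.mem_killingCompl LSer (LG 𝔤) ⊤).mp hX _ (LieSubmodule.mem_top _))
    have hn (y : 𝔤) : coeff n (killingForm LSer (LG 𝔤) X (1 ⊗ₜ[ℂ] y)) =
        killingForm ℂ 𝔤 (lcoeff n X) y := by
      rw [killingForm, LieModule.traceForm_baseChange]
      clear h hX
      induction X using TensorProduct.induction_on with
      | zero => simp
      | add x y hx hy => simp only [map_add, LinearMap.add_apply, hx, hy]
      | tmul s v =>
        rw [LinearMap.BilinForm.baseChange_tmul, mul_one, map_smul]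
        rw [lcoeff_tmul, map_smul, LinearMap.smul_apply, smul_eq_mul, smul_eq_mul, mul_comm]
    have hker : lcoeff n X ∈ LinearMap.ker (killingForm ℂ 𝔤) := by
      rw [LinearMap.mem_ker]
      refine LinearMap.ext fun y => ?_
      rw [← hn, h, map_zero, LinearMap.zero_apply]
    rw [LieAlgebra.IsKilling.ker_killingForm_eq_bot, Submodule.mem_bot] at hker
    rw [hker, map_zero]

end BaseChange

open LSer

/-! ### Horizontal Borel subalgebras -/

section Solvable

variable {k L : Type*} [Field k] [LieRing L] [LieAlgebra k L]

/-- Solvable subalgebras of given dimension. -/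
structure IsSolvOfDim (P : Submodule k L) (d : ℕ) : Prop where
  solv : Solv P
  closed : brk P P ≤ P
  finrank_eq : Module.finrank k P = d

lemma IsSolvOfDim.map {P : Submodule k L} {d : ℕ} (hP : IsSolvOfDim P d) (g : L ≃ₗ[k] L)
    (hg : ∀ x y, g ⁅x, y⁆ = ⁅g x, g y⁆) : IsSolvOfDim (P.map g.toLinearMap) d where
  solv := hP.solv.map ({ g.toLinearMap with map_lie' := hg _ _ } : L →ₗ⁅k⁆ L)
  closed := by
    rw [brk_le]
    rintro - ⟨x, hx, rfl⟩ - ⟨y, hy, rfl⟩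
    exact ⟨⁅x, y⁆, hP.closed (lie_mem_brk hx hy), hg x y⟩
  finrank_eq := (LinearEquiv.finrank_map_eq g P).trans hP.finrank_eq

lemma solv_span_singleton (x : L) :
    Solv (Submodule.span k {x}) ∧ brk (Submodule.span k {x}) (Submodule.span k {x}) ≤
      Submodule.span k {x} := by
  have h : brk (Submodule.span k {x}) (Submodule.span k {x}) = ⊥ := by
    rw [← le_bot_iff, brk_le]
    intro y hy z hz
    obtain ⟨a, rfl⟩ := Submodule.mem_span_singleton.mp hy
    obtain ⟨c, rfl⟩ := Submodule.mem_span_singleton.mp hz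
    rw [smul_lie, lie_smul, lie_self, smul_zero, smul_zero]
    exact zero_mem _
  exact ⟨⟨1, h⟩, h.trans_le bot_le⟩

/-- An element that normalizes a solvable subalgebra can be added to it. -/
lemma solv_span_sup {P : Submodule k L} (hP : Solv P) (hPP : brk P P ≤ P) {x : L}
    (hx : ∀ v ∈ P, ⁅x, v⁆ ∈ P) : Solv (Submodule.span k {x} ⊔ P) ∧
      brk (Submodule.span k {x} ⊔ P) (Submodule.span k {x} ⊔ P) ≤ Submodule.span k {x} ⊔ P := by
  obtain ⟨h1, h2⟩ := solv_span_singleton (k := k) x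
  have h : brk (Submodule.span k {x}) P ≤ P := brk_le.mpr fun y hy v hv => by
    obtain ⟨a, rfl⟩ := Submodule.mem_span_singleton.mp hy
    rw [smul_lie]
    exact P.smul_mem _ (hx v hv)
  exact ⟨Solv.sup h1 h2 hP hPP h, (brk_sup_sup hPP h).trans (sup_le_sup_right h2 _)⟩

end Solvable

section Horizontal

variable {𝔤 : Type*} [LieRing 𝔤] [LieAlgebra ℂ 𝔤]

lemma IsSolvOfDim.lsub [FiniteDimensional ℂ 𝔤] {P : Submodule ℂ 𝔤} {d : ℕ} (hP : IsSolvOfDim P d) :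
    IsSolvOfDim (lsub P) d :=
  ⟨solv_lsub hP.solv, (brk_lsub_le P P).trans (lsub_mono hP.closed),
    (finrank_lsub P).trans hP.finrank_eq⟩

lemma lie_mem_lsub {P Q R : Submodule ℂ 𝔤} (h : brk P Q ≤ R) {X Y : LG 𝔤} (hX : X ∈ lsub P)
    (hY : Y ∈ lsub Q) : ⁅X, Y⁆ ∈ lsub R :=
  lsub_mono h (brk_lsub_le P Q (lie_mem_brk hX hY))

/-- A connection with nilpotent residue is reduced to its residue by `Φ`. -/
structure IsReduction (C : LG 𝔤) (x : 𝔤) (Φ : LG 𝔤 ≃ₗ[LSer] LG 𝔤) : Prop where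
  map_lie : ∀ X Y, Φ ⁅X, Y⁆ = ⁅Φ X, Φ Y⁆
  map_cov : ∀ Y, Φ (cov (tpow (-1) ⊗ₜ[ℂ] x) Y) = cov C (Φ Y)
  lim_map : ∀ W : Submodule LSer (LG 𝔤), lim (W.map Φ.toLinearMap) = lim W

lemma exists_isReduction [FiniteDimensional ℂ 𝔤] {C : LG 𝔤} (hC : ∀ n < -1, lcoeff n C = 0)
    (hx : IsNilpotent (LieAlgebra.ad ℂ 𝔤 (lcoeff (-1) C))) :
    ∃ Φ, IsReduction C (lcoeff (-1) C) Φ := by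
  obtain ⟨Φ, h1, h2⟩ := exists_logForm hC hx
  exact ⟨Φ.toLinearEquiv, ⟨fun X Y => LieEquiv.map_lie Φ X Y, h1, h2⟩⟩

lemma IsReduction.eq_map_lsub_lim [FiniteDimensional ℂ 𝔤] {C : LG 𝔤} {x : 𝔤}
    {Φ : LG 𝔤 ≃ₗ[LSer] LG 𝔤} (hΦ : IsReduction C x Φ) (hx : IsNilpotent (LieAlgebra.ad ℂ 𝔤 x))
    {W : Submodule LSer (LG 𝔤)} (hW : ∀ Y ∈ W, cov C Y ∈ W) :
    W = (lsub (lim W)).map Φ.toLinearMap ∧ ∀ v ∈ lim W, ⁅x, v⁆ ∈ lim W := by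
  have hmap : (W.comap Φ.toLinearMap).map Φ.toLinearMap = W :=
    Submodule.map_comap_eq_of_surjective Φ.surjective W
  obtain ⟨h1, h2⟩ := eq_lsub_lim hx (W := W.comap Φ.toLinearMap) fun Y hY => by
    change Φ _ ∈ W
    rw [hΦ.map_cov]
    exact hW _ hY
  have hlim : lim (W.comap Φ.toLinearMap) = lim W := by
    rw [← hΦ.lim_map, hmap]
  rw [hlim] at h1 h2
  exact ⟨by rw [← h1, hmap], h2⟩

end Horizontal

section Miura

variable {𝔤 : Type*} [LieRing 𝔤] [LieAlgebra ℂ 𝔤] [FiniteDimensional ℂ 𝔤]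
  [LieAlgebra.HasTrivialRadical ℂ 𝔤] {ι : Type*} [Fintype ι] {𝔥 : LieSubalgebra ℂ 𝔤}
  {b : LieAlgebra.Basis ι 𝔥}

namespace PrincipalData

omit [LieAlgebra.HasTrivialRadical ℂ 𝔤] in
lemma mem_lsub_iff_proj (D : PrincipalData b) {U : Submodule ℂ 𝔤} {p : ℤ → Prop}
    (hU : ∀ x, x ∈ U ↔ ∀ c, p c → D.G.proj c x = 0) (X : LG 𝔤) :
    X ∈ lsub U ↔ ∀ c, p c → (D.G.baseChange LSer).proj c X = 0 := by
  have h (n : ℤ) (c : ℤ) : lcoeff n ((D.G.baseChange LSer).proj c X) = D.G.proj c (lcoeff n X) :=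
    lcoeff_baseChange ..
  rw [mem_lsub_iff]
  constructor
  · intro hX c hc
    refine LG.ext fun n => ?_
    rw [h, map_zero]
    exact (hU _).mp (hX n) c hc
  · intro hX n
    rw [hU]
    intro c hc
    rw [← h, hX c hc, map_zero]

omit [LieAlgebra.HasTrivialRadical ℂ 𝔤] in
lemma mem_lsub_bMinus (D : PrincipalData b) (X : LG 𝔤) :
    X ∈ lsub (bMinus b) ↔ ∀ c > 0, (D.G.baseChange LSer).proj c X = 0 :=
  D.mem_lsub_iff_proj D.mem_bMinus X

omit [LieAlgebra.HasTrivialRadical ℂ 𝔤] in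
lemma mem_lsub_cartan (D : PrincipalData b) (X : LG 𝔤) :
    X ∈ lsub 𝔥.toSubmodule ↔ ∀ c ≠ 0, (D.G.baseChange LSer).proj c X = 0 :=
  D.mem_lsub_iff_proj D.mem_cartan X

omit [LieAlgebra.HasTrivialRadical ℂ 𝔤] in
lemma mem_lsub_bPlus (D : PrincipalData b) (X : LG 𝔤) :
    X ∈ lsub (bPlus b) ↔ X ∈ (D.G.baseChange LSer).fil 0 :=
  (D.mem_lsub_iff_proj D.mem_bPlus X).trans (Grading.mem_fil _).symm

omit [LieAlgebra.HasTrivialRadical ℂ 𝔤] in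
lemma mem_lsub_nPlus (D : PrincipalData b) (X : LG 𝔤) :
    X ∈ lsub (nPlus b).toSubmodule ↔ X ∈ (D.G.baseChange LSer).fil 1 :=
  (D.mem_lsub_iff_proj D.mem_nPlus X).trans (Grading.mem_fil _).symm

omit [FiniteDimensional ℂ 𝔤] [LieAlgebra.HasTrivialRadical ℂ 𝔤] in
lemma isSolvOfDim_bMinus (D : PrincipalData b) :
    IsSolvOfDim (bMinus b) (Module.finrank ℂ (bMinus b)) :=
  ⟨D.solv_bMinus, D.brk_bMinus_le, rfl⟩

omit [FiniteDimensional ℂ 𝔤] [LieAlgebra.HasTrivialRadical ℂ 𝔤] in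
lemma lder_mem_fil (D : PrincipalData b) {c : ℤ} {X : LG 𝔤} (hX : X ∈ (D.G.baseChange LSer).fil c) :
    lder X ∈ (D.G.baseChange LSer).fil c := by
  rw [Grading.mem_fil] at hX ⊢
  intro d hd
  have h : (D.G.baseChange LSer).proj d (lder X) = lder ((D.G.baseChange LSer).proj d X) :=
    (lder_baseChange (D.G.proj d) X).symm
  rw [h, hX d hd, map_zero]

end PrincipalData

/-- The loop `∑ f_i`. -/
abbrev lf (b : LieAlgebra.Basis ι 𝔥) : LG 𝔤 := (1 : LSer) ⊗ₜ[ℂ] ∑ i, b.f i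

/-- `g` carries the connection `∂_t - ∑ f_i + u` to `∂_t + A`. -/
structure IsMiura (D : PrincipalData b) (A u : LG 𝔤) (g : LG 𝔤 ≃ₗ[LSer] LG 𝔤) : Prop where
  u_mem : u ∈ lsub 𝔥.toSubmodule
  g_mem : g ∈ unip (D.G.baseChange LSer)
  map_cov : ∀ Y, g (cov (u - lf b) Y) = cov A (g Y)

omit [FiniteDimensional ℂ 𝔤] [LieAlgebra.HasTrivialRadical ℂ 𝔤] in
lemma lf_mem (D : PrincipalData b) : lf b ∈ lsub (bMinus b) := tmul_mem_lsub 1 D.f_mem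

omit [FiniteDimensional ℂ 𝔤] [LieAlgebra.HasTrivialRadical ℂ 𝔤] in
lemma lf_mem_fil (D : PrincipalData b) : lf b ∈ (D.G.baseChange LSer).fil (-1) := by
  have h := Grading.proj_mem_fil (D.G.baseChange LSer) (-1) (lf b)
  have hf : (D.G.baseChange LSer).proj (-1) (lf b) = lf b := D.isPrincipal_baseChange.proj_f
  rwa [hf] at h

omit [FiniteDimensional ℂ 𝔤] [LieAlgebra.HasTrivialRadical ℂ 𝔤] in
lemma cov_mem_lsub_bMinus (D : PrincipalData b) {u Y : LG 𝔤} (hu : u ∈ lsub 𝔥.toSubmodule)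
    (hY : Y ∈ lsub (bMinus b)) : cov (u - lf b) Y ∈ lsub (bMinus b) :=
  add_mem (lder_mem_lsub hY) (lie_mem_lsub D.brk_bMinus_le
    (sub_mem (lsub_mono le_sup_left hu) (lf_mem D)) hY)

omit [LieAlgebra.HasTrivialRadical ℂ 𝔤] in
/-- The gauge transformation is determined by the two operators. -/
lemma IsMiura.unique (D : PrincipalData b) {A u : LG 𝔤} {g g' : LG 𝔤 ≃ₗ[LSer] LG 𝔤}
    (h : IsMiura D A u g) (h' : IsMiura D A u g') : g = g' := by
  have hP := D.isPrincipal_baseChange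
  have h1 : g'⁻¹ * g = 1 := by
    refine hP.eq_one_of_commute (mul_mem (inv_mem h'.g_mem) h.g_mem)
      (AddMonoidHom.mk' (cov (u - lf b)) (cov_add _)) (fun c x hx => ?_) fun x => ?_
    · have hu : u ∈ (D.G.baseChange LSer).fil 0 :=
        (D.mem_lsub_bPlus u).mp (lsub_mono le_sup_left h.u_mem)
      have h2 := hP.isLie.lie_mem_fil hu hx
      rw [zero_add] at h2
      have h3 : cov (u - lf b) x + ⁅lf b, x⁆ = lder x + ⁅u, x⁆ := by
        rw [cov, sub_lie]; abel
      change cov (u - lf b) x + ⁅lf b, x⁆ ∈ _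
      rw [h3]
      exact add_mem (D.lder_mem_fil hx) h2
    · change g'.symm (g (cov (u - lf b) x)) = cov (u - lf b) (g'.symm (g x))
      rw [h.map_cov, LinearEquiv.symm_apply_eq, h'.map_cov, LinearEquiv.apply_symm_apply]
  exact (inv_mul_eq_one.mp h1).symm

/-- The limit attached to an operator in the fibre of the Miura transformation. -/
abbrev miuraLim (b : LieAlgebra.Basis ι 𝔥) (k g : LG 𝔤 ≃ₗ[LSer] LG 𝔤) : Submodule ℂ 𝔤 :=
  lim (((lsub (bMinus b)).map g.toLinearMap).map k.toLinearMap)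

variable {A C : LG 𝔤} {k : LG 𝔤 ≃ₗ[LSer] LG 𝔤}

omit [FiniteDimensional ℂ 𝔤] [LieAlgebra.HasTrivialRadical ℂ 𝔤] in
lemma IsMiura.cov_mem (D : PrincipalData b) (hk : ∀ Y, k (cov A Y) = cov C (k Y)) {u : LG 𝔤}
    {g : LG 𝔤 ≃ₗ[LSer] LG 𝔤} (h : IsMiura D A u g) :
    ∀ Y ∈ ((lsub (bMinus b)).map g.toLinearMap).map k.toLinearMap,
      cov C Y ∈ ((lsub (bMinus b)).map g.toLinearMap).map k.toLinearMap := by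
  rintro - ⟨-, ⟨Y, hY, rfl⟩, rfl⟩
  refine ⟨g (cov (u - lf b) Y), ⟨_, cov_mem_lsub_bMinus D h.u_mem hY, rfl⟩, ?_⟩
  change k (g (cov (u - lf b) Y)) = cov C (k (g Y))
  rw [h.map_cov, hk]

lemma IsMiura.exists_borel (D : PrincipalData b) (hklie : ∀ X Y, k ⁅X, Y⁆ = ⁅k X, k Y⁆)
    (hk : ∀ Y, k (cov A Y) = cov C (k Y)) (hC : ∀ n < -1, lcoeff n C = 0)
    (hx : IsNilpotent (LieAlgebra.ad ℂ 𝔤 (lcoeff (-1) C))) {u : LG 𝔤} {g : LG 𝔤 ≃ₗ[LSer] LG 𝔤}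
    (h : IsMiura D A u g) :
    ∃ B ∈ springerFiber (lcoeff (-1) C), B.toSubmodule = miuraLim b k g := by
  obtain ⟨Φ, hΦ⟩ := exists_isReduction hC hx
  obtain ⟨h1, h2⟩ := hΦ.eq_map_lsub_lim hx (h.cov_mem D hk)
  have hglie := unip_map_lie D.isPrincipal_baseChange.isLie h.g_mem
  have hW := (D.isSolvOfDim_bMinus.lsub.map g hglie).map k hklie
  have hVs : Solv (miuraLim b k g) := solv_lim hW.solv
  have hVc : brk (miuraLim b k g) (miuraLim b k g) ≤ miuraLim b k g :=
    (brk_lim_le _ _).trans (lim_mono hW.closed)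
  have hVd : Module.finrank ℂ (miuraLim b k g) = Module.finrank ℂ (bMinus b) := by
    rw [← hW.finrank_eq, ← finrank_lsub (miuraLim b k g), ← LinearEquiv.finrank_map_eq Φ]
    exact congrArg (fun W : Submodule LSer (LG 𝔤) => Module.finrank LSer W) h1.symm
  obtain ⟨h3, h4⟩ := solv_span_sup hVs hVc h2
  have h5 : miuraLim b k g = Submodule.span ℂ {lcoeff (-1) C} ⊔ miuraLim b k g :=
    Submodule.eq_of_le_of_finrank_le le_sup_right (hVd ▸ D.finrank_le h3 h4)
  refine ⟨ofBrkLe _ hVc, ⟨(D.isBorel_iff _).mpr ⟨hVs, hVd⟩, ?_⟩, rfl⟩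
  change lcoeff (-1) C ∈ miuraLim b k g
  rw [h5]
  exact Submodule.mem_sup_left (Submodule.mem_span_singleton_self _)

lemma eq_of_cov_eq {u u' : LG 𝔤} (h : ∀ Y, cov u Y = cov u' Y) : u = u' := by
  have := isKilling_loop (𝔤 := 𝔤)
  have hc : u - u' ∈ LieAlgebra.center LSer (LG 𝔤) := by
    rw [LieModule.mem_maxTrivSubmodule]
    intro Y
    have h1 : ⁅u, Y⁆ = ⁅u', Y⁆ := add_left_cancel (h Y)
    rw [← lie_skew, sub_lie, h1, sub_self, neg_zero]
  rw [LieAlgebra.center_eq_bot] at hc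
  exact sub_eq_zero.mp ((LieSubmodule.mem_bot _).mp hc)

lemma IsMiura.injective (D : PrincipalData b)
    (hk : ∀ Y, k (cov A Y) = cov C (k Y)) (hC : ∀ n < -1, lcoeff n C = 0)
    (hx : IsNilpotent (LieAlgebra.ad ℂ 𝔤 (lcoeff (-1) C))) {u u' : LG 𝔤}
    {g g' : LG 𝔤 ≃ₗ[LSer] LG 𝔤} (h : IsMiura D A u g) (h' : IsMiura D A u' g')
    (hlim : miuraLim b k g = miuraLim b k g') : u = u' := by
  obtain ⟨Φ, hΦ⟩ := exists_isReduction hC hx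
  have h1 := (hΦ.eq_map_lsub_lim hx (h.cov_mem D hk)).1
  have h2 := (hΦ.eq_map_lsub_lim hx (h'.cov_mem D hk)).1
  have h3 := Submodule.map_injective_of_injective k.injective
    (h1.trans ((congrArg (fun V => (lsub V).map Φ.toLinearMap) hlim).trans h2.symm))
  have hP := D.isPrincipal_baseChange
  have h4 : g'⁻¹ * g = 1 := by
    refine hP.eq_one_of_map_le (mul_mem (inv_mem h'.g_mem) h.g_mem) fun X hX => ?_
    rw [← D.mem_lsub_bMinus] at hX ⊢
    have h5 : g X ∈ (lsub (bMinus b)).map g'.toLinearMap := h3 ▸ ⟨X, hX, rfl⟩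
    obtain ⟨Z, hZ, hZX⟩ := h5
    change g'.symm (g X) ∈ _
    rw [← hZX]
    change g'.symm (g' Z) ∈ _
    rwa [LinearEquiv.symm_apply_apply]
  obtain rfl : g' = g := inv_mul_eq_one.mp h4
  refine sub_left_injective (b := lf b) (eq_of_cov_eq fun Y => g'.injective ?_)
  rw [h.map_cov, h'.map_cov]

/-- Every automorphism carries connections to connections. -/
lemma exists_gauge (A : LG 𝔤) (g : LG 𝔤 ≃ₗ[LSer] LG 𝔤) (hg : ∀ X Y, g ⁅X, Y⁆ = ⁅g X, g Y⁆) :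
    ∃ A' : LG 𝔤, ∀ Y, g (cov A Y) = cov A' (g Y) := by
  have := isKilling_loop (𝔤 := 𝔤)
  let T : LieDerivation LSer (LG 𝔤) (LG 𝔤) :=
    { toFun := fun Z => g (cov A (g.symm Z)) - lder Z
      map_add' := fun X Y => by rw [map_add, cov_add, map_add, map_add]; abel
      map_smul' := fun s X => by
        rw [map_smul, cov_smul, map_add, map_smul, map_smul, lder_smul, LinearEquiv.apply_symm_apply,
          RingHom.id_apply, smul_sub]
        abel
      leibniz' := fun X Y => by
        have hs (X Y : LG 𝔤) : g.symm ⁅X, Y⁆ = ⁅g.symm X, g.symm Y⁆ := by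
          rw [LinearEquiv.symm_apply_eq, hg, LinearEquiv.apply_symm_apply,
            LinearEquiv.apply_symm_apply]
        change g (cov A (g.symm ⁅X, Y⁆)) - lder ⁅X, Y⁆ =
          ⁅X, g (cov A (g.symm Y)) - lder Y⁆ - ⁅Y, g (cov A (g.symm X)) - lder X⁆
        rw [hs, cov_lie, map_add, hg, hg, LinearEquiv.apply_symm_apply,
          LinearEquiv.apply_symm_apply, lder_lie, lie_sub, lie_sub, ← lie_skew Y, ← lie_skew Y]
        abel }
  obtain ⟨A', hA'⟩ := LieDerivation.IsKilling.exists_eq_ad T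
  refine ⟨A', fun Y => ?_⟩
  have h1 : T (g Y) = ⁅A', g Y⁆ := by
    rw [← hA', LieDerivation.ad_apply_apply]
  have h2 : T (g Y) = g (cov A (g.symm (g Y))) - lder (g Y) := rfl
  rw [LinearEquiv.symm_apply_apply, h1] at h2
  change _ = lder (g Y) + ⁅A', g Y⁆
  rw [h2]
  abel

/-- The associated graded of a horizontal Borel subalgebra is `𝔟₋`. -/
lemma gr_eq_lsub_bMinus (D : PrincipalData b) (hA : A + lf b ∈ lsub (bPlus b))
    {W : Submodule LSer (LG 𝔤)} (hW : IsSolvOfDim W (Module.finrank ℂ (bMinus b)))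
    (hWA : ∀ Y ∈ W, cov A Y ∈ W) : (D.G.baseChange LSer).gr W = lsub (bMinus b) := by
  set G := D.G.baseChange LSer with hG
  have hP := D.isPrincipal_baseChange
  have hgrf : ∀ X ∈ G.gr W, ⁅lf b, X⁆ ∈ G.gr W := by
    intro X hX
    rw [← G.sum_proj X, lie_sum]
    refine sum_mem fun c _ => ?_
    obtain ⟨w, hw, hc, h⟩ := G.mem_gr.mp hX c
    have h1 : cov A w = (lder w + ⁅A + lf b, w⁆) - ⁅lf b, w⁆ := by rw [cov, add_lie]; abel
    have h2 : lder w + ⁅A + lf b, w⁆ ∈ G.fil c := by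
      have := hP.isLie.lie_mem_fil ((D.mem_lsub_bPlus _).mp hA) hc
      rw [zero_add] at this
      exact add_mem (D.lder_mem_fil hc) this
    have h3 : ⁅lf b, w⁆ ∈ G.fil (-1 + c) := hP.isLie.lie_mem_fil (lf_mem_fil D) hc
    have h4 : cov A w ∈ G.fil (-1 + c) := by
      rw [h1]; exact sub_mem (G.fil_anti (by omega) h2) h3
    have h5 : G.proj (-1 + c) (cov A w) = -⁅lf b, G.proj c X⁆ := by
      rw [h1, map_sub, G.mem_fil.mp h2 _ (by omega), zero_sub,
        hP.isLie.proj_lie_of_mem_fil (lf_mem_fil D) hc, hP.proj_f, h]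
    have h6 := G.proj_mem_gr_of_mem (hWA w hw) h4
    rw [h5] at h6
    exact neg_mem_iff.mp h6
  have hgrs : Solv (G.gr W) := hP.isLie.solv_gr hW.solv
  have hgrc : brk (G.gr W) (G.gr W) ≤ G.gr W :=
    (hP.isLie.brk_gr_le _ _).trans (G.gr_mono hW.closed)
  have hgrd : Module.finrank ℂ (bMinus b) ≤ Module.finrank LSer (G.gr W) :=
    hW.finrank_eq ▸ G.finrank_le_finrank_gr W
  have hVs : Solv (lim (G.gr W)) := solv_lim hgrs
  have hVc : brk (lim (G.gr W)) (lim (G.gr W)) ≤ lim (G.gr W) :=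
    (brk_lim_le _ _).trans (lim_mono hgrc)
  have hVf : ∀ v ∈ lim (G.gr W), ⁅∑ i, b.f i, v⁆ ∈ lim (G.gr W) := by
    rintro - ⟨w, hw, hw', rfl⟩
    exact ⟨_, hgrf w hw, fun n hn => by rw [lcoeff_one_tmul_lie, hw' n hn, lie_zero],
      lcoeff_one_tmul_lie ..⟩
  have hVG (c : ℤ) : ∀ v ∈ lim (G.gr W), D.G.proj c v ∈ lim (G.gr W) := fun v hv =>
    baseChange_mem_lim (fun X hX => G.proj_mem_gr hX c) hv
  obtain ⟨h1, h2⟩ := solv_span_sup hVs hVc hVf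
  have h3 : Submodule.span ℂ {∑ i, b.f i} ⊔ lim (G.gr W) ≤ bMinus b := by
    refine D.le_bMinus h1 h2 (fun x hx c => ?_)
      (Submodule.mem_sup_left (Submodule.mem_span_singleton_self _))
    obtain ⟨y, hy, v, hv, rfl⟩ := Submodule.mem_sup.mp hx
    obtain ⟨a, rfl⟩ := Submodule.mem_span_singleton.mp hy
    rw [map_add, map_smul]
    refine Submodule.add_mem_sup (Submodule.smul_mem _ _ ?_) (hVG c v hv)
    rcases eq_or_ne c (-1) with rfl | hc
    · rw [D.proj_f]; exact Submodule.mem_span_singleton_self _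
    · rw [D.G.proj_of_eq D.proj_f hc]; exact zero_mem _
  have h4 : lim (G.gr W) ≤ bMinus b := le_sup_right.trans h3
  refine Submodule.eq_of_le_of_finrank_le (fun X hX => ?_) ((finrank_lsub _).trans_le hgrd)
  rw [D.mem_lsub_bMinus]
  intro c hc
  by_contra hne
  obtain ⟨m, hm, hm'⟩ := exists_leading_coeff hne
  have h5 : lcoeff 0 (tpow m • G.proj c X) ∈ bMinus b :=
    h4 ⟨_, Submodule.smul_mem _ _ (G.proj_mem_gr hX c), hm, rfl⟩
  have h6 : D.G.proj c (lcoeff 0 (tpow m • G.proj c X)) = lcoeff 0 (tpow m • G.proj c X) := by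
    rw [← lcoeff_baseChange, map_smul]
    change lcoeff 0 (tpow m • G.proj c (G.proj c X)) = _
    rw [G.proj_proj_self]
  rw [D.mem_bMinus] at h5
  rw [← h6, h5 c hc] at hm'
  exact hm' rfl

omit [LieAlgebra.HasTrivialRadical ℂ 𝔤] in
/-- Gauge transformations by unipotent elements preserve the form of an oper. -/
lemma gauge_lie_mem_fil (D : PrincipalData b) (hA : A + lf b ∈ lsub (bPlus b))
    {g : LG 𝔤 ≃ₗ[LSer] LG 𝔤} (hg : g ∈ unip (D.G.baseChange LSer)) {A' : LG 𝔤}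
    (hA' : ∀ Y, g (cov A Y) = cov A' (g Y)) {c : ℤ} {X : LG 𝔤}
    (hX : X ∈ (D.G.baseChange LSer).fil c) : ⁅A' + lf b, X⁆ ∈ (D.G.baseChange LSer).fil c := by
  have hP := D.isPrincipal_baseChange
  have hglie := unip_map_lie hP.isLie hg
  obtain ⟨Y, rfl⟩ := g.surjective X
  have hYc : Y ∈ (D.G.baseChange LSer).fil c := by
    have h := unip_mem_fil hP.isLie (inv_mem hg) hX
    have hY : g⁻¹ (g Y) = Y := g.symm_apply_apply Y
    rwa [hY] at h
  have h2 : ⁅A' + lf b, g Y⁆ =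
      g (lder Y + ⁅A + lf b, Y⁆) - ⁅g (lf b) - lf b, g Y⁆ - lder (g Y) := by
    have h3 : g (lder Y) + g ⁅A, Y⁆ = lder (g Y) + ⁅A', g Y⁆ := by
      rw [← map_add]; exact hA' Y
    rw [map_add, add_lie A, map_add, hglie (lf b), add_lie, sub_lie, ← add_assoc, h3]
    abel
  have h4 : g (lf b) - lf b ∈ (D.G.baseChange LSer).fil 0 := by
    simpa using unip_sub_mem hP.isLie hg (lf_mem_fil D)
  have h5 := hP.isLie.lie_mem_fil h4 hX
  have h6 := hP.isLie.lie_mem_fil ((D.mem_lsub_bPlus _).mp hA) hYc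
  rw [zero_add] at h5 h6
  rw [h2]
  exact sub_mem (sub_mem (unip_mem_fil hP.isLie hg (add_mem (D.lder_mem_fil hYc) h6)) h5)
    (D.lder_mem_fil hX)

/-- A horizontal Borel subalgebra is conjugate to `𝔟₋((t))` by a unipotent element. -/
lemma exists_unip_map_eq (D : PrincipalData b) (hA : A + lf b ∈ lsub (bPlus b))
    {W : Submodule LSer (LG 𝔤)} (hW : IsSolvOfDim W (Module.finrank ℂ (bMinus b)))
    (hWA : ∀ Y ∈ W, cov A Y ∈ W) :
    ∃ g ∈ unip (D.G.baseChange LSer), W.map g.toLinearMap = lsub (bMinus b) := by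
  have hgr := gr_eq_lsub_bMinus D hA hW hWA
  have hP := D.isPrincipal_baseChange
  have hRm : (1 : LSer) ⊗ₜ[ℂ] D.ρ ∈ lsub (bMinus b) := tmul_mem_lsub 1 D.rho_mem
  rw [← hgr] at hRm
  obtain ⟨w, hw, hw0, hwR⟩ := (Grading.mem_gr _).mp hRm 0
  rw [hP.proj_rho] at hwR
  have hw1 := Grading.sub_proj_mem_fil _ hw0
  rw [hwR] at hw1
  obtain ⟨g, hg, hgw⟩ := hP.exists_unip_apply hw1
  rw [add_sub_cancel] at hgw
  have hW1 := hW.map g (unip_map_lie hP.isLie hg)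
  have hRW : (1 : LSer) ⊗ₜ[ℂ] D.ρ ∈ W.map g.toLinearMap := ⟨w, hw, hgw⟩
  refine ⟨g, hg, Submodule.eq_of_le_of_finrank_eq ?_ (hW1.finrank_eq.trans (finrank_lsub _).symm)⟩
  rw [← hgr]
  refine le_trans (Grading.le_gr _ fun X hX c => ?_) (gr_map_le hP.isLie hg W)
  exact Grading.proj_mem_of_stable _
    (T := LieAlgebra.ad LSer (LG 𝔤) ((1 : LSer) ⊗ₜ[ℂ] D.ρ)) (a := fun c : ℤ => (c : LSer))
    Int.cast_injective hP.lie_rho (fun Y hY => hW1.closed (lie_mem_brk hRW hY)) hX c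

omit [LieAlgebra.HasTrivialRadical ℂ 𝔤] in
lemma mem_lsub_cartan_of_cov (D : PrincipalData b) {U : LG 𝔤}
    (hfil : ⁅U, (1 : LSer) ⊗ₜ[ℂ] D.ρ⁆ ∈ (D.G.baseChange LSer).fil 0)
    (hcov : cov (U - lf b) ((1 : LSer) ⊗ₜ[ℂ] D.ρ) ∈ lsub (bMinus b)) :
    U ∈ lsub 𝔥.toSubmodule := by
  have hP := D.isPrincipal_baseChange
  have hRm : (1 : LSer) ⊗ₜ[ℂ] D.ρ ∈ lsub (bMinus b) := tmul_mem_lsub 1 D.rho_mem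
  have h1 : ⁅U, (1 : LSer) ⊗ₜ[ℂ] D.ρ⁆ ∈ lsub (bMinus b) := by
    have h2 := sub_mem hcov (lder_mem_lsub hRm)
    have h3 := add_mem h2 (lie_mem_lsub D.brk_bMinus_le (lf_mem D) hRm)
    rwa [cov, add_sub_cancel_left, sub_lie, sub_add_cancel] at h3
  rw [D.mem_lsub_bMinus] at h1
  rw [D.mem_lsub_cartan]
  intro c hc
  have h2 : (D.G.baseChange LSer).proj c ⁅U, (1 : LSer) ⊗ₜ[ℂ] D.ρ⁆ = 0 := by
    rcases lt_or_gt_of_ne hc with h | h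
    · exact (Grading.mem_fil _).mp hfil c h
    · exact h1 c h
  rw [← lie_skew, map_neg, neg_eq_zero, hP.proj_lie_rho] at h2
  exact (smul_eq_zero.mp h2).resolve_left (Int.cast_ne_zero.mpr hc)

/-- Every horizontal Borel subalgebra comes from the Miura transformation. -/
lemma exists_isMiura (D : PrincipalData b) (hA : A + lf b ∈ lsub (bPlus b))
    {W : Submodule LSer (LG 𝔤)} (hW : IsSolvOfDim W (Module.finrank ℂ (bMinus b)))
    (hWA : ∀ Y ∈ W, cov A Y ∈ W) :
    ∃ u g, IsMiura D A u g ∧ (lsub (bMinus b)).map g.toLinearMap = W := by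
  obtain ⟨g, hg, hgW⟩ := exists_unip_map_eq D hA hW hWA
  have hP := D.isPrincipal_baseChange
  obtain ⟨A', hA'⟩ := exists_gauge A g (unip_map_lie hP.isLie hg)
  have hinv (X : LG 𝔤) : g (g⁻¹ X) = X := g.apply_symm_apply X
  refine ⟨A' + lf b, g⁻¹, ⟨mem_lsub_cartan_of_cov D
    (gauge_lie_mem_fil D hA hg hA' hP.rho_mem_fil) ?_, inv_mem hg, fun Y => g.injective ?_⟩, ?_⟩
  · have hRm : (1 : LSer) ⊗ₜ[ℂ] D.ρ ∈ lsub (bMinus b) := tmul_mem_lsub 1 D.rho_mem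
    rw [add_sub_cancel_right]
    rw [← hgW] at hRm ⊢
    obtain ⟨w, hw, hgw⟩ := hRm
    exact ⟨cov A w, hWA w hw, (hA' w).trans (congrArg (cov A') hgw)⟩
  · rw [add_sub_cancel_right, hinv, hA', hinv]
  · rw [← hgW, ← Submodule.map_comp]
    have hid : (g⁻¹).toLinearMap ∘ₗ g.toLinearMap = LinearMap.id :=
      LinearMap.ext fun X => g.symm_apply_apply X
    rw [hid, Submodule.map_id]

lemma exists_isMiura_of_borel (D : PrincipalData b) (hA : A + lf b ∈ lsub (bPlus b))
    (hklie : ∀ X Y, k ⁅X, Y⁆ = ⁅k X, k Y⁆)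
    (hk : ∀ Y, k (cov A Y) = cov C (k Y)) (hC : ∀ n < -1, lcoeff n C = 0)
    (hx : IsNilpotent (LieAlgebra.ad ℂ 𝔤 (lcoeff (-1) C))) {B : LieSubalgebra ℂ 𝔤}
    (hB : B ∈ springerFiber (lcoeff (-1) C)) :
    ∃ u g, IsMiura D A u g ∧ B.toSubmodule = miuraLim b k g := by
  obtain ⟨Φ, hΦ⟩ := exists_isReduction hC hx
  obtain ⟨hB1, hB2⟩ := (D.isBorel_iff B).mp hB.1
  have hB0 : IsSolvOfDim B.toSubmodule (Module.finrank ℂ (bMinus b)) :=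
    ⟨hB1, brk_toSubmodule_le B, hB2⟩
  have hs (X Y : LG 𝔤) : k.symm ⁅X, Y⁆ = ⁅k.symm X, k.symm Y⁆ := by
    rw [LinearEquiv.symm_apply_eq, hklie, LinearEquiv.apply_symm_apply,
      LinearEquiv.apply_symm_apply]
  have hsc (Y : LG 𝔤) : cov A (k.symm Y) = k.symm (cov C Y) := by
    rw [LinearEquiv.eq_symm_apply, hk, LinearEquiv.apply_symm_apply]
  obtain ⟨u, g, h, hmap⟩ := exists_isMiura D hA ((hB0.lsub.map Φ hΦ.map_lie).map k.symm hs) (by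
    rintro - ⟨-, ⟨Y, hY, rfl⟩, rfl⟩
    exact ⟨cov C (Φ Y), ⟨cov (tpow (-1) ⊗ₜ lcoeff (-1) C) Y, add_mem (lder_mem_lsub hY)
      (lie_mem_lsub (brk_toSubmodule_le B) (tmul_mem_lsub _ hB.2) hY), hΦ.map_cov Y⟩, (hsc _).symm⟩)
  refine ⟨u, g, h, ?_⟩
  rw [miuraLim, hmap, ← Submodule.map_comp]
  have hid : k.toLinearMap ∘ₗ k.symm.toLinearMap = LinearMap.id :=
    LinearMap.ext fun X => k.apply_symm_apply X
  rw [hid, Submodule.map_id, hΦ.lim_map, lim_lsub]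

end Miura

open LSer

/-! ### The fibres of the Miura transformation -/

lemma eq_exp_iff {K L : Type*} [Field K] [CharZero K] [AddCommGroup L] [Module K L]
    [Module ℚ (Module.End K L)] {N g : Module.End K L} (hN : IsNilpotent N) :
    g = IsNilpotent.exp N ↔ ∀ n, N ^ n = 0 → ∀ x,
      g x = ∑ i ∈ Finset.range n, (i.factorial : K)⁻¹ • (N ^ i) x := by
  have h (n : ℕ) (hn : N ^ n = 0) (x : L) : IsNilpotent.exp N x =
      ∑ i ∈ Finset.range n, (i.factorial : K)⁻¹ • (N ^ i) x := by
    rw [IsNilpotent.exp_eq_sum hn, LinearMap.sum_apply]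
    refine Finset.sum_congr rfl fun i _ => ?_
    rw [inv_natCast_smul_eq (R := ℚ) (S := K), LinearMap.smul_apply]
  constructor
  · rintro rfl
    exact h
  · intro hg
    obtain ⟨n, hn⟩ := hN
    exact LinearMap.ext fun x => (hg n hn x).trans (h n hn x).symm

section Miura

variable {𝔤 : Type*} [LieRing 𝔤] [LieAlgebra ℂ 𝔤]

lemma mem_limitAtZero {W : Submodule (LaurentSeries ℂ) (Loop 𝔤)} {v : 𝔤} :
    v ∈ limitAtZero W ↔ ∃ w ∈ W, (∀ n < 0, loopCoeff n w = 0) ∧ loopCoeff 0 w = v := by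
  simp only [limitAtZero, integralLoops, Submodule.mem_map, Submodule.mem_inf,
    Submodule.restrictScalars_mem, Submodule.mem_iInf, LinearMap.mem_ker, and_assoc]

lemma limitAtZero_eq (W : Submodule (LaurentSeries ℂ) (Loop 𝔤)) :
    limitAtZero W = lim (𝔤 := 𝔤) W :=
  Submodule.ext fun _ => mem_limitAtZero

variable [FiniteDimensional ℂ 𝔤]
  [LieAlgebra.HasTrivialRadical ℂ 𝔤] {ι : Type*} [Fintype ι] {𝔥 : LieSubalgebra ℂ 𝔤}
  {b : LieAlgebra.Basis ι 𝔥}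

omit [FiniteDimensional ℂ 𝔤] [LieAlgebra.HasTrivialRadical ℂ 𝔤] in
lemma isNilpotent_ad_of_mem_nPlus (D : PrincipalData b) {x : 𝔤} (hx : x ∈ nPlus b) :
    IsNilpotent (LieAlgebra.ad ℂ 𝔤 x) :=
  Grading.IsLie.isNilpotent_ad D.isLie ((Grading.mem_fil _).mpr ((D.mem_nPlus x).mp hx))

omit [LieAlgebra.HasTrivialRadical ℂ 𝔤] in
lemma loopNPlus_eq (D : PrincipalData b) :
    loopNPlus b = (unip (D.G.baseChange LSer) : Subgroup (LG 𝔤 ≃ₗ[LSer] LG 𝔤)) := by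
  have : CharZero (LaurentSeries ℂ) := inferInstanceAs (CharZero LSer)
  refine congrArg Subgroup.closure (Set.ext fun g => ?_)
  have h (X : LG 𝔤) (hX : X ∈ (D.G.baseChange LSer).fil 1) :=
    eq_exp_iff (K := LaurentSeries ℂ) (L := Loop 𝔤) (g := g)
      (Grading.IsLie.isNilpotent_ad D.isPrincipal_baseChange.isLie hX)
  constructor
  · rintro ⟨X, hX, hg⟩
    have hX' := (D.mem_lsub_nPlus X).mp hX
    exact ⟨X, hX', (h X hX').mp hg⟩
  · rintro ⟨X, hX, hg⟩
    exact ⟨X, (D.mem_lsub_nPlus X).mpr hX, (h X hX).mpr hg⟩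

omit [LieAlgebra.HasTrivialRadical ℂ 𝔤] in
lemma isMiura_iff (D : PrincipalData b) (A : OperConn b) (u : Conn 𝔥)
    (g : Loop 𝔤 ≃ₗ[LaurentSeries ℂ] Loop 𝔤) :
    IsMiura D A.1 u.1 g ↔ g ∈ loopNPlus b ∧ IsGaugeTransform g (miuraConn b u).1 A.1 := by
  rw [loopNPlus_eq D]
  exact ⟨fun h => ⟨h.g_mem, h.map_cov⟩, fun h => ⟨u.2, h.1, h.2⟩⟩

omit [LieAlgebra.HasTrivialRadical ℂ 𝔤] in
lemma mem_miuraFiber_iff (D : PrincipalData b) (A : OperConn b) (u : Conn 𝔥) :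
    u ∈ miuraFiber A.toOper ↔ ∃ g, IsMiura D A.1 u.1 g := by
  have h : u ∈ miuraFiber A.toOper ↔
      ∃ g ∈ loopNPlus b, IsGaugeTransform g (miuraConn b u).1 A.1 :=
    Quotient.eq (r := gaugeSetoid b)
  exact h.trans (exists_congr fun g => (isMiura_iff D A u g).symm)

/-- Horizontal Borel subalgebras are classified by their limits. -/
lemma exists_equiv_springerFiber (D : PrincipalData b) {A C : LG 𝔤} {k : LG 𝔤 ≃ₗ[LSer] LG 𝔤}
    (hA : A + lf b ∈ lsub (bPlus b)) (hklie : ∀ X Y, k ⁅X, Y⁆ = ⁅k X, k Y⁆)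
    (hk : ∀ Y, k (cov A Y) = cov C (k Y)) (hC : ∀ n < -1, lcoeff n C = 0)
    (hx : IsNilpotent (LieAlgebra.ad ℂ 𝔤 (lcoeff (-1) C))) :
    ∃ e : {u // ∃ g, IsMiura D A u g} ≃ springerFiber (lcoeff (-1) C),
      ∀ u, ∃ g, IsMiura D A u.1 g ∧ (e u).1.toSubmodule = miuraLim b k g := by
  choose g hg using fun u : {u // ∃ g, IsMiura D A u g} => u.2
  choose B hB hBlim using fun u => (hg u).exists_borel D hklie hk hC hx
  have hbij : Function.Bijective fun u =>
      (⟨B u, hB u⟩ : springerFiber (lcoeff (-1) C)) := by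
    constructor
    · intro u u' huu
      have h1 : B u = B u' := congrArg Subtype.val huu
      exact Subtype.ext ((hg u).injective D hk hC hx (hg u')
        ((hBlim u).symm.trans ((congrArg LieSubalgebra.toSubmodule h1).trans (hBlim u'))))
    · rintro ⟨B', hB'⟩
      obtain ⟨u, g', h1, h2⟩ := exists_isMiura_of_borel D hA hklie hk hC hx hB'
      refine ⟨⟨u, g', h1⟩, Subtype.ext (LieSubalgebra.toSubmodule_injective ?_)⟩
      have h3 : g ⟨u, g', h1⟩ = g' := (hg ⟨u, g', h1⟩).unique D h1
      exact (hBlim _).trans ((congrArg (miuraLim b k) h3).trans h2.symm)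
  exact ⟨Equiv.ofBijective _ hbij, fun u => ⟨g u, hg u, hBlim u⟩⟩

/-- The fibre of the Miura transformation, as a set of loops. -/
def miuraFiberEquiv (D : PrincipalData b) (A : OperConn b) :
    miuraFiber A.toOper ≃ {u // ∃ g, IsMiura D A.1 u g} where
  toFun u := ⟨u.1.1, (mem_miuraFiber_iff D A u.1).mp u.2⟩
  invFun u := ⟨⟨u.1, u.2.choose_spec.u_mem⟩, (mem_miuraFiber_iff D A _).mpr u.2⟩
  left_inv _ := rfl
  right_inv _ := rfl

/-- The fibre of the Miura transformation over an oper with regular singularity and unipotent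
monodromy is the Springer fibre of the residue. -/
lemma exists_miuraFiber_equiv (D : PrincipalData b) (A : OperConn b)
    {k : Loop 𝔤 ≃ₗ⁅LaurentSeries ℂ⁆ Loop 𝔤} {C : Loop 𝔤} (h : IsUnipotentLogForm A k C) :
    ∃ e : miuraFiber A.toOper ≃ springerFiber (loopCoeff (-1) C),
      ∀ u : miuraFiber A.toOper, IsLimitBorel A k u (e u : LieSubalgebra ℂ 𝔤) := by
  obtain ⟨hk, hC, hx⟩ := h
  have hklie (X Y : Loop 𝔤) :
      k.toLinearEquiv ⁅X, Y⁆ = ⁅k.toLinearEquiv X, k.toLinearEquiv Y⁆ := LieEquiv.map_lie k X Y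
  obtain ⟨e, he⟩ := exists_equiv_springerFiber D (k := k.toLinearEquiv) A.2 hklie hk hC hx
  refine ⟨(miuraFiberEquiv D A).trans e, fun u => ?_⟩
  obtain ⟨g, hg, hlim⟩ := he (miuraFiberEquiv D A u)
  obtain ⟨h1, h2⟩ := (isMiura_iff D A u.1 g).mp hg
  exact ⟨g, h1, h2, hlim.trans (limitAtZero_eq _).symm⟩

omit [FiniteDimensional ℂ 𝔤] [LieAlgebra.HasTrivialRadical ℂ 𝔤] in
lemma OperConn.IsNilpotentForm.isUnipotentLogForm (D : PrincipalData b) {A : OperConn b}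
    (hA : A.IsNilpotentForm) : IsUnipotentLogForm A LieEquiv.refl A.1 :=
  ⟨fun _ => rfl, hA.1, isNilpotent_ad_of_mem_nPlus D hA.2⟩

omit [FiniteDimensional ℂ 𝔤] [LieAlgebra.HasTrivialRadical ℂ 𝔤] in
lemma OperConn.IsRegularForm.isNilpotentForm {A : OperConn b} (hA : A.IsRegularForm) :
    A.IsNilpotentForm :=
  ⟨fun n hn => hA n (by omega), by rw [hA (-1) (by omega)]; exact zero_mem _⟩

omit [FiniteDimensional ℂ 𝔤] [LieAlgebra.HasTrivialRadical ℂ 𝔤] in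
lemma springerFiber_zero : springerFiber (0 : 𝔤) = flagVariety 𝔤 :=
  Set.ext fun B => and_iff_left B.zero_mem

end Miura

end MiuraOper

end

open MiuraOper in
theorem mainTheorem1 {𝔤 : Type*} [LieRing 𝔤] [LieAlgebra ℂ 𝔤] [FiniteDimensional ℂ 𝔤]
    [LieAlgebra.IsSimple ℂ 𝔤] {ι : Type*} [Fintype ι] {𝔥 : LieSubalgebra ℂ 𝔤}
    (b : LieAlgebra.Basis ι 𝔥) (ρ : Oper b) (A : OperConn b) (hA : A.toOper = ρ) :
    (A.IsNilpotentForm → ∃ e : miuraFiber ρ ≃ springerFiber A.residue,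
      ∀ u : miuraFiber ρ, IsLimitBorel A LieEquiv.refl u (e u : LieSubalgebra ℂ 𝔤)) ∧
    (A.IsRegularForm → ∃ e : miuraFiber ρ ≃ flagVariety 𝔤,
      ∀ u : miuraFiber ρ, IsLimitBorel A LieEquiv.refl u (e u : LieSubalgebra ℂ 𝔤)) ∧
    (∀ (k : Loop 𝔤 ≃ₗ⁅LaurentSeries ℂ⁆ Loop 𝔤) (C : Loop 𝔤), IsUnipotentLogForm A k C →
      ∃ e : miuraFiber ρ ≃ springerFiber (loopCoeff (-1) C),
        ∀ u : miuraFiber ρ, IsLimitBorel A k u (e u : LieSubalgebra ℂ 𝔤)) := by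
  subst hA
  have : Nontrivial 𝔤 := LieAlgebra.IsSimple.nontrivial ℂ 𝔤
  obtain ⟨D⟩ := nonempty_principalData b
  refine ⟨fun h => exists_miuraFiber_equiv D A (h.isUnipotentLogForm D), fun h => ?_,
    fun k C h => exists_miuraFiber_equiv D A h⟩
  obtain ⟨e, he⟩ := exists_miuraFiber_equiv D A (h.isNilpotentForm.isUnipotentLogForm D)
  have hres : springerFiber (loopCoeff (-1) A.1) = flagVariety 𝔤 := by
    rw [h (-1) (by omega), springerFiber_zero]
  exact ⟨e.trans (Equiv.setCongr hres), he⟩
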